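/- **Theorem.** Manifolds are smooth, finite-dimensional, Hausdorff and second countable. A *contact manifold* $(M,H)$ is a manifold $M$ with a smooth hyperplane distribution $H\subseteq TM$ whose curvature $\kappa_H:\wedge^2H\to TM/H$, $(X,Y)\mapsto [X,Y] \bmod H$, is non-degenerate; a *contactomorphism* $(M,H)\to(M',H')$ is a diffeomorphism $\Phi:M\to M'$ with $d\Phi(H)=H'$. A *homogeneous symplectic manifold* is a principal $\mathbb R^\ast$-bundle $P\to M$ ($\mathbb R^\ast=\mathbb R\smallsetminus\{0\}$, acting by $h_t:P\to P$) with a symplectic form $\omega$ on its total space $P$ such that $h_t^\ast\omega=t\,\omega$ for all $t\in\mathbb R^\ast$; a morphism of homogeneous symplectic manifolds is an $\mathbb R^\ast$-equivariant diffeomorphism of the total spaces that preserves the symplectic forms. The category of contact manifolds and contactomorphisms is equivalent to the category of homogeneous symplectic manifolds and $\mathbb R^\ast$-equivariant symplectomorphisms. More precisely, there is an equivalence of categories that is given (up to natural isomorphism) by symplectization: it maps $(M,H)$, with normal line bundle $L=TM/H$, to the principal $\mathbb R^\ast$-bundle $$\widetilde L=L^\ast\smallsetminus 0=\{\alpha\in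 T^\ast M:\ \ker\alpha=H_{\tau(\alpha)}\}\subseteq T^\ast M,$$ where $\tau:T^\ast M\to M$ is the projection and $\mathbb R^\ast$ acts by fibrewise multiplication, with the symplectic form $\widetilde\omega=d\lambda$, where $\lambda_\alpha(v)=\alpha(d\tau(v))$ is the tautological 1-form; and it maps a contactomorphism $\Phi$ to $\alpha\mapsto\alpha\circ(d\Phi)^{-1}$. -/

import Mathlib

open scoped Manifold ContDiff Bundle

universe u

noncomputable section

namespace ContactDictionary

/-! ### Vector fields and differential forms on a manifold of dimension `m` -/

section Calculus

variable {m : ℕ} {M : Type u} [TopologicalSpace M] [ChartedSpace (EuclideanSpace ℝ (Fin m)) M]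
  [IsManifold (𝓡 m) ∞ M]

/-- The (set-theoretic) vector field `X` is smooth on `U`. -/
def IsSmoothFieldOn (X : ∀ x : M, TangentSpace (𝓡 m) x) (U : Set M) : Prop :=
  ContMDiffOn (𝓡 m) (𝓡 m).tangent ∞ (fun x => (⟨x, X x⟩ : TangentBundle (𝓡 m) M)) U

/-- `X` is a smooth vector field on `M`. -/
def IsSmoothField (X : ∀ x : M, TangentSpace (𝓡 m) x) : Prop :=
  ContMDiff (𝓡 m) (𝓡 m).tangent ∞ (fun x => (⟨x, X x⟩ : TangentBundle (𝓡 m) M))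

/-- The derivative `X(f)` of a function along a vector field. -/
def fieldDeriv (X : ∀ x : M, TangentSpace (𝓡 m) x) (f : M → ℝ) (x : M) : ℝ :=
  mfderiv (𝓡 m) 𝓘(ℝ, ℝ) f x (X x)

/-- The Lie bracket `[X, Y]` of vector fields. -/
def bracket (X Y : ∀ x : M, TangentSpace (𝓡 m) x) : ∀ x : M, TangentSpace (𝓡 m) x :=
  VectorField.mlieBracket (𝓡 m) X Y

/-- The exterior derivative of a 1-form `θ`, evaluated on vector fields:
`dθ(X, Y) = X(θ(Y)) - Y(θ(X)) - θ([X, Y])`. -/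
def dOneForm (θ : ∀ x : M, TangentSpace (𝓡 m) x →L[ℝ] ℝ)
    (X Y : ∀ x : M, TangentSpace (𝓡 m) x) (x : M) : ℝ :=
  fieldDeriv X (fun y => θ y (Y y)) x - fieldDeriv Y (fun y => θ y (X y)) x
    - θ x (bracket X Y x)

/-- The exterior derivative of a 2-form `Ω`, evaluated on vector fields. -/
def dTwoForm (Ω : ∀ x : M, TangentSpace (𝓡 m) x →L[ℝ] TangentSpace (𝓡 m) x →L[ℝ] ℝ)
    (X Y Z : ∀ x : M, TangentSpace (𝓡 m) x) (x : M) : ℝ :=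
  fieldDeriv X (fun y => Ω y (Y y) (Z y)) x
    - fieldDeriv Y (fun y => Ω y (X y) (Z y)) x
    + fieldDeriv Z (fun y => Ω y (X y) (Y y)) x
    - Ω x (bracket X Y x) (Z x)
    + Ω x (bracket X Z x) (Y x)
    - Ω x (bracket Y Z x) (X x)

/-- `Ω` is a symplectic form: a smooth, skew-symmetric, closed and non-degenerate 2-form. -/
structure IsSymplecticForm
    (Ω : ∀ x : M, TangentSpace (𝓡 m) x →L[ℝ] TangentSpace (𝓡 m) x →L[ℝ] ℝ) : Prop where
  smooth : ContMDiff (𝓡 m)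
    ((𝓡 m).prod 𝓘(ℝ, EuclideanSpace ℝ (Fin m) →L[ℝ] EuclideanSpace ℝ (Fin m) →L[ℝ] ℝ)) ∞
    (fun x => Bundle.TotalSpace.mk'
      (EuclideanSpace ℝ (Fin m) →L[ℝ] EuclideanSpace ℝ (Fin m) →L[ℝ] ℝ)
      (E := fun x : M => TangentSpace (𝓡 m) x →L[ℝ] TangentSpace (𝓡 m) x →L[ℝ] ℝ) x (Ω x))
  alternating : ∀ (x : M) (v : TangentSpace (𝓡 m) x), Ω x v v = 0
  closed : ∀ X Y Z : (∀ x : M, TangentSpace (𝓡 m) x),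
    IsSmoothField X → IsSmoothField Y → IsSmoothField Z → ∀ x, dTwoForm Ω X Y Z x = 0
  nondegenerate : ∀ (x : M) (v : TangentSpace (𝓡 m) x), (∀ w, Ω x v w = 0) → v = 0

/-! ### Contact structures -/

/-- `H` is a hyperplane distribution: each `H x` is a linear hyperplane of `T_x M`, and `H` is
a smooth subbundle, i.e. it has a smooth frame near every point. -/
structure IsHyperplaneDistribution (H : ∀ x : M, Submodule ℝ (TangentSpace (𝓡 m) x)) : Prop where
  codim_one : ∀ x, Module.finrank ℝ (TangentSpace (𝓡 m) x ⧸ H x) = 1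
  exists_frame : ∀ x : M, ∃ U : Set M, IsOpen U ∧ x ∈ U ∧
    ∃ (k : ℕ) (X : Fin k → ∀ y : M, TangentSpace (𝓡 m) y),
      (∀ i, IsSmoothFieldOn (X i) U) ∧
      ∀ y ∈ U, LinearIndependent ℝ (fun i => X i y) ∧
        Submodule.span ℝ (Set.range fun i => X i y) = H y

/-- `X` is a smooth section of the distribution `H`. -/
def IsSectionOf (H : ∀ x : M, Submodule ℝ (TangentSpace (𝓡 m) x))
    (X : ∀ x : M, TangentSpace (𝓡 m) x) : Prop :=
  IsSmoothField X ∧ ∀ x, X x ∈ H x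

/-- The curvature `κ_H(X, Y) = [X, Y] mod H`, with values in the normal bundle `TM / H`. -/
def curvature (H : ∀ x : M, Submodule ℝ (TangentSpace (𝓡 m) x))
    (X Y : ∀ x : M, TangentSpace (𝓡 m) x) (x : M) : TangentSpace (𝓡 m) x ⧸ H x :=
  (H x).mkQ (bracket X Y x)

/-- `H` is a contact structure: a hyperplane distribution whose curvature is non-degenerate at
each point, i.e. for each non-zero `v ∈ H x` there is `w ∈ H x` with `κ_H(v, w) ≠ 0`, the
curvature being computed with sections `X`, `Y` of `H` which extend `v`, `w`. -/
structure IsContactStructure (H : ∀ x : M, Submodule ℝ (TangentSpace (𝓡 m) x)) : Prop where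
  isHyperplaneDistribution : IsHyperplaneDistribution H
  nondegenerate : ∀ (x : M), ∀ v ∈ H x, v ≠ 0 →
    ∃ X Y : (∀ x : M, TangentSpace (𝓡 m) x),
      IsSectionOf H X ∧ IsSectionOf H Y ∧ X x = v ∧ curvature H X Y x ≠ 0

end Calculus

/-! ### Bundled manifolds -/

/-- Smooth, Hausdorff, second countable, finite dimensional manifolds (without boundary). -/
structure Mfd : Type (u + 1) where
  carrier : Type u
  dim : ℕ
  [topology : TopologicalSpace carrier]
  [charted : ChartedSpace (EuclideanSpace ℝ (Fin dim)) carrier]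
  [isManifold : IsManifold (𝓡 dim) ∞ carrier]
  [t2 : T2Space carrier]
  [secondCountable : SecondCountableTopology carrier]

instance : CoeSort Mfd.{u} (Type u) := ⟨Mfd.carrier⟩

attribute [instance] Mfd.topology Mfd.charted Mfd.isManifold Mfd.t2 Mfd.secondCountable

/-! ### The category of contact manifolds and contactomorphisms -/

/-- A contact manifold `(M, H)`. -/
structure ContactManifold : Type (u + 1) where
  M : Mfd.{u}
  H : ∀ x : M, Submodule ℝ (TangentSpace (𝓡 M.dim) x)
  isContact : IsContactStructure H

/-- A contactomorphism: a diffeomorphism `Φ` such that `dΦ` identifies the contact structures. -/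
@[ext]
structure Contactomorphism (C C' : ContactManifold.{u}) : Type u where
  toDiffeo : Diffeomorph (𝓡 C.M.dim) (𝓡 C'.M.dim) C.M C'.M ∞
  map_H : ∀ x : C.M, (C.H x).map (mfderiv (𝓡 C.M.dim) (𝓡 C'.M.dim) toDiffeo x).toLinearMap
    = C'.H (toDiffeo x)

/-- The chain rule for diffeomorphisms. -/
theorem mfderiv_trans_apply {A B C : Mfd.{u}}
    (f : Diffeomorph (𝓡 A.dim) (𝓡 B.dim) A B ∞) (g : Diffeomorph (𝓡 B.dim) (𝓡 C.dim) B C ∞)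
    (x : A) : mfderiv (𝓡 A.dim) (𝓡 C.dim) (f.trans g) x =
      (mfderiv (𝓡 B.dim) (𝓡 C.dim) g (f x)).comp (mfderiv (𝓡 A.dim) (𝓡 B.dim) f x) := by
  rw [Diffeomorph.coe_trans]
  exact mfderiv_comp x (g.mdifferentiable (by simp) (f x)) (f.mdifferentiable (by simp) x)

/-- The identity contactomorphism. -/
def Contactomorphism.refl (C : ContactManifold.{u}) : Contactomorphism C C where
  toDiffeo := Diffeomorph.refl (𝓡 C.M.dim) C.M ∞
  map_H x := by
    simp only [Diffeomorph.coe_refl, mfderiv_id]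
    exact Submodule.map_id _

/-- The composition of contactomorphisms. -/
def Contactomorphism.trans {C C' C'' : ContactManifold.{u}} (f : Contactomorphism C C')
    (g : Contactomorphism C' C'') : Contactomorphism C C'' where
  toDiffeo := f.toDiffeo.trans g.toDiffeo
  map_H x := by
    rw [mfderiv_trans_apply]
    have h := Submodule.map_comp
      (mfderiv (𝓡 C.M.dim) (𝓡 C'.M.dim) f.toDiffeo x).toLinearMap
      (mfderiv (𝓡 C'.M.dim) (𝓡 C''.M.dim) g.toDiffeo (f.toDiffeo x)).toLinearMap (C.H x)
    exact h.trans ((congrArg _ (f.map_H x)).trans (g.map_H (f.toDiffeo x)))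

instance : CategoryTheory.Category ContactManifold.{u} where
  Hom := Contactomorphism
  id := Contactomorphism.refl
  comp f g := f.trans g
  id_comp f := by apply Contactomorphism.ext; exact Diffeomorph.ext fun _ => rfl
  comp_id f := by apply Contactomorphism.ext; exact Diffeomorph.ext fun _ => rfl
  assoc f g h := by apply Contactomorphism.ext; exact Diffeomorph.ext fun _ => rfl

/-! ### The category of homogeneous symplectic manifolds -/

/-- A homogeneous manifold: a (smooth) principal `ℝ*`-bundle `proj : P → M`. The total space `P`
carries a smooth action of the Lie group `ℝˣ` that preserves the fibres, and `P` is locally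
(over `M`) equivariantly diffeomorphic to `U × ℝˣ`, where `ℝˣ` acts by multiplication. -/
structure HomogeneousManifold : Type (u + 1) where
  P : Mfd.{u}
  M : Mfd.{u}
  proj : P → M
  smooth_proj : ContMDiff (𝓡 P.dim) (𝓡 M.dim) ∞ proj
  [action : MulAction ℝˣ P]
  smooth_smul : ContMDiffSMul 𝓘(ℝ, ℝ) (𝓡 P.dim) ∞ ℝˣ P
  proj_smul : ∀ (t : ℝˣ) (p : P), proj (t • p) = proj p
  exists_trivialization : ∀ x : M, ∃ e : Bundle.Trivialization ℝˣ proj, x ∈ e.baseSet ∧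
    ContMDiffOn (𝓡 P.dim) ((𝓡 M.dim).prod 𝓘(ℝ, ℝ)) ∞ e e.source ∧
    ContMDiffOn ((𝓡 M.dim).prod 𝓘(ℝ, ℝ)) (𝓡 P.dim) ∞ e.toOpenPartialHomeomorph.symm e.target ∧
    ∀ p ∈ e.source, ∀ t : ℝˣ, (e (t • p)).2 = t * (e p).2

attribute [instance] HomogeneousManifold.action

/-- A homogeneous symplectic manifold: a homogeneous manifold with a symplectic form `Ω` on its
total space that is homogeneous of degree 1, i.e. `h_t^* Ω = t Ω` for each `t ∈ ℝ*`, where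
`h_t p = t • p`. -/
structure HomogeneousSymplecticManifold : Type (u + 1) extends HomogeneousManifold.{u} where
  Ω : ∀ p : P, TangentSpace (𝓡 P.dim) p →L[ℝ] TangentSpace (𝓡 P.dim) p →L[ℝ] ℝ
  isSymplectic : IsSymplecticForm Ω
  homogeneous : ∀ (t : ℝˣ) (p : P) (v w : TangentSpace (𝓡 P.dim) p),
    Ω (t • p) (mfderiv (𝓡 P.dim) (𝓡 P.dim) (fun q : P => t • q) p v)
      (mfderiv (𝓡 P.dim) (𝓡 P.dim) (fun q : P => t • q) p w) = (t : ℝ) * Ω p v w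

/-- An `ℝ*`-equivariant symplectomorphism: an equivariant diffeomorphism of the total spaces
that pulls back the symplectic form of the target to the one of the source. -/
@[ext]
structure EquivariantSymplectomorphism (S S' : HomogeneousSymplecticManifold.{u}) : Type u where
  toDiffeo : Diffeomorph (𝓡 S.P.dim) (𝓡 S'.P.dim) S.P S'.P ∞
  map_smul : ∀ (t : ℝˣ) (p : S.P), toDiffeo (t • p) = t • toDiffeo p
  map_Ω : ∀ (p : S.P) (v w : TangentSpace (𝓡 S.P.dim) p),
    S'.Ω (toDiffeo p) (mfderiv (𝓡 S.P.dim) (𝓡 S'.P.dim) toDiffeo p v)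
      (mfderiv (𝓡 S.P.dim) (𝓡 S'.P.dim) toDiffeo p w) = S.Ω p v w

/-- The identity symplectomorphism. -/
def EquivariantSymplectomorphism.refl (S : HomogeneousSymplecticManifold.{u}) :
    EquivariantSymplectomorphism S S where
  toDiffeo := Diffeomorph.refl (𝓡 S.P.dim) S.P ∞
  map_smul _ _ := rfl
  map_Ω p v w := by
    simp only [Diffeomorph.coe_refl, mfderiv_id]
    rfl

/-- The composition of equivariant symplectomorphisms. -/
def EquivariantSymplectomorphism.trans {S S' S'' : HomogeneousSymplecticManifold.{u}}
    (f : EquivariantSymplectomorphism S S') (g : EquivariantSymplectomorphism S' S'') :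
    EquivariantSymplectomorphism S S'' where
  toDiffeo := f.toDiffeo.trans g.toDiffeo
  map_smul t p := by
    simp only [Diffeomorph.coe_trans, Function.comp_apply, f.map_smul, g.map_smul]
  map_Ω p v w := by
    rw [mfderiv_trans_apply]
    exact (g.map_Ω (f.toDiffeo p) _ _).trans (f.map_Ω p v w)

instance : CategoryTheory.Category HomogeneousSymplecticManifold.{u} where
  Hom := EquivariantSymplectomorphism
  id := EquivariantSymplectomorphism.refl
  comp f g := f.trans g
  id_comp f := by apply EquivariantSymplectomorphism.ext; exact Diffeomorph.ext fun _ => rfl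
  comp_id f := by apply EquivariantSymplectomorphism.ext; exact Diffeomorph.ext fun _ => rfl
  assoc f g h := by apply EquivariantSymplectomorphism.ext; exact Diffeomorph.ext fun _ => rfl

/-! ### The symplectization -/

/-- The total space of the cotangent bundle of `M`. -/
abbrev CotangentBundle (M : Mfd.{u}) : Type u :=
  Bundle.TotalSpace (EuclideanSpace ℝ (Fin M.dim) →L[ℝ] ℝ)
    (fun x : M => TangentSpace (𝓡 M.dim) x →L[ℝ] ℝ)

/-- The model with corners of the cotangent bundle. -/
abbrev cotangentModel (M : Mfd.{u}) :=
  (𝓡 M.dim).prod 𝓘(ℝ, EuclideanSpace ℝ (Fin M.dim) →L[ℝ] ℝ)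

/-- The pull-back along `ε : P → T*M` of the tautological (Liouville) 1-form of `T*M`:
`v ↦ ⟨ε p, d(τ ∘ ε) v⟩`, where `τ : T*M → M` is the projection. -/
def pullbackTautological {P M : Mfd.{u}} (ε : P → CotangentBundle M) (p : P) :
    TangentSpace (𝓡 P.dim) p →L[ℝ] ℝ :=
  (ε p).2.comp (mfderiv (𝓡 P.dim) (𝓡 M.dim) (fun q => (ε q).proj) p)

/-- Let `L = TM/H` be the normal bundle of the contact manifold `C = (M, H)`. The bundle `L^*`
is the bundle of covectors on `M` that vanish on `H`, and so `L^* ∖ 0`, the homogeneous manifold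
of `L`, consists of the covectors `α ∈ T_x^* M` with `ker α = H x`, inside `T^* M`. This says that
`ε` identifies `S` with the symplectization of `C`: it is an `ℝ*`-equivariant diffeomorphism
onto the submanifold `L^* ∖ 0` of `T^* M`, and the symplectic form of `S` corresponds to the
exterior derivative of the tautological 1-form `v ↦ ⟨α, dτ(v) mod H⟩` of `L^* ∖ 0`. -/
structure IsSymplectization (C : ContactManifold.{u}) (S : HomogeneousSymplecticManifold.{u})
    (ε : S.P → CotangentBundle C.M) : Prop where
  smooth : ContMDiff (𝓡 S.P.dim) (cotangentModel C.M) ∞ ε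
  isEmbedding : Topology.IsEmbedding ε
  immersion : ∀ p, Function.Injective (mfderiv (𝓡 S.P.dim) (cotangentModel C.M) ε p)
  range_eq : Set.range ε = {α | LinearMap.ker α.2.toLinearMap = C.H α.proj}
  map_smul : ∀ (t : ℝˣ) (p : S.P), ε (t • p) = ⟨(ε p).proj, (t : ℝ) • (ε p).2⟩
  Ω_eq : ∀ X Y : (∀ p : S.P, TangentSpace (𝓡 S.P.dim) p), IsSmoothField X → IsSmoothField Y →
    ∀ p, S.Ω p (X p) (Y p) = dOneForm (pullbackTautological ε) X Y p

open CategoryTheory in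
/-- The functor `F` is the symplectization functor: it maps each contact manifold to its
symplectization (up to the identification `ε C`), and each contactomorphism `Φ` to its
cotangent lift `α ↦ α ∘ (dΦ)⁻¹`. -/
def IsSymplectizationFunctor
    (F : ContactManifold.{u} ⥤ HomogeneousSymplecticManifold.{u}) : Prop :=
  ∃ ε : ∀ C : ContactManifold.{u}, (F.obj C).P → CotangentBundle C.M,
    (∀ C, IsSymplectization C (F.obj C) (ε C)) ∧
    ∀ (C C' : ContactManifold.{u}) (Φ : C ⟶ C') (p : (F.obj C).P),
      ∃ β : TangentSpace (𝓡 C'.M.dim) (Φ.toDiffeo (ε C p).proj) →L[ℝ] ℝ,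
        ε C' ((F.map Φ).toDiffeo p) = ⟨Φ.toDiffeo (ε C p).proj, β⟩ ∧
        β.comp (mfderiv (𝓡 C.M.dim) (𝓡 C'.M.dim) Φ.toDiffeo (ε C p).proj) = (ε C p).2

end ContactDictionary

end

noncomputable section

set_option synthInstance.maxHeartbeats 200000
set_option linter.unusedSectionVars false

/-! Let π : P → M be a homogeneous symplectic manifold, E the Euler field (the generator of the
action) and λ = Ω(E, ·). Homogeneity says that the Lie derivative of Ω along E is Ω. Since Ω is
closed, Cartan's formula gives Ω = dλ (`extD_liouville`). Moreover λ(E) = 0 and λ is homogeneous of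
degree 1, so λ at p is the pull-back of a unique covector on the tangent space of M at π(p). This
covector is non-zero, because E is non-zero and Ω is non-degenerate, and it scales with p. Its
kernel therefore depends on π(p) only and defines a hyperplane field H on M.

A local section σ with fibre coordinate c turns this into λ = c π*θ with θ = σ*λ, and hence Ω = dc ∧
π*θ + c π*dθ. In this formula, non-degeneracy of Ω amounts to non-degeneracy of dθ on H = ker θ. As
dθ(X, Y) = -θ([X, Y]) for sections X, Y of H, that is the contact condition. The formula is used in
both directions: from Ω to H in `isContactStructure_baseContact`, and from H to Ω, with λ the
tautological form on L* ∖ 0, in `symplForm_nondegenerate`.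

For morphisms, an equivariant symplectomorphism preserves E, hence λ, so it is the cotangent lift of
the diffeomorphism that it induces on the bases, and this diffeomorphism preserves the kernels
(`exists_base_diffeomorph`). Conversely, the covectors of P over x form a full punctured line, so a
diffeomorphism that preserves the distributions lifts pointwise. The lift is unique
(`IsLiftAt.unique`), smooth, and pulls λ' back to λ, hence Ω' to Ω (`exists_lift`).

Lifts are treated between arbitrary homogeneous symplectic manifolds, which makes one existence
statement serve three purposes. Lifting contactomorphisms gives the functor, with its laws supplied
by uniqueness. Descending and comparing lifts gives fullness. Lifting the identity of M between P
and the symplectization of (M, H) gives essential surjectivity. Faithfulness holds because the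
projections are onto. -/

namespace ContactDictionary

/-! ### Exterior calculus on a normed space -/

section NormedSpace

variable {E F : Type*} [NormedAddCommGroup E] [NormedSpace ℝ E]
  [NormedAddCommGroup F] [NormedSpace ℝ F]

/-- The exterior derivative of a 1-form on a normed space. -/
def altD (η : E → E →L[ℝ] ℝ) (y : E) : E →L[ℝ] E →L[ℝ] ℝ :=
  fderiv ℝ η y - (fderiv ℝ η y).flip

theorem altD_apply (η : E → E →L[ℝ] ℝ) (y v w : E) :
    altD η y v w = fderiv ℝ η y v w - fderiv ℝ η y w v := rfl

/-- The exterior derivative of a 2-form on a normed space. -/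
def altD₂ (β : E → E →L[ℝ] E →L[ℝ] ℝ) (y a b c : E) : ℝ :=
  fderiv ℝ β y a b c - fderiv ℝ β y b a c + fderiv ℝ β y c a b

theorem altD_congr {η η' : E → E →L[ℝ] ℝ} {y : E} (h : η =ᶠ[nhds y] η') :
    altD η y = altD η' y := by
  simp only [altD, h.fderiv_eq]

theorem altD₂_congr {β β' : E → E →L[ℝ] E →L[ℝ] ℝ} {y : E} (h : β =ᶠ[nhds y] β') :
    altD₂ β y = altD₂ β' y := by
  funext a b c
  simp only [altD₂, h.fderiv_eq]

/-- The transposition of bilinear forms, as a continuous linear map. -/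
def flipCLM (E : Type*) [NormedAddCommGroup E] [NormedSpace ℝ E] :
    (E →L[ℝ] E →L[ℝ] ℝ) →L[ℝ] E →L[ℝ] E →L[ℝ] ℝ :=
  (ContinuousLinearMap.flipₗᵢ ℝ E E ℝ).toContinuousLinearEquiv.toContinuousLinearMap

theorem contDiffAt_altD {η : E → E →L[ℝ] ℝ} {y : E} (h : ContDiffAt ℝ ∞ η y) :
    ContDiffAt ℝ ∞ (altD η) y := by
  have h1 : ContDiffAt ℝ ∞ (fderiv ℝ η) y := h.fderiv_right (by simp)
  have h2 : ContDiff ℝ ∞ (flipCLM E) := ContinuousLinearMap.contDiff _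
  exact h1.sub (h2.contDiffAt.comp y h1)

/-- The exterior derivative commutes with pull-backs. -/
theorem altD_pullback {η : F → F →L[ℝ] ℝ} {g : E → F} {y : E}
    (hη : DifferentiableAt ℝ η (g y)) (hg : ContDiffAt ℝ ∞ g y) :
    altD (fun z => (η (g z)).comp (fderiv ℝ g z)) y =
      (altD η (g y)).bilinearComp (fderiv ℝ g y) (fderiv ℝ g y) := by
  have hg1 : DifferentiableAt ℝ g y := hg.differentiableAt (by simp)
  have hg2 : DifferentiableAt ℝ (fderiv ℝ g) y :=
    (hg.fderiv_right (m := ∞) (by simp)).differentiableAt (by simp)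
  -- The product rule leaves a term η(D²g(v, w)); it is symmetric in v and w and cancels in the
  -- antisymmetrization.
  have hsymm : IsSymmSndFDerivAt ℝ g y := hg.isSymmSndFDerivAt (by simp; exact ENat.LEInfty.out)
  have key : ∀ v w, fderiv ℝ (fun z => (η (g z)).comp (fderiv ℝ g z)) y v w =
      η (g y) (fderiv ℝ (fderiv ℝ g) y v w) + fderiv ℝ η (g y) (fderiv ℝ g y v) (fderiv ℝ g y w) := by
    intro v w
    have := (hη.hasFDerivAt.comp y hg1.hasFDerivAt).clm_comp hg2.hasFDerivAt
    have h2 := this.fderiv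
    simp only [Function.comp_apply] at h2
    rw [h2]
    simp
  ext v w
  simp only [ContinuousLinearMap.bilinearComp_apply, altD_apply, key, hsymm v w]
  ring

theorem altD_smul {η : E → E →L[ℝ] ℝ} {c : E → ℝ} {y : E}
    (hη : DifferentiableAt ℝ η y) (hc : DifferentiableAt ℝ c y) (v w : E) :
    altD (fun z => c z • η z) y v w =
      fderiv ℝ c y v * η y w - fderiv ℝ c y w * η y v + c y * altD η y v w := by
  have := (hc.hasFDerivAt.smul hη.hasFDerivAt).fderiv
  simp only [altD_apply]
  rw [show (fun z => c z • η z) = c • η from rfl, this]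
  simp
  ring

/-- Cartan's formula for the exterior derivative of a 1-form. -/
theorem altD_eq_lieBracket {η : E → E →L[ℝ] ℝ} {X Y : E → E} {y : E}
    (hη : DifferentiableAt ℝ η y) (hX : DifferentiableAt ℝ X y) (hY : DifferentiableAt ℝ Y y) :
    fderiv ℝ (fun z => η z (Y z)) y (X y) - fderiv ℝ (fun z => η z (X z)) y (Y y)
      - η y (VectorField.lieBracket ℝ X Y y) = altD η y (X y) (Y y) := by
  rw [(hη.hasFDerivAt.clm_apply hY.hasFDerivAt).fderiv,
    (hη.hasFDerivAt.clm_apply hX.hasFDerivAt).fderiv]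
  simp [VectorField.lieBracket, altD_apply]
  ring

/-- Cartan's formula for the exterior derivative of a 2-form. -/
theorem altD₂_eq_lieBracket {β : E → E →L[ℝ] E →L[ℝ] ℝ} {X Y Z : E → E} {y : E}
    (hβ : DifferentiableAt ℝ β y) (hX : DifferentiableAt ℝ X y) (hY : DifferentiableAt ℝ Y y)
    (hZ : DifferentiableAt ℝ Z y) (halt : ∀ v w, β y v w = - β y w v) :
    fderiv ℝ (fun z => β z (Y z) (Z z)) y (X y) - fderiv ℝ (fun z => β z (X z) (Z z)) y (Y y)
      + fderiv ℝ (fun z => β z (X z) (Y z)) y (Z y)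
      - β y (VectorField.lieBracket ℝ X Y y) (Z y) + β y (VectorField.lieBracket ℝ X Z y) (Y y)
      - β y (VectorField.lieBracket ℝ Y Z y) (X y) = altD₂ β y (X y) (Y y) (Z y) := by
  rw [((hβ.hasFDerivAt.clm_apply hY.hasFDerivAt).clm_apply hZ.hasFDerivAt).fderiv,
    ((hβ.hasFDerivAt.clm_apply hX.hasFDerivAt).clm_apply hZ.hasFDerivAt).fderiv,
    ((hβ.hasFDerivAt.clm_apply hX.hasFDerivAt).clm_apply hY.hasFDerivAt).fderiv]
  simp [VectorField.lieBracket, altD₂]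
  -- The product rule leaves some derivatives of fields in the second slot, while the bracket terms
  -- have them in the first. Skew-symmetry makes them cancel.
  rw [halt (Y y) (fderiv ℝ Z y (X y)), halt (X y) (fderiv ℝ Z y (Y y)),
    halt (X y) (fderiv ℝ Y y (Z y))]
  ring

/-- The six second derivatives of η cancel in pairs, because the second derivative is symmetric. -/
theorem altD₂_altD {η : E → E →L[ℝ] ℝ} {y : E} (h : ContDiffAt ℝ ∞ η y) (a b c : E) :
    altD₂ (altD η) y a b c = 0 := by
  have h1 : DifferentiableAt ℝ (fderiv ℝ η) y :=
    (h.fderiv_right (m := ∞) (by simp)).differentiableAt (by simp)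
  have hsymm : IsSymmSndFDerivAt ℝ η y := h.isSymmSndFDerivAt (by simp; exact ENat.LEInfty.out)
  have key : ∀ u v w, fderiv ℝ (altD η) y u v w =
      fderiv ℝ (fderiv ℝ η) y u v w - fderiv ℝ (fderiv ℝ η) y u w v := by
    intro u v w
    have h2 := (((contDiffAt_altD h).differentiableAt (by simp)).hasFDerivAt.clm_apply
      (hasFDerivAt_const v y)).clm_apply (hasFDerivAt_const w y)
    have h3 := (((h1.hasFDerivAt.clm_apply (hasFDerivAt_const v y)).clm_apply
      (hasFDerivAt_const w y)).sub ((h1.hasFDerivAt.clm_apply (hasFDerivAt_const w y)).clm_apply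
      (hasFDerivAt_const v y)))
    have h4 := congrArg (fun L => L u) (h2.unique h3)
    simpa using h4
  simp only [altD₂, key]
  rw [hsymm a b, hsymm a c, hsymm b c]
  ring

end NormedSpace

/-! ### Forms on manifolds in coordinates -/

section Forms

open Set Filter Topology

variable {E F G : Type*} [NormedAddCommGroup E] [NormedSpace ℝ E]
  [NormedAddCommGroup F] [NormedSpace ℝ F] [NormedAddCommGroup G] [NormedSpace ℝ G]
  {M : Type*} [TopologicalSpace M] [ChartedSpace E M]
  {N : Type*} [TopologicalSpace N] [ChartedSpace F N]
  {K : Type*} [TopologicalSpace K] [ChartedSpace G K]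

/-- The pull-back of a 1-form. -/
def pullForm (f : N → M) (θ : ∀ x : M, TangentSpace 𝓘(ℝ, E) x →L[ℝ] ℝ) (y : N) :
    TangentSpace 𝓘(ℝ, F) y →L[ℝ] ℝ :=
  (θ (f y)).comp (mfderiv 𝓘(ℝ, F) 𝓘(ℝ, E) f y)

/-- The pull-back of a 2-form. -/
def pullForm₂ (f : N → M)
    (Ω : ∀ x : M, TangentSpace 𝓘(ℝ, E) x →L[ℝ] TangentSpace 𝓘(ℝ, E) x →L[ℝ] ℝ) (y : N) :
    TangentSpace 𝓘(ℝ, F) y →L[ℝ] TangentSpace 𝓘(ℝ, F) y →L[ℝ] ℝ :=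
  show F →L[ℝ] F →L[ℝ] ℝ from (show E →L[ℝ] E →L[ℝ] ℝ from Ω (f y)).bilinearComp
    (show F →L[ℝ] E from mfderiv 𝓘(ℝ, F) 𝓘(ℝ, E) f y)
    (show F →L[ℝ] E from mfderiv 𝓘(ℝ, F) 𝓘(ℝ, E) f y)

theorem pullForm_congr {f g : N → M} {y : N} (h : f =ᶠ[𝓝 y] g)
    (θ : ∀ x : M, TangentSpace 𝓘(ℝ, E) x →L[ℝ] ℝ) :
    (pullForm f θ y : TangentSpace 𝓘(ℝ, F) y →L[ℝ] ℝ) = pullForm g θ y := by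
  have h1 := h.mfderiv_eq (I := 𝓘(ℝ, F)) (I' := 𝓘(ℝ, E))
  -- The two sides live over base points that are only propositionally equal. Every fibre is the
  -- model space by definition, so the claim is stated for free base points and settled by
  -- substitution. The same device recurs below.
  have h2 : ∀ (a b : M) (L L' : F →L[ℝ] E), a = b → L = L' →
    (show E →L[ℝ] ℝ from θ a).comp L = (show E →L[ℝ] ℝ from θ b).comp L' := by
    rintro a b L L' rfl rfl; rfl
  exact h2 _ _ _ _ h.eq_of_nhds h1

theorem pullForm₂_congr {f g : N → M} {y : N} (h : f =ᶠ[𝓝 y] g)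
    (Ω : ∀ x : M, TangentSpace 𝓘(ℝ, E) x →L[ℝ] TangentSpace 𝓘(ℝ, E) x →L[ℝ] ℝ) :
    (pullForm₂ f Ω y : TangentSpace 𝓘(ℝ, F) y →L[ℝ] TangentSpace 𝓘(ℝ, F) y →L[ℝ] ℝ) =
      pullForm₂ g Ω y := by
  have h1 := h.mfderiv_eq (I := 𝓘(ℝ, F)) (I' := 𝓘(ℝ, E))
  have h2 : ∀ (a b : M) (L L' : F →L[ℝ] E), a = b → L = L' →
    (show E →L[ℝ] E →L[ℝ] ℝ from Ω a).bilinearComp L L =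
      (show E →L[ℝ] E →L[ℝ] ℝ from Ω b).bilinearComp L' L' := by
    rintro a b L L' rfl rfl; rfl
  exact h2 _ _ _ _ h.eq_of_nhds h1

theorem pullForm_comp {f : N → M} {g : K → N} {z : K}
    (hf : MDifferentiableAt 𝓘(ℝ, F) 𝓘(ℝ, E) f (g z))
    (hg : MDifferentiableAt 𝓘(ℝ, G) 𝓘(ℝ, F) g z)
    (θ : ∀ x : M, TangentSpace 𝓘(ℝ, E) x →L[ℝ] ℝ) :
    (pullForm (f ∘ g) θ z : TangentSpace 𝓘(ℝ, G) z →L[ℝ] ℝ) =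
      pullForm g (pullForm f θ : ∀ y : N, TangentSpace 𝓘(ℝ, F) y →L[ℝ] ℝ) z := by
  simp only [pullForm, mfderiv_comp z hf hg]
  rfl

theorem pullForm₂_comp {f : N → M} {g : K → N} {z : K}
    (hf : MDifferentiableAt 𝓘(ℝ, F) 𝓘(ℝ, E) f (g z))
    (hg : MDifferentiableAt 𝓘(ℝ, G) 𝓘(ℝ, F) g z)
    (Ω : ∀ x : M, TangentSpace 𝓘(ℝ, E) x →L[ℝ] TangentSpace 𝓘(ℝ, E) x →L[ℝ] ℝ) :
    (pullForm₂ (f ∘ g) Ω z : TangentSpace 𝓘(ℝ, G) z →L[ℝ] TangentSpace 𝓘(ℝ, G) z →L[ℝ] ℝ) =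
      pullForm₂ g (pullForm₂ f Ω :
        ∀ y : N, TangentSpace 𝓘(ℝ, F) y →L[ℝ] TangentSpace 𝓘(ℝ, F) y →L[ℝ] ℝ) z := by
  simp only [pullForm₂, mfderiv_comp z hf hg]
  rfl

/-- A 1-form in the chart at `x₀`. -/
def chartForm (x₀ : M) (θ : ∀ x : M, TangentSpace 𝓘(ℝ, E) x →L[ℝ] ℝ) : E → E →L[ℝ] ℝ :=
  pullForm (extChartAt 𝓘(ℝ, E) x₀).symm θ

/-- A 2-form in the chart at `x₀`. -/
def chartForm₂ (x₀ : M)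
    (Ω : ∀ x : M, TangentSpace 𝓘(ℝ, E) x →L[ℝ] TangentSpace 𝓘(ℝ, E) x →L[ℝ] ℝ) :
    E → E →L[ℝ] E →L[ℝ] ℝ :=
  pullForm₂ (extChartAt 𝓘(ℝ, E) x₀).symm Ω

/-- A map between manifolds in the charts at `y₀` and `x₀`. -/
def chartMap (y₀ : N) (x₀ : M) (f : N → M) : F → E :=
  extChartAt 𝓘(ℝ, E) x₀ ∘ f ∘ (extChartAt 𝓘(ℝ, F) y₀).symm

theorem mdifferentiableAt_symm_chart [IsManifold 𝓘(ℝ, E) 1 M] {x₀ : M} {y : E}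
    (hy : y ∈ (extChartAt 𝓘(ℝ, E) x₀).target) :
    MDifferentiableAt 𝓘(ℝ, E) 𝓘(ℝ, E) (extChartAt 𝓘(ℝ, E) x₀).symm y := by
  have := mdifferentiableWithinAt_extChartAt_symm (I := 𝓘(ℝ, E)) hy
  simpa [mdifferentiableWithinAt_univ] using this

theorem mdifferentiableAt_chart [IsManifold 𝓘(ℝ, E) 1 M] {x₀ x : M}
    (hx : x ∈ (extChartAt 𝓘(ℝ, E) x₀).source) :
    MDifferentiableAt 𝓘(ℝ, E) 𝓘(ℝ, E) (extChartAt 𝓘(ℝ, E) x₀) x :=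
  mdifferentiableAt_extChartAt (by simpa using hx)

theorem chartMap_mdifferentiableAt [IsManifold 𝓘(ℝ, E) 1 M] [IsManifold 𝓘(ℝ, F) 1 N]
    {f : N → M} {y₀ : N} {x₀ : M} {y : F} (hy : y ∈ (extChartAt 𝓘(ℝ, F) y₀).target)
    (hx : f ((extChartAt 𝓘(ℝ, F) y₀).symm y) ∈ (extChartAt 𝓘(ℝ, E) x₀).source)
    (hf : MDifferentiableAt 𝓘(ℝ, F) 𝓘(ℝ, E) f ((extChartAt 𝓘(ℝ, F) y₀).symm y)) :
    MDifferentiableAt 𝓘(ℝ, F) 𝓘(ℝ, E) (chartMap y₀ x₀ f : F → E) y :=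
  MDifferentiableAt.comp (I' := 𝓘(ℝ, E)) y (mdifferentiableAt_chart hx)
    (hf.comp (I' := 𝓘(ℝ, F)) y (mdifferentiableAt_symm_chart hy))

theorem symm_comp_chartMap [IsManifold 𝓘(ℝ, F) 1 N]
    {f : N → M} {y₀ : N} {x₀ : M} {y : F} (hy : y ∈ (extChartAt 𝓘(ℝ, F) y₀).target)
    (hx : f ((extChartAt 𝓘(ℝ, F) y₀).symm y) ∈ (extChartAt 𝓘(ℝ, E) x₀).source)
    (hf : MDifferentiableAt 𝓘(ℝ, F) 𝓘(ℝ, E) f ((extChartAt 𝓘(ℝ, F) y₀).symm y)) :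
    f ∘ (extChartAt 𝓘(ℝ, F) y₀).symm =ᶠ[𝓝 y]
      (extChartAt 𝓘(ℝ, E) x₀).symm ∘ chartMap y₀ x₀ f := by
  have hc : ContinuousAt (f ∘ (extChartAt 𝓘(ℝ, F) y₀).symm) y :=
    (hf.comp y (mdifferentiableAt_symm_chart hy)).continuousAt
  filter_upwards [hc.preimage_mem_nhds ((isOpen_extChartAt_source x₀).mem_nhds hx)] with z hz
  exact ((extChartAt 𝓘(ℝ, E) x₀).left_inv hz).symm

/-- Near y, f after the inverse chart of N equals the inverse chart of M after the chart expression
of f, and pull-back is functorial. The point y need not be the centre of the chart, since the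
identity is differentiated later. -/
theorem chartForm_pullForm [IsManifold 𝓘(ℝ, E) 1 M] [IsManifold 𝓘(ℝ, F) 1 N]
    {f : N → M} {y₀ : N} {x₀ : M} {y : F} (hy : y ∈ (extChartAt 𝓘(ℝ, F) y₀).target)
    (hx : f ((extChartAt 𝓘(ℝ, F) y₀).symm y) ∈ (extChartAt 𝓘(ℝ, E) x₀).source)
    (hf : MDifferentiableAt 𝓘(ℝ, F) 𝓘(ℝ, E) f ((extChartAt 𝓘(ℝ, F) y₀).symm y))
    (θ : ∀ x : M, TangentSpace 𝓘(ℝ, E) x →L[ℝ] ℝ) :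
    chartForm y₀ (pullForm f θ : ∀ y : N, TangentSpace 𝓘(ℝ, F) y →L[ℝ] ℝ) y =
      (chartForm x₀ θ (chartMap y₀ x₀ f y)).comp (fderiv ℝ (chartMap y₀ x₀ f) y) := by
  have hx' : chartMap y₀ x₀ f y ∈ (extChartAt 𝓘(ℝ, E) x₀).target :=
    (extChartAt 𝓘(ℝ, E) x₀).map_source hx
  refine (pullForm_comp hf (mdifferentiableAt_symm_chart hy) θ).symm.trans ?_
  refine (pullForm_congr (symm_comp_chartMap hy hx hf) θ).trans ?_
  refine (pullForm_comp (mdifferentiableAt_symm_chart hx')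
    (chartMap_mdifferentiableAt hy hx hf) θ).trans ?_
  rw [← mfderiv_eq_fderiv]
  rfl

theorem chartForm₂_pullForm₂ [IsManifold 𝓘(ℝ, E) 1 M] [IsManifold 𝓘(ℝ, F) 1 N]
    {f : N → M} {y₀ : N} {x₀ : M} {y : F} (hy : y ∈ (extChartAt 𝓘(ℝ, F) y₀).target)
    (hx : f ((extChartAt 𝓘(ℝ, F) y₀).symm y) ∈ (extChartAt 𝓘(ℝ, E) x₀).source)
    (hf : MDifferentiableAt 𝓘(ℝ, F) 𝓘(ℝ, E) f ((extChartAt 𝓘(ℝ, F) y₀).symm y))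
    (Ω : ∀ x : M, TangentSpace 𝓘(ℝ, E) x →L[ℝ] TangentSpace 𝓘(ℝ, E) x →L[ℝ] ℝ) :
    chartForm₂ y₀ (pullForm₂ f Ω :
        ∀ y : N, TangentSpace 𝓘(ℝ, F) y →L[ℝ] TangentSpace 𝓘(ℝ, F) y →L[ℝ] ℝ) y =
      (chartForm₂ x₀ Ω (chartMap y₀ x₀ f y)).bilinearComp (fderiv ℝ (chartMap y₀ x₀ f) y)
        (fderiv ℝ (chartMap y₀ x₀ f) y) := by
  have hx' : chartMap y₀ x₀ f y ∈ (extChartAt 𝓘(ℝ, E) x₀).target :=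
    (extChartAt 𝓘(ℝ, E) x₀).map_source hx
  refine (pullForm₂_comp hf (mdifferentiableAt_symm_chart hy) Ω).symm.trans ?_
  refine (pullForm₂_congr (symm_comp_chartMap hy hx hf) Ω).trans ?_
  refine (pullForm₂_comp (mdifferentiableAt_symm_chart hx')
    (chartMap_mdifferentiableAt hy hx hf) Ω).trans ?_
  rw [← mfderiv_eq_fderiv]
  rfl

variable [IsManifold 𝓘(ℝ, E) ∞ M] [IsManifold 𝓘(ℝ, F) ∞ N]

/-- Smoothness of a 1-form at a point. -/
def SmoothFormAt (θ : ∀ x : M, TangentSpace 𝓘(ℝ, E) x →L[ℝ] ℝ) (x₀ : M) : Prop :=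
  ContMDiffAt 𝓘(ℝ, E) (𝓘(ℝ, E).prod 𝓘(ℝ, E →L[ℝ] ℝ)) ∞
    (fun x => Bundle.TotalSpace.mk' (E →L[ℝ] ℝ)
      (E := fun x : M => TangentSpace 𝓘(ℝ, E) x →L[ℝ] ℝ) x (θ x)) x₀

/-- Smoothness of a 2-form at a point. -/
def SmoothForm₂At
    (Ω : ∀ x : M, TangentSpace 𝓘(ℝ, E) x →L[ℝ] TangentSpace 𝓘(ℝ, E) x →L[ℝ] ℝ) (x₀ : M) : Prop :=
  ContMDiffAt 𝓘(ℝ, E) (𝓘(ℝ, E).prod 𝓘(ℝ, E →L[ℝ] E →L[ℝ] ℝ)) ∞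
    (fun x => Bundle.TotalSpace.mk' (E →L[ℝ] E →L[ℝ] ℝ)
      (E := fun x : M => TangentSpace 𝓘(ℝ, E) x →L[ℝ] TangentSpace 𝓘(ℝ, E) x →L[ℝ] ℝ) x (Ω x)) x₀

theorem contMDiffAt_iff_of_eventuallyEq_chart {f : M → G} {g : E → G}
    {x₀ : M} (h : f =ᶠ[𝓝 x₀] g ∘ extChartAt 𝓘(ℝ, E) x₀) :
    ContMDiffAt 𝓘(ℝ, E) 𝓘(ℝ, G) ∞ f x₀ ↔ ContDiffAt ℝ ∞ g (extChartAt 𝓘(ℝ, E) x₀ x₀) := by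
  rw [h.contMDiffAt_iff, ← contMDiffAt_iff_contDiffAt]
  constructor
  · intro H
    have h1 : ContMDiffAt 𝓘(ℝ, E) 𝓘(ℝ, E) ∞ (extChartAt 𝓘(ℝ, E) x₀).symm
        (extChartAt 𝓘(ℝ, E) x₀ x₀) :=
      (contMDiffOn_extChartAt_symm x₀).contMDiffAt (extChartAt_target_mem_nhds x₀)
    have h2 := ContMDiffAt.comp_of_eq H h1 (by simp)
    refine h2.congr_of_eventuallyEq ?_
    filter_upwards [extChartAt_target_mem_nhds (I := 𝓘(ℝ, E)) x₀] with y hy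
    exact congrArg g ((extChartAt 𝓘(ℝ, E) x₀).right_inv hy).symm
  · exact fun H => H.comp x₀ contMDiffAt_extChartAt

/-- The trivialization of the tangent bundle at x₀ is the derivative of the chart at x₀. This
connects bundle coordinates with the chart expressions of forms. -/
theorem symmL_eq_mfderiv {x₀ x : M} (hx : x ∈ (chartAt E x₀).source) (v : E) :
    (show E from (trivializationAt E (TangentSpace 𝓘(ℝ, E)) x₀).symmL ℝ x v) =
      mfderiv 𝓘(ℝ, E) 𝓘(ℝ, E) (extChartAt 𝓘(ℝ, E) x₀).symm (extChartAt 𝓘(ℝ, E) x₀ x) v := by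
  have h := TangentBundle.symmL_trivializationAt (I := 𝓘(ℝ, E)) hx
  simp only [modelWithCornersSelf_coe, range_id, mfderivWithin_univ] at h
  exact congrArg (fun L : E →L[ℝ] E => L v) h

/-- The bundle coordinates of θ near x₀ are θ composed with the inverse tangent trivialization,
which is `chartForm`. Smoothness of a section becomes smoothness of a map between normed spaces. -/
theorem smoothFormAt_iff {θ : ∀ x : M, TangentSpace 𝓘(ℝ, E) x →L[ℝ] ℝ} {x₀ : M} :
    SmoothFormAt θ x₀ ↔ ContDiffAt ℝ ∞ (chartForm x₀ θ) (extChartAt 𝓘(ℝ, E) x₀ x₀) := by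
  refine (contMDiffAt_hom_bundle _).trans ((and_iff_right contMDiffAt_id).trans ?_)
  refine contMDiffAt_iff_of_eventuallyEq_chart ?_
  filter_upwards [chart_source_mem_nhds E x₀] with x hx
  have h2 : x = (extChartAt 𝓘(ℝ, E) x₀).symm (extChartAt 𝓘(ℝ, E) x₀ x) :=
    ((extChartAt 𝓘(ℝ, E) x₀).left_inv (by simpa using hx)).symm
  have h3 : ∀ (a b : M) (u w : E), a = b → u = w →
      (show E →L[ℝ] ℝ from θ a) u = (show E →L[ℝ] ℝ from θ b) w := by
    rintro a b u w rfl rfl; rfl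
  ext v
  simp only [ContinuousLinearMap.inCoordinates, Bundle.Trivial.fiberBundle_trivializationAt']
  simp only [ContinuousLinearMap.comp_apply, Bundle.Trivial.continuousLinearMapAt_trivialization]
  exact h3 _ _ _ _ h2 (symmL_eq_mfderiv hx v)

theorem smoothForm₂At_iff
    {Ω : ∀ x : M, TangentSpace 𝓘(ℝ, E) x →L[ℝ] TangentSpace 𝓘(ℝ, E) x →L[ℝ] ℝ} {x₀ : M} :
    SmoothForm₂At Ω x₀ ↔ ContDiffAt ℝ ∞ (chartForm₂ x₀ Ω) (extChartAt 𝓘(ℝ, E) x₀ x₀) := by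
  refine (contMDiffAt_hom_bundle _).trans ((and_iff_right contMDiffAt_id).trans ?_)
  refine contMDiffAt_iff_of_eventuallyEq_chart ?_
  filter_upwards [chart_source_mem_nhds E x₀] with x hx
  have h2 : x = (extChartAt 𝓘(ℝ, E) x₀).symm (extChartAt 𝓘(ℝ, E) x₀ x) :=
    ((extChartAt 𝓘(ℝ, E) x₀).left_inv (by simpa using hx)).symm
  have h3 : ∀ (a b : M) (u u' w w' : E), a = b → u = u' → w = w' →
      (show E →L[ℝ] E →L[ℝ] ℝ from Ω a) u w = (show E →L[ℝ] E →L[ℝ] ℝ from Ω b) u' w' := by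
    rintro a b u u' w w' rfl rfl rfl; rfl
  ext v w
  refine (inCoordinates_apply_eq₂ (by simpa using hx) (by simpa using hx) (by simp)).trans ?_
  refine Eq.trans ?_ (h3 _ _ _ _ _ _ h2 (symmL_eq_mfderiv hx v) (symmL_eq_mfderiv hx w))
  rw [Bundle.Trivialization.symmL_apply _ hx, Bundle.Trivialization.symmL_apply _ hx]
  simp
  rfl

end Forms

/-! ### The exterior derivative on manifolds -/

section ExteriorDerivative

open Set Filter Topology

variable {E F : Type*} [NormedAddCommGroup E] [NormedSpace ℝ E]
  [NormedAddCommGroup F] [NormedSpace ℝ F]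
  {M : Type*} [TopologicalSpace M] [ChartedSpace E M]
  {N : Type*} [TopologicalSpace N] [ChartedSpace F N]

/-- The exterior derivative of a 1-form, computed in the preferred chart at each point. -/
def extD (θ : ∀ x : M, TangentSpace 𝓘(ℝ, E) x →L[ℝ] ℝ) (x : M) :
    TangentSpace 𝓘(ℝ, E) x →L[ℝ] TangentSpace 𝓘(ℝ, E) x →L[ℝ] ℝ :=
  show E →L[ℝ] E →L[ℝ] ℝ from altD (chartForm x θ) (extChartAt 𝓘(ℝ, E) x x)

theorem extD_swap (θ : ∀ x : M, TangentSpace 𝓘(ℝ, E) x →L[ℝ] ℝ) (x : M)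
    (v w : TangentSpace 𝓘(ℝ, E) x) : extD θ x v w = - extD θ x w v := by
  change altD (chartForm x θ) _ (show E from v) (show E from w) =
    - altD (chartForm x θ) _ (show E from w) (show E from v)
  rw [altD_apply, altD_apply]
  ring

theorem extD_self (θ : ∀ x : M, TangentSpace 𝓘(ℝ, E) x →L[ℝ] ℝ) (x : M)
    (v : TangentSpace 𝓘(ℝ, E) x) : extD θ x v v = 0 := by
  have := extD_swap θ x v v
  linarith

/-- A vector field in the chart at `x₀`. -/
def chartField (x₀ : M) (X : ∀ x : M, TangentSpace 𝓘(ℝ, E) x) : E → E :=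
  VectorField.mpullbackWithin 𝓘(ℝ, E) 𝓘(ℝ, E) (extChartAt 𝓘(ℝ, E) x₀).symm X
    (range 𝓘(ℝ, E))

variable [IsManifold 𝓘(ℝ, E) ∞ M] [IsManifold 𝓘(ℝ, F) ∞ N]

/-- Smoothness of a vector field at a point. -/
def SmoothFieldAt (X : ∀ x : M, TangentSpace 𝓘(ℝ, E) x) (x₀ : M) : Prop :=
  ContMDiffAt 𝓘(ℝ, E) 𝓘(ℝ, E).tangent ∞ (fun x => (⟨x, X x⟩ : TangentBundle 𝓘(ℝ, E) M)) x₀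

theorem mfderiv_symm_chartField {x₀ : M} {y : E} (hy : y ∈ (extChartAt 𝓘(ℝ, E) x₀).target)
    (X : ∀ x : M, TangentSpace 𝓘(ℝ, E) x) :
    (show E →L[ℝ] E from mfderiv 𝓘(ℝ, E) 𝓘(ℝ, E) (extChartAt 𝓘(ℝ, E) x₀).symm y)
      (chartField x₀ X y) = X ((extChartAt 𝓘(ℝ, E) x₀).symm y) := by
  have h := isInvertible_mfderivWithin_extChartAt_symm (I := 𝓘(ℝ, E)) hy
  have h1 := h.self_apply_inverse (X ((extChartAt 𝓘(ℝ, E) x₀).symm y))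
  rw [← VectorField.mpullbackWithin_apply] at h1
  have h2 : mfderivWithin 𝓘(ℝ, E) 𝓘(ℝ, E) (extChartAt 𝓘(ℝ, E) x₀).symm (range 𝓘(ℝ, E)) y =
    mfderiv 𝓘(ℝ, E) 𝓘(ℝ, E) (extChartAt 𝓘(ℝ, E) x₀).symm y := by
    simp only [modelWithCornersSelf_coe, range_id, mfderivWithin_univ]
  rw [h2] at h1
  exact h1

/-- The tangent space at x₀ is identified with the model through the preferred chart at x₀, so that
chart has the identity as derivative at its centre, and the coordinates of a vector there are the
vector itself. -/
theorem chartField_self (x₀ : M) (X : ∀ x : M, TangentSpace 𝓘(ℝ, E) x) :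
    (chartField x₀ X (extChartAt 𝓘(ℝ, E) x₀ x₀) : E) = X x₀ := by
  have h := mfderiv_symm_chartField (mem_extChartAt_target (I := 𝓘(ℝ, E)) x₀) X
  have h2 := mfderivWithin_range_extChartAt_symm (I := 𝓘(ℝ, E)) (x := x₀)
  simp only [modelWithCornersSelf_coe, range_id, mfderivWithin_univ] at h2
  have h3 : ∀ (a b : M), a = b → (show E from X a) = (show E from X b) := by
    rintro a b rfl; rfl
  have h4 := h3 _ _ (extChartAt_to_inv (I := 𝓘(ℝ, E)) x₀)
  refine Eq.trans ?_ (Eq.trans h h4)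
  exact (congrArg (fun L : E →L[ℝ] E => L (chartField x₀ X (extChartAt 𝓘(ℝ, E) x₀ x₀))) h2).symm

theorem chartForm_chartField {x₀ : M} {y : E} (hy : y ∈ (extChartAt 𝓘(ℝ, E) x₀).target)
    (θ : ∀ x : M, TangentSpace 𝓘(ℝ, E) x →L[ℝ] ℝ) (X : ∀ x : M, TangentSpace 𝓘(ℝ, E) x) :
    chartForm x₀ θ y (chartField x₀ X y) =
      θ ((extChartAt 𝓘(ℝ, E) x₀).symm y) (X ((extChartAt 𝓘(ℝ, E) x₀).symm y)) :=
  congrArg (θ ((extChartAt 𝓘(ℝ, E) x₀).symm y)) (mfderiv_symm_chartField hy X)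

theorem chartForm₂_chartField {x₀ : M} {y : E} (hy : y ∈ (extChartAt 𝓘(ℝ, E) x₀).target)
    (Ω : ∀ x : M, TangentSpace 𝓘(ℝ, E) x →L[ℝ] TangentSpace 𝓘(ℝ, E) x →L[ℝ] ℝ)
    (X Y : ∀ x : M, TangentSpace 𝓘(ℝ, E) x) :
    chartForm₂ x₀ Ω y (chartField x₀ X y) (chartField x₀ Y y) =
      Ω ((extChartAt 𝓘(ℝ, E) x₀).symm y) (X ((extChartAt 𝓘(ℝ, E) x₀).symm y))
        (Y ((extChartAt 𝓘(ℝ, E) x₀).symm y)) :=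
  congrArg₂ (fun a b => Ω ((extChartAt 𝓘(ℝ, E) x₀).symm y) a b) (mfderiv_symm_chartField hy X)
    (mfderiv_symm_chartField hy Y)

theorem mfderiv_symm_self (x₀ : M) :
    (mfderiv 𝓘(ℝ, E) 𝓘(ℝ, E) (extChartAt 𝓘(ℝ, E) x₀).symm (extChartAt 𝓘(ℝ, E) x₀ x₀) : E →L[ℝ] E)
      = ContinuousLinearMap.id ℝ E := by
  have h2 := mfderivWithin_range_extChartAt_symm (I := 𝓘(ℝ, E)) (x := x₀)
  simp only [modelWithCornersSelf_coe, range_id, mfderivWithin_univ] at h2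
  exact h2

theorem chartForm_self (x₀ : M) (θ : ∀ x : M, TangentSpace 𝓘(ℝ, E) x →L[ℝ] ℝ) :
    chartForm x₀ θ (extChartAt 𝓘(ℝ, E) x₀ x₀) = θ x₀ := by
  have h3 : ∀ (a b : M) (L : E →L[ℝ] E), a = b → L = ContinuousLinearMap.id ℝ E →
      (show E →L[ℝ] ℝ from θ a).comp L = (show E →L[ℝ] ℝ from θ b) := by
    rintro a b L rfl rfl; rfl
  exact h3 _ _ _ (extChartAt_to_inv (I := 𝓘(ℝ, E)) x₀) (mfderiv_symm_self x₀)

theorem chartForm₂_self (x₀ : M)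
    (Ω : ∀ x : M, TangentSpace 𝓘(ℝ, E) x →L[ℝ] TangentSpace 𝓘(ℝ, E) x →L[ℝ] ℝ) :
    chartForm₂ x₀ Ω (extChartAt 𝓘(ℝ, E) x₀ x₀) = Ω x₀ := by
  have h3 : ∀ (a b : M) (L : E →L[ℝ] E), a = b → L = ContinuousLinearMap.id ℝ E →
      (show E →L[ℝ] E →L[ℝ] ℝ from Ω a).bilinearComp L L = (show E →L[ℝ] E →L[ℝ] ℝ from Ω b) := by
    rintro a b L rfl rfl; rfl
  exact h3 _ _ _ (extChartAt_to_inv (I := 𝓘(ℝ, E)) x₀) (mfderiv_symm_self x₀)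

theorem mfderiv_of_eventuallyEq_chart {f : M → F} {g : E → F} {x₀ : M}
    (h : f =ᶠ[𝓝 x₀] g ∘ extChartAt 𝓘(ℝ, E) x₀)
    (hg : DifferentiableAt ℝ g (extChartAt 𝓘(ℝ, E) x₀ x₀)) :
    (mfderiv 𝓘(ℝ, E) 𝓘(ℝ, F) f x₀ : E →L[ℝ] F) = fderiv ℝ g (extChartAt 𝓘(ℝ, E) x₀ x₀) := by
  have h1 : (mfderiv 𝓘(ℝ, E) 𝓘(ℝ, F) f x₀ : E →L[ℝ] F) =
    (mfderiv 𝓘(ℝ, E) 𝓘(ℝ, F) (g ∘ extChartAt 𝓘(ℝ, E) x₀) x₀ : E →L[ℝ] F) := h.mfderiv_eq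
  rw [h1]
  have h2 : (mfderiv 𝓘(ℝ, E) 𝓘(ℝ, E) (extChartAt 𝓘(ℝ, E) x₀) x₀ : E →L[ℝ] E) =
    ContinuousLinearMap.id ℝ E := mfderiv_extChartAt_self
  have h3 : (mfderiv 𝓘(ℝ, E) 𝓘(ℝ, F) (g ∘ extChartAt 𝓘(ℝ, E) x₀) x₀ : E →L[ℝ] F) =
    (mfderiv 𝓘(ℝ, E) 𝓘(ℝ, F) g (extChartAt 𝓘(ℝ, E) x₀ x₀) : E →L[ℝ] F).comp
      (mfderiv 𝓘(ℝ, E) 𝓘(ℝ, E) (extChartAt 𝓘(ℝ, E) x₀) x₀ : E →L[ℝ] E) :=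
    mfderiv_comp (I' := 𝓘(ℝ, E)) x₀ hg.mdifferentiableAt
      (mdifferentiableAt_chart (mem_extChartAt_source x₀))
  rw [h3, h2, mfderiv_eq_fderiv]
  rfl

theorem mfderiv_eq_fderiv_chartMap {f : N → M} {y₀ : N}
    (hf : MDifferentiableAt 𝓘(ℝ, F) 𝓘(ℝ, E) f y₀) :
    (mfderiv 𝓘(ℝ, F) 𝓘(ℝ, E) f y₀ : F →L[ℝ] E) =
      fderiv ℝ (chartMap y₀ (f y₀) f : F → E) (extChartAt 𝓘(ℝ, F) y₀ y₀) := by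
  have h : (mfderiv 𝓘(ℝ, F) 𝓘(ℝ, E) f y₀ : F →L[ℝ] E) =
    fderivWithin ℝ (writtenInExtChartAt 𝓘(ℝ, F) 𝓘(ℝ, E) y₀ f) (range 𝓘(ℝ, F))
      (extChartAt 𝓘(ℝ, F) y₀ y₀) := if_pos hf
  simp only [modelWithCornersSelf_coe, range_id, fderivWithin_univ] at h
  exact h

theorem contDiffAt_chartMap {f : N → M} {y₀ : N} (hf : ContMDiffAt 𝓘(ℝ, F) 𝓘(ℝ, E) ∞ f y₀) :
    ContDiffAt ℝ ∞ (chartMap y₀ (f y₀) f : F → E) (extChartAt 𝓘(ℝ, F) y₀ y₀) := by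
  have := (contMDiffAt_iff.1 hf).2
  simp only [modelWithCornersSelf_coe, range_id] at this
  exact this.contDiffAt univ_mem

theorem eventually_chartForm_pullForm {f : N → M} {y₀ : N}
    (hf : ContMDiffAt 𝓘(ℝ, F) 𝓘(ℝ, E) ∞ f y₀) (θ : ∀ x : M, TangentSpace 𝓘(ℝ, E) x →L[ℝ] ℝ) :
    chartForm y₀ (pullForm f θ : ∀ y : N, TangentSpace 𝓘(ℝ, F) y →L[ℝ] ℝ)
      =ᶠ[𝓝 (extChartAt 𝓘(ℝ, F) y₀ y₀)] fun y =>
        (chartForm (f y₀) θ (chartMap y₀ (f y₀) f y)).comp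
          (fderiv ℝ (chartMap y₀ (f y₀) f) y) := by
  -- Order ∞ at a point means a neighbourhood for each finite order, with no common one, so only
  -- order 1 is spread to a neighbourhood here.
  have h1 : ∀ᶠ y in 𝓝 y₀, MDifferentiableAt 𝓘(ℝ, F) 𝓘(ℝ, E) f y := by
    have := (contMDiffAt_iff_contMDiffAt_nhds (n := 1) (by simp)).1
      (hf.of_le (show (1 : WithTop ℕ∞) ≤ ∞ from mod_cast le_top))
    filter_upwards [this] with y hy using hy.mdifferentiableAt one_ne_zero
  have h2 : ∀ᶠ y in 𝓝 y₀, f y ∈ (extChartAt 𝓘(ℝ, E) (f y₀)).source :=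
    hf.continuousAt.preimage_mem_nhds (extChartAt_source_mem_nhds _)
  have h3 : ContinuousAt (extChartAt 𝓘(ℝ, F) y₀).symm (extChartAt 𝓘(ℝ, F) y₀ y₀) :=
    continuousAt_extChartAt_symm y₀
  have h4 := h3.eventually (p := fun y => MDifferentiableAt 𝓘(ℝ, F) 𝓘(ℝ, E) f y ∧
    f y ∈ (extChartAt 𝓘(ℝ, E) (f y₀)).source) (by
      rw [extChartAt_to_inv]; exact h1.and h2)
  filter_upwards [h4, extChartAt_target_mem_nhds (I := 𝓘(ℝ, F)) y₀] with y hy hy'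
  exact chartForm_pullForm hy' hy.2 hy.1 θ

/-- Pull-backs of smooth forms along smooth maps are smooth. -/
theorem SmoothFormAt.pullForm {f : N → M} {y₀ : N} {θ : ∀ x : M, TangentSpace 𝓘(ℝ, E) x →L[ℝ] ℝ}
    (hθ : SmoothFormAt θ (f y₀)) (hf : ContMDiffAt 𝓘(ℝ, F) 𝓘(ℝ, E) ∞ f y₀) :
    SmoothFormAt (pullForm f θ : ∀ y : N, TangentSpace 𝓘(ℝ, F) y →L[ℝ] ℝ) y₀ := by
  rw [smoothFormAt_iff] at hθ ⊢
  have h1 := contDiffAt_chartMap hf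
  have h2 : ContDiffAt ℝ ∞ (fderiv ℝ (chartMap y₀ (f y₀) f : F → E))
    (extChartAt 𝓘(ℝ, F) y₀ y₀) := h1.fderiv_right (by simp)
  have h0 : (chartMap y₀ (f y₀) f : F → E) (extChartAt 𝓘(ℝ, F) y₀ y₀) =
    extChartAt 𝓘(ℝ, E) (f y₀) (f y₀) := by simp [chartMap]
  rw [← h0] at hθ
  exact ((hθ.comp _ h1).clm_comp h2).congr_of_eventuallyEq (eventually_chartForm_pullForm hf θ)

/-- The exterior derivative is natural. -/
theorem extD_pullForm {f : N → M} {y₀ : N} {θ : ∀ x : M, TangentSpace 𝓘(ℝ, E) x →L[ℝ] ℝ}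
    (hθ : SmoothFormAt θ (f y₀)) (hf : ContMDiffAt 𝓘(ℝ, F) 𝓘(ℝ, E) ∞ f y₀) :
    (extD (pullForm f θ : ∀ y : N, TangentSpace 𝓘(ℝ, F) y →L[ℝ] ℝ) y₀) =
      pullForm₂ f (extD θ) y₀ := by
  rw [smoothFormAt_iff] at hθ
  have h1 := contDiffAt_chartMap hf
  have h0 : (chartMap y₀ (f y₀) f : F → E) (extChartAt 𝓘(ℝ, F) y₀ y₀) =
    extChartAt 𝓘(ℝ, E) (f y₀) (f y₀) := by simp [chartMap]
  have h2 := altD_pullback (g := (chartMap y₀ (f y₀) f : F → E))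
    (by rw [h0]; exact hθ.differentiableAt (by simp)) h1
  have h3 := (altD_congr (eventually_chartForm_pullForm hf θ)).trans h2
  rw [h0, ← mfderiv_eq_fderiv_chartMap (hf.mdifferentiableAt (by simp))] at h3
  exact h3

theorem chartForm_model (η : ∀ x : E, TangentSpace 𝓘(ℝ, E) x →L[ℝ] ℝ) (y : E) :
    chartForm y η = η := by
  funext z
  ext v
  have : (mfderiv 𝓘(ℝ, E) 𝓘(ℝ, E) (fun x : E => x) z : E →L[ℝ] E) = ContinuousLinearMap.id ℝ E :=
    mfderiv_id
  exact congrArg (fun L : E →L[ℝ] E => (show E →L[ℝ] ℝ from η z) (L v)) this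

theorem extD_congr {θ θ' : ∀ x : M, TangentSpace 𝓘(ℝ, E) x →L[ℝ] ℝ} {x₀ : M}
    (h : ∀ᶠ x in 𝓝 x₀, θ x = θ' x) : extD θ x₀ = extD θ' x₀ := by
  refine altD_congr ?_
  have h3 : ContinuousAt (extChartAt 𝓘(ℝ, E) x₀).symm (extChartAt 𝓘(ℝ, E) x₀ x₀) :=
    continuousAt_extChartAt_symm x₀
  have h4 := h3.eventually (p := fun x => θ x = θ' x) (by rwa [extChartAt_to_inv])
  filter_upwards [h4] with y hy
  simp only [chartForm, ContactDictionary.pullForm]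
  rw [hy]

theorem SmoothFormAt.congr {θ θ' : ∀ x : M, TangentSpace 𝓘(ℝ, E) x →L[ℝ] ℝ} {x₀ : M}
    (hθ : SmoothFormAt θ x₀) (h : ∀ᶠ x in 𝓝 x₀, θ' x = θ x) : SmoothFormAt θ' x₀ := by
  refine ContMDiffAt.congr_of_eventuallyEq hθ ?_
  filter_upwards [h] with x hx
  rw [hx]

/-- `extD` uses a different chart at each point. Naturality, applied to the inverse of the chart at
x₀, shows that in this single chart it is `altD` on a whole neighbourhood. Smoothness and closedness
of exact forms both rest on this, and it needs θ to be smooth near x₀ and not only at x₀. -/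
theorem eventually_chartForm₂_extD {θ : ∀ x : M, TangentSpace 𝓘(ℝ, E) x →L[ℝ] ℝ} {x₀ : M}
    (hθ : ∀ᶠ x in 𝓝 x₀, SmoothFormAt θ x) :
    chartForm₂ x₀ (extD θ) =ᶠ[𝓝 (extChartAt 𝓘(ℝ, E) x₀ x₀)] altD (chartForm x₀ θ) := by
  have h3 : ContinuousAt (extChartAt 𝓘(ℝ, E) x₀).symm (extChartAt 𝓘(ℝ, E) x₀ x₀) :=
    continuousAt_extChartAt_symm x₀
  have h4 := h3.eventually (p := fun x => SmoothFormAt θ x) (by rwa [extChartAt_to_inv])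
  filter_upwards [h4, extChartAt_target_mem_nhds (I := 𝓘(ℝ, E)) x₀] with y hy hy'
  have h5 : ContMDiffAt 𝓘(ℝ, E) 𝓘(ℝ, E) ∞ (extChartAt 𝓘(ℝ, E) x₀).symm y :=
    (contMDiffOn_extChartAt_symm x₀).contMDiffAt ((isOpen_extChartAt_target x₀).mem_nhds hy')
  have h6 := extD_pullForm hy h5
  refine h6.symm.trans ?_
  exact congrArg (fun η => altD η y) (chartForm_model _ y)

theorem smoothForm₂At_extD {θ : ∀ x : M, TangentSpace 𝓘(ℝ, E) x →L[ℝ] ℝ} {x₀ : M}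
    (hθ : ∀ᶠ x in 𝓝 x₀, SmoothFormAt θ x) : SmoothForm₂At (extD θ) x₀ := by
  rw [smoothForm₂At_iff]
  have h := smoothFormAt_iff.1 hθ.self_of_nhds
  exact (contDiffAt_altD h).congr_of_eventuallyEq (eventually_chartForm₂_extD hθ)

theorem comp_symm_chart_eventuallyEq {A : Type*} (f : M → A) (x₀ : M) :
    f =ᶠ[𝓝 x₀] (f ∘ (extChartAt 𝓘(ℝ, E) x₀).symm) ∘ extChartAt 𝓘(ℝ, E) x₀ := by
  filter_upwards [extChartAt_source_mem_nhds (I := 𝓘(ℝ, E)) x₀] with x hx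
  exact congrArg f ((extChartAt 𝓘(ℝ, E) x₀).left_inv hx).symm

theorem chartForm_smul (c : M → ℝ) (θ : ∀ x : M, TangentSpace 𝓘(ℝ, E) x →L[ℝ] ℝ) (x₀ : M) :
    chartForm x₀ (fun x => c x • θ x) =
      fun y => (c ∘ (extChartAt 𝓘(ℝ, E) x₀).symm) y • chartForm x₀ θ y := rfl

theorem contDiffAt_comp_symm_chart {f : M → F} {x₀ : M}
    (hf : ContMDiffAt 𝓘(ℝ, E) 𝓘(ℝ, F) ∞ f x₀) :
    ContDiffAt ℝ ∞ (f ∘ (extChartAt 𝓘(ℝ, E) x₀).symm) (extChartAt 𝓘(ℝ, E) x₀ x₀) :=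
  (contMDiffAt_iff_of_eventuallyEq_chart (comp_symm_chart_eventuallyEq f x₀)).1 hf

theorem SmoothFormAt.smul {c : M → ℝ} {θ : ∀ x : M, TangentSpace 𝓘(ℝ, E) x →L[ℝ] ℝ} {x₀ : M}
    (hθ : SmoothFormAt θ x₀) (hc : ContMDiffAt 𝓘(ℝ, E) 𝓘(ℝ, ℝ) ∞ c x₀) :
    SmoothFormAt (fun x => c x • θ x) x₀ := by
  rw [smoothFormAt_iff] at hθ ⊢
  rw [chartForm_smul]
  exact (contDiffAt_comp_symm_chart hc).smul hθ

/-- The Leibniz rule. -/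
theorem extD_smul {c : M → ℝ} {θ : ∀ x : M, TangentSpace 𝓘(ℝ, E) x →L[ℝ] ℝ} {x₀ : M}
    (hθ : SmoothFormAt θ x₀) (hc : ContMDiffAt 𝓘(ℝ, E) 𝓘(ℝ, ℝ) ∞ c x₀)
    (v w : TangentSpace 𝓘(ℝ, E) x₀) :
    extD (fun x => c x • θ x) x₀ v w =
      (show ℝ from mfderiv 𝓘(ℝ, E) 𝓘(ℝ, ℝ) c x₀ v) * θ x₀ w
        - (show ℝ from mfderiv 𝓘(ℝ, E) 𝓘(ℝ, ℝ) c x₀ w) * θ x₀ v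
        + c x₀ * extD θ x₀ v w := by
  rw [smoothFormAt_iff] at hθ
  have h1 := (contDiffAt_comp_symm_chart hc).differentiableAt (by simp)
  have h2 := mfderiv_of_eventuallyEq_chart (comp_symm_chart_eventuallyEq c x₀) h1
  have h3 := altD_smul (hθ.differentiableAt (by simp)) h1 (show E from v) (show E from w)
  rw [← h2, chartForm_self] at h3
  refine h3.trans ?_
  rw [Function.comp_apply, extChartAt_to_inv]
  rfl

section CartanFormulas

variable [CompleteSpace E]

theorem SmoothFieldAt.differentiableAt_chartField {X : ∀ x : M, TangentSpace 𝓘(ℝ, E) x} {x₀ : M}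
    (hX : SmoothFieldAt X x₀) :
    DifferentiableAt ℝ (chartField x₀ X) (extChartAt 𝓘(ℝ, E) x₀ x₀) := by
  have h1 : MDifferentiableWithinAt 𝓘(ℝ, E) 𝓘(ℝ, E).tangent
    (fun x => (⟨x, X x⟩ : TangentBundle 𝓘(ℝ, E) M)) univ x₀ :=
    (hX.mdifferentiableAt (by simp)).mdifferentiableWithinAt
  have h2 := h1.differentiableWithinAt_mpullbackWithin_vectorField
  exact DifferentiableWithinAt.differentiableAt h2 (by simp)

/-- The manifold bracket is the bracket of the chart expressions, carried back by the derivative of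
the chart, and this derivative is the identity at the centre. -/
theorem mlieBracket_eq_lieBracket (X Y : ∀ x : M, TangentSpace 𝓘(ℝ, E) x) (x₀ : M) :
    (VectorField.mlieBracket 𝓘(ℝ, E) X Y x₀ : E) =
      VectorField.lieBracket ℝ (chartField x₀ X) (chartField x₀ Y)
        (extChartAt 𝓘(ℝ, E) x₀ x₀) := by
  have h2 : (mfderiv 𝓘(ℝ, E) 𝓘(ℝ, E) (extChartAt 𝓘(ℝ, E) x₀) x₀ : E →L[ℝ] E) =
    ContinuousLinearMap.id ℝ E := mfderiv_extChartAt_self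
  have h3 : (VectorField.mlieBracket 𝓘(ℝ, E) X Y x₀ : E) =
    (show E →L[ℝ] E from mfderiv 𝓘(ℝ, E) 𝓘(ℝ, E) (extChartAt 𝓘(ℝ, E) x₀) x₀).inverse
      (VectorField.lieBracketWithin ℝ (chartField x₀ X) (chartField x₀ Y)
        ((extChartAt 𝓘(ℝ, E) x₀).symm ⁻¹' univ ∩ range 𝓘(ℝ, E)) (extChartAt 𝓘(ℝ, E) x₀ x₀)) := rfl
  rw [h3]
  have h4 : (extChartAt 𝓘(ℝ, E) x₀).symm ⁻¹' univ ∩ range 𝓘(ℝ, E) = univ := by simp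
  rw [h4, VectorField.lieBracketWithin_univ]
  exact congrArg (fun L : E →L[ℝ] E => L.inverse (VectorField.lieBracket ℝ (chartField x₀ X)
    (chartField x₀ Y) (extChartAt 𝓘(ℝ, E) x₀ x₀))) h2 |>.trans (by simp)

end CartanFormulas

end ExteriorDerivative

/-! ### Cartan's formulas: the derivatives evaluated on vector fields, in coordinates -/

section Euclidean

open Set Filter Topology

variable {m : ℕ} {M : Type*} [TopologicalSpace M] [ChartedSpace (EuclideanSpace ℝ (Fin m)) M]
  [IsManifold (𝓡 m) ∞ M]

theorem fieldDeriv_eq {f : M → ℝ} {g : EuclideanSpace ℝ (Fin m) → ℝ} {x₀ : M}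
    (X : ∀ x : M, TangentSpace (𝓡 m) x)
    (h : f ∘ (extChartAt (𝓡 m) x₀).symm =ᶠ[𝓝 (extChartAt (𝓡 m) x₀ x₀)] g)
    (hg : DifferentiableAt ℝ g (extChartAt (𝓡 m) x₀ x₀)) :
    fieldDeriv X f x₀ = fderiv ℝ g (extChartAt (𝓡 m) x₀ x₀)
      (chartField x₀ X (extChartAt (𝓡 m) x₀ x₀)) := by
  have h1 := mfderiv_of_eventuallyEq_chart (comp_symm_chart_eventuallyEq f x₀)
    (hg.congr_of_eventuallyEq h)
  rw [h.fderiv_eq] at h1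
  rw [chartField_self]
  exact congrArg (fun L : EuclideanSpace ℝ (Fin m) →L[ℝ] ℝ => L (X x₀)) h1

/-- Cartan's formula for 1-forms. -/
theorem dOneForm_eq_extD {θ : ∀ x : M, TangentSpace (𝓡 m) x →L[ℝ] ℝ}
    {X Y : ∀ x : M, TangentSpace (𝓡 m) x} {x₀ : M} (hθ : SmoothFormAt θ x₀)
    (hX : SmoothFieldAt X x₀) (hY : SmoothFieldAt Y x₀) :
    dOneForm θ X Y x₀ = extD θ x₀ (X x₀) (Y x₀) := by
  have hθ' := (smoothFormAt_iff.1 hθ).differentiableAt (by simp)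
  have hX' := hX.differentiableAt_chartField
  have hY' := hY.differentiableAt_chartField
  have h1 := altD_eq_lieBracket hθ' hX' hY'
  have key : ∀ Z : ∀ x : M, TangentSpace (𝓡 m) x,
      (fun x => θ x (Z x)) ∘ (extChartAt (𝓡 m) x₀).symm =ᶠ[𝓝 (extChartAt (𝓡 m) x₀ x₀)]
        fun y => chartForm x₀ θ y (chartField x₀ Z y) := by
    intro Z
    filter_upwards [extChartAt_target_mem_nhds (I := 𝓡 m) x₀] with y hy
    exact (chartForm_chartField hy θ Z).symm
  rw [dOneForm, fieldDeriv_eq X (key Y) (hθ'.clm_apply hY'),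
    fieldDeriv_eq Y (key X) (hθ'.clm_apply hX')]
  have h2 : θ x₀ (bracket X Y x₀) = chartForm x₀ θ (extChartAt (𝓡 m) x₀ x₀)
      (VectorField.lieBracket ℝ (chartField x₀ X) (chartField x₀ Y)
        (extChartAt (𝓡 m) x₀ x₀)) := by
    rw [chartForm_self]
    exact congrArg (θ x₀) (mlieBracket_eq_lieBracket X Y x₀)
  rw [h2, h1, chartField_self, chartField_self]
  rfl

/-- Cartan's formula for 2-forms. -/
theorem dTwoForm_eq_altD₂
    {Ω : ∀ x : M, TangentSpace (𝓡 m) x →L[ℝ] TangentSpace (𝓡 m) x →L[ℝ] ℝ}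
    {X Y Z : ∀ x : M, TangentSpace (𝓡 m) x} {x₀ : M} (hΩ : SmoothForm₂At Ω x₀)
    (hswap : ∀ v w, Ω x₀ v w = - Ω x₀ w v)
    (hX : SmoothFieldAt X x₀) (hY : SmoothFieldAt Y x₀) (hZ : SmoothFieldAt Z x₀) :
    dTwoForm Ω X Y Z x₀ =
      altD₂ (chartForm₂ x₀ Ω) (extChartAt (𝓡 m) x₀ x₀) (X x₀) (Y x₀) (Z x₀) := by
  have hΩ' := (smoothForm₂At_iff.1 hΩ).differentiableAt (by simp)
  have hX' := hX.differentiableAt_chartField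
  have hY' := hY.differentiableAt_chartField
  have hZ' := hZ.differentiableAt_chartField
  have h1 := altD₂_eq_lieBracket hΩ' hX' hY' hZ' (by rw [chartForm₂_self]; exact hswap)
  have key : ∀ V W : ∀ x : M, TangentSpace (𝓡 m) x,
      (fun x => Ω x (V x) (W x)) ∘ (extChartAt (𝓡 m) x₀).symm =ᶠ[𝓝 (extChartAt (𝓡 m) x₀ x₀)]
        fun y => chartForm₂ x₀ Ω y (chartField x₀ V y) (chartField x₀ W y) := by
    intro V W
    filter_upwards [extChartAt_target_mem_nhds (I := 𝓡 m) x₀] with y hy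
    exact (chartForm₂_chartField hy Ω V W).symm
  rw [dTwoForm, fieldDeriv_eq X (key Y Z) ((hΩ'.clm_apply hY').clm_apply hZ'),
    fieldDeriv_eq Y (key X Z) ((hΩ'.clm_apply hX').clm_apply hZ'),
    fieldDeriv_eq Z (key X Y) ((hΩ'.clm_apply hX').clm_apply hY')]
  have h2 : ∀ U V W : ∀ x : M, TangentSpace (𝓡 m) x, Ω x₀ (bracket U V x₀) (W x₀) =
      chartForm₂ x₀ Ω (extChartAt (𝓡 m) x₀ x₀)
      (VectorField.lieBracket ℝ (chartField x₀ U) (chartField x₀ V)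
        (extChartAt (𝓡 m) x₀ x₀)) (chartField x₀ W (extChartAt (𝓡 m) x₀ x₀)) := by
    intro U V W
    rw [chartForm₂_self, chartField_self]
    exact congrArg (fun v => Ω x₀ v (W x₀)) (mlieBracket_eq_lieBracket U V x₀)
  rw [h2, h2, h2, h1, chartField_self, chartField_self, chartField_self]

/-- Exact 2-forms are closed. -/
theorem dTwoForm_extD {θ : ∀ x : M, TangentSpace (𝓡 m) x →L[ℝ] ℝ}
    {X Y Z : ∀ x : M, TangentSpace (𝓡 m) x} {x₀ : M} (hθ : ∀ᶠ x in 𝓝 x₀, SmoothFormAt θ x)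
    (hX : SmoothFieldAt X x₀) (hY : SmoothFieldAt Y x₀) (hZ : SmoothFieldAt Z x₀) :
    dTwoForm (extD θ) X Y Z x₀ = 0 := by
  rw [dTwoForm_eq_altD₂ (smoothForm₂At_extD hθ) (extD_swap θ x₀) hX hY hZ,
    altD₂_congr (eventually_chartForm₂_extD hθ)]
  exact altD₂_altD (smoothFormAt_iff.1 hθ.self_of_nhds) _ _ _

end Euclidean

/-! ### Smooth vector fields, and forms and fields prescribed in a chart -/

section Fields

open Set Filter Topology

variable {E : Type*} [NormedAddCommGroup E] [NormedSpace ℝ E]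
  {M : Type*} [TopologicalSpace M] [ChartedSpace E M] [IsManifold 𝓘(ℝ, E) ∞ M]

/-- The value of a smooth 1-form on a smooth vector field is smooth. -/
theorem SmoothFormAt.apply {θ : ∀ x : M, TangentSpace 𝓘(ℝ, E) x →L[ℝ] ℝ}
    {X : ∀ x : M, TangentSpace 𝓘(ℝ, E) x} {x₀ : M} (hθ : SmoothFormAt θ x₀)
    (hX : SmoothFieldAt X x₀) : ContMDiffAt 𝓘(ℝ, E) 𝓘(ℝ, ℝ) ∞ (fun x => θ x (X x)) x₀ := by
  have h : ContMDiffAt 𝓘(ℝ, E) (𝓘(ℝ, E).prod 𝓘(ℝ, ℝ)) ∞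
      (fun x => Bundle.TotalSpace.mk' ℝ (E := Bundle.Trivial M ℝ) x (θ x (X x))) x₀ :=
    ContMDiffAt.clm_bundle_apply (F₁ := E) (F₂ := ℝ) (E₁ := fun x : M => TangentSpace 𝓘(ℝ, E) x)
      (E₂ := Bundle.Trivial M ℝ) hθ hX
  simp only [Bundle.contMDiffAt_totalSpace] at h
  exact h.2

theorem SmoothFieldAt.add {X Y : ∀ x : M, TangentSpace 𝓘(ℝ, E) x} {x₀ : M}
    (hX : SmoothFieldAt X x₀) (hY : SmoothFieldAt Y x₀) :
    SmoothFieldAt (fun x => X x + Y x) x₀ :=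
  ContMDiffAt.add_section hX hY

theorem SmoothFieldAt.smul {c : M → ℝ} {X : ∀ x : M, TangentSpace 𝓘(ℝ, E) x} {x₀ : M}
    (hX : SmoothFieldAt X x₀) (hc : ContMDiffAt 𝓘(ℝ, E) 𝓘(ℝ, ℝ) ∞ c x₀) :
    SmoothFieldAt (fun x => c x • X x) x₀ :=
  ContMDiffAt.smul_section hc hX

theorem SmoothFieldAt.sum {ι : Type*} {s : Finset ι} {X : ι → ∀ x : M, TangentSpace 𝓘(ℝ, E) x}
    {x₀ : M} (hX : ∀ i ∈ s, SmoothFieldAt (X i) x₀) :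
    SmoothFieldAt (fun x => ∑ i ∈ s, X i x) x₀ :=
  ContMDiffAt.sum_section hX

theorem SmoothFieldAt.congr {X Y : ∀ x : M, TangentSpace 𝓘(ℝ, E) x} {x₀ : M}
    (hX : SmoothFieldAt X x₀) (h : ∀ᶠ x in 𝓝 x₀, Y x = X x) : SmoothFieldAt Y x₀ := by
  refine ContMDiffAt.congr_of_eventuallyEq hX ?_
  filter_upwards [h] with x hx
  rw [hx]

/-- The 1-form on the domain of the chart at `x₀` given by `η` in coordinates. -/
def ofChartForm (x₀ : M) (η : E → E →L[ℝ] ℝ) : ∀ x : M, TangentSpace 𝓘(ℝ, E) x →L[ℝ] ℝ :=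
  pullForm (extChartAt 𝓘(ℝ, E) x₀) (M := E) η

theorem smoothFormAt_ofChartForm {x₀ x : M} (hx : x ∈ (extChartAt 𝓘(ℝ, E) x₀).source)
    {η : E → E →L[ℝ] ℝ} (hη : ContDiffAt ℝ ∞ η (extChartAt 𝓘(ℝ, E) x₀ x)) :
    SmoothFormAt (ofChartForm x₀ η) x := by
  refine SmoothFormAt.pullForm (M := E) (θ := η) ?_ (contMDiffAt_extChartAt' (by simpa using hx))
  refine smoothFormAt_iff.2 ?_
  have h := chartForm_model η (extChartAt 𝓘(ℝ, E) x₀ x)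
  exact h.symm ▸ hη

/-- The vector field on the domain of the chart at `x₀` with constant coordinates `v`. -/
def chartConst (x₀ : M) (v : E) : ∀ x : M, TangentSpace 𝓘(ℝ, E) x :=
  VectorField.mpullback 𝓘(ℝ, E) 𝓘(ℝ, E) (extChartAt 𝓘(ℝ, E) x₀) (fun _ => v)

theorem mfderiv_chartConst {x₀ x : M} (hx : x ∈ (extChartAt 𝓘(ℝ, E) x₀).source) (v : E) :
    (show E →L[ℝ] E from mfderiv 𝓘(ℝ, E) 𝓘(ℝ, E) (extChartAt 𝓘(ℝ, E) x₀) x)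
      (chartConst x₀ v x) = v :=
  (isInvertible_mfderiv_extChartAt (I := 𝓘(ℝ, E)) hx).self_apply_inverse v

theorem chartConst_self (x₀ : M) (v : E) : (chartConst x₀ v x₀ : E) = v := by
  have h := mfderiv_chartConst (mem_extChartAt_source (I := 𝓘(ℝ, E)) x₀) v
  have h2 : (mfderiv 𝓘(ℝ, E) 𝓘(ℝ, E) (extChartAt 𝓘(ℝ, E) x₀) x₀ : E →L[ℝ] E) =
    ContinuousLinearMap.id ℝ E := mfderiv_extChartAt_self
  exact (congrArg (fun L : E →L[ℝ] E => L (chartConst x₀ v x₀)) h2).symm.trans h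

theorem mfderiv_chart_injective {x₀ x : M} (hx : x ∈ (extChartAt 𝓘(ℝ, E) x₀).source) :
    Function.Injective (mfderiv 𝓘(ℝ, E) 𝓘(ℝ, E) (extChartAt 𝓘(ℝ, E) x₀) x) :=
  (isInvertible_mfderiv_extChartAt (I := 𝓘(ℝ, E)) hx).injective

variable [CompleteSpace E]

theorem smoothFieldAt_chartConst {x₀ x : M} (hx : x ∈ (extChartAt 𝓘(ℝ, E) x₀).source) (v : E) :
    SmoothFieldAt (chartConst x₀ v) x := by
  refine ContMDiffAt.mpullback_vectorField_preimage (n := ∞) ?_ ?_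
    (isInvertible_mfderiv_extChartAt hx) (by simp)
  · exact (contMDiffAt_vectorSpace_iff_contDiffAt).2 contDiffAt_const
  · exact contMDiffAt_extChartAt' (by simpa using hx)

theorem SmoothFieldAt.contDiffAt_chartField {X : ∀ x : M, TangentSpace 𝓘(ℝ, E) x} {x₀ : M} {y : E}
    (hy : y ∈ (extChartAt 𝓘(ℝ, E) x₀).target)
    (hX : SmoothFieldAt X ((extChartAt 𝓘(ℝ, E) x₀).symm y)) :
    ContDiffAt ℝ ∞ (chartField x₀ X) y := by
  have h1 : (chartField x₀ X : E → E) =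
      VectorField.mpullback 𝓘(ℝ, E) 𝓘(ℝ, E) (extChartAt 𝓘(ℝ, E) x₀).symm X := by
    simp only [chartField, modelWithCornersSelf_coe, range_id, VectorField.mpullbackWithin_univ]
    rfl
  have h3 := isInvertible_mfderivWithin_extChartAt_symm (I := 𝓘(ℝ, E)) hy
  simp only [modelWithCornersSelf_coe, range_id, mfderivWithin_univ] at h3
  have h2 := ContMDiffAt.mpullback_vectorField_preimage (n := ∞) hX
    ((contMDiffOn_extChartAt_symm x₀).contMDiffAt ((isOpen_extChartAt_target x₀).mem_nhds hy))
    h3 (by simp)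
  rw [h1]
  exact contMDiffAt_vectorSpace_iff_contDiffAt.1 h2

theorem mfderiv_chart_eq_chartField {x₀ x : M} (hx : x ∈ (extChartAt 𝓘(ℝ, E) x₀).source)
    (X : ∀ x : M, TangentSpace 𝓘(ℝ, E) x) :
    (show E →L[ℝ] E from mfderiv 𝓘(ℝ, E) 𝓘(ℝ, E) (extChartAt 𝓘(ℝ, E) x₀) x) (X x) =
      chartField x₀ X (extChartAt 𝓘(ℝ, E) x₀ x) := by
  have h1 := mfderiv_symm_chartField ((extChartAt 𝓘(ℝ, E) x₀).map_source hx) X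
  have h2 := mfderiv_extChartAt_comp_mfderivWithin_extChartAt_symm' (I := 𝓘(ℝ, E)) hx
  simp only [modelWithCornersSelf_coe, range_id, mfderivWithin_univ] at h2
  have h3 := congrArg (fun L : E →L[ℝ] E => L (chartField x₀ X (extChartAt 𝓘(ℝ, E) x₀ x))) h2
  have h4 : ∀ (a b : M), a = b → (show E from X a) = (show E from X b) := by
    rintro a b rfl; rfl
  have h5 := h1.trans (h4 _ _ ((extChartAt 𝓘(ℝ, E) x₀).left_inv hx))
  refine Eq.trans ?_ h3
  exact congrArg
    (show E →L[ℝ] E from mfderiv 𝓘(ℝ, E) 𝓘(ℝ, E) (extChartAt 𝓘(ℝ, E) x₀) x) h5.symm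

variable [FiniteDimensional ℝ E] [T2Space M]

/-- A local vector field can be multiplied by a bump function to give a global one. -/
theorem exists_smul_contMDiff {U : Set M} (hU : IsOpen U) {x₀ : M} (hx₀ : x₀ ∈ U)
    {X : ∀ x : M, TangentSpace 𝓘(ℝ, E) x} (hX : ∀ x ∈ U, SmoothFieldAt X x) :
    ∃ χ : M → ℝ, χ x₀ = 1 ∧ ContMDiff 𝓘(ℝ, E) 𝓘(ℝ, E).tangent ∞
      (fun x => (⟨x, χ x • X x⟩ : TangentBundle 𝓘(ℝ, E) M)) := by
  obtain ⟨f, -, hf⟩ := (SmoothBumpFunction.nhds_basis_tsupport (I := 𝓘(ℝ, E)) x₀).mem_iff.1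
    (hU.mem_nhds hx₀)
  refine ⟨f, f.eq_one, ?_⟩
  exact ContMDiffOn.smul_section_of_tsupport f.contMDiff.contMDiffOn hU hf
    (fun x hx => (hX x hx).contMDiffWithinAt)

end Fields

/-! ### From a hyperplane distribution to a local defining 1-form -/

section Distributions

open Set Filter Topology

/-- A hyperplane is the kernel of a linear form, normalized on a given vector. -/
theorem exists_form_of_codim_one {V : Type*} [NormedAddCommGroup V] [NormedSpace ℝ V]
    [FiniteDimensional ℝ V] {H : Submodule ℝ V} (h : Module.finrank ℝ (V ⧸ H) = 1) :
    ∃ (α : V →L[ℝ] ℝ) (y : V), LinearMap.ker α.toLinearMap = H ∧ α y = 1 := by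
  let e : (V ⧸ H) ≃ₗ[ℝ] ℝ := LinearEquiv.ofFinrankEq _ _ (by simpa using h)
  obtain ⟨y, hy⟩ := H.mkQ_surjective (e.symm 1)
  refine ⟨(e.toLinearMap ∘ₗ H.mkQ).toContinuousLinearMap, y, ?_, ?_⟩
  · ext v
    simp
  · change e (H.mkQ y) = 1
    rw [hy]; simp

/-- The quotient by the kernel of a non-zero linear form. -/
theorem finrank_quotient_ker {V : Type*} [AddCommGroup V] [Module ℝ V] {α : V →ₗ[ℝ] ℝ}
    (h : α ≠ 0) : Module.finrank ℝ (V ⧸ LinearMap.ker α) = 1 := by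
  have hs : Function.Surjective α := LinearMap.surjective h
  rw [(α.quotKerEquivOfSurjective hs).finrank_eq]
  simp

variable {m : ℕ} {M : Type u} [TopologicalSpace M] [ChartedSpace (EuclideanSpace ℝ (Fin m)) M]
  [IsManifold (𝓡 m) ∞ M]

theorem contDiffAt_sum_smulRight {E F : Type*} [NormedAddCommGroup E] [NormedSpace ℝ E]
    [NormedAddCommGroup F] [NormedSpace ℝ F] {k : ℕ} {X : Fin k → E → F} {y : E}
    (h : ∀ i, ContDiffAt ℝ ∞ (X i) y) (v : F) :
    ContDiffAt ℝ ∞ (fun z => (∑ i, ((ContinuousLinearMap.proj i).comp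
      (ContinuousLinearMap.fst ℝ (Fin k → ℝ) ℝ)).smulRight (X i z)
      + (ContinuousLinearMap.snd ℝ (Fin k → ℝ) ℝ).smulRight v : (Fin k → ℝ) × ℝ →L[ℝ] F)) y := by
  refine ContDiffAt.add (ContDiffAt.sum fun i _ => ?_) contDiffAt_const
  exact ContDiffAt.smulRight contDiffAt_const (h i)

/-- Locally, a hyperplane distribution is the kernel of a smooth 1-form `θ`, and there is a vector
field `Y` with `θ(Y) = 1`. -/
theorem IsHyperplaneDistribution.exists_localForm
    {H : ∀ x : M, Submodule ℝ (TangentSpace (𝓡 m) x)} (hH : IsHyperplaneDistribution H) (x₀ : M) :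
    ∃ (U : Set M) (θ : ∀ x : M, TangentSpace (𝓡 m) x →L[ℝ] ℝ) (Y : ∀ x : M, TangentSpace (𝓡 m) x),
      IsOpen U ∧ x₀ ∈ U ∧ (∀ x, LinearMap.ker (θ x).toLinearMap = H x) ∧ (∀ x, θ x (Y x) = 1) ∧
      ∀ x ∈ U, SmoothFormAt θ x ∧ SmoothFieldAt Y x := by
  classical
  -- Pointwise choices without any regularity: `y x₀` provides a vector transverse to H at x₀, and
  -- both families serve as default values away from x₀.
  have hpt : ∀ x, ∃ (α : TangentSpace (𝓡 m) x →L[ℝ] ℝ) (y : TangentSpace (𝓡 m) x),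
      LinearMap.ker α.toLinearMap = H x ∧ α y = 1 := fun x =>
    exists_form_of_codim_one (V := EuclideanSpace ℝ (Fin m)) (hH.codim_one x)
  choose α y hα hy using hpt
  obtain ⟨U, hU, hx₀, k, X, hX, hframe⟩ := hH.exists_frame x₀
  have hX' : ∀ i, ∀ x ∈ U, SmoothFieldAt (X i) x := fun i x hx =>
    (hX i).contMDiffAt (hU.mem_nhds hx)
  let E := EuclideanSpace ℝ (Fin m)
  let φ := extChartAt (𝓡 m) x₀
  let v : E := y x₀
  -- In the chart, A z sends (a, b) to Σ aᵢ Xᵢ(z) + b v, where v is transverse to H at x₀. It is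
  -- invertible at the centre, hence nearby, and it straightens H.
  let A : E → ((Fin k → ℝ) × ℝ →L[ℝ] E) := fun z =>
    ∑ i, ((ContinuousLinearMap.proj i).comp
      (ContinuousLinearMap.fst ℝ (Fin k → ℝ) ℝ)).smulRight (chartField x₀ (X i) z)
      + (ContinuousLinearMap.snd ℝ (Fin k → ℝ) ℝ).smulRight v
  have hAapp : ∀ z a b, A z (a, b) = ∑ i, a i • chartField x₀ (X i) z + b • v := by
    intro z a b
    simp [A]
  have hA : ∀ z ∈ φ.target, φ.symm z ∈ U → ContDiffAt ℝ ∞ A z := fun z hz hzU =>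
    contDiffAt_sum_smulRight (fun i => (hX' i _ hzU).contDiffAt_chartField hz) v
  have hinj : Function.Injective (A (φ x₀)) := by
    rw [injective_iff_map_eq_zero]
    rintro ⟨a, b⟩ hab
    rw [hAapp] at hab
    simp only [φ, chartField_self] at hab
    have hspan : (∑ i, a i • X i x₀ : TangentSpace (𝓡 m) x₀) ∈ H x₀ := by
      rw [← (hframe x₀ hx₀).2]
      exact Submodule.sum_mem _ fun i _ => Submodule.smul_mem _ _ (Submodule.subset_span ⟨i, rfl⟩)
    rw [← hα] at hspan
    have hb : b = 0 := by
      have h1 := congrArg (α x₀) hab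
      have h2 : α x₀ (∑ i, a i • X i x₀) = 0 := hspan
      have h3 : α x₀ (∑ i, a i • X i x₀ + b • y x₀) = 0 := h1.trans (map_zero _)
      rw [map_add, h2, map_smul, hy] at h3
      simpa using h3
    subst hb
    rw [zero_smul, add_zero] at hab
    have h4 : ∑ i, a i • X i x₀ = 0 := hab
    have := Fintype.linearIndependent_iff.1 (hframe x₀ hx₀).1 a h4
    ext i
    · exact this i
    · rfl
  have hsurj : Function.Surjective (A (φ x₀)) := by
    intro w
    let w' : TangentSpace (𝓡 m) x₀ := w
    have h1 : w' - α x₀ w' • y x₀ ∈ H x₀ := by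
      rw [← hα]
      change α x₀ _ = 0
      rw [map_sub, map_smul, hy]; simp
    rw [← (hframe x₀ hx₀).2] at h1
    obtain ⟨a, ha⟩ := (Submodule.mem_span_range_iff_exists_fun ℝ).1 h1
    refine ⟨(a, α x₀ w'), ?_⟩
    rw [hAapp]
    simp only [φ, chartField_self]
    have h2 : ∑ i, a i • X i x₀ + α x₀ w' • y x₀ = w' := by rw [ha]; simp
    exact h2
  let A₀ : ((Fin k → ℝ) × ℝ) ≃L[ℝ] E :=
    (LinearEquiv.ofBijective (A (φ x₀)).toLinearMap ⟨hinj, hsurj⟩).toContinuousLinearEquiv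
  have hA₀ : (A₀ : (Fin k → ℝ) × ℝ →L[ℝ] E) = A (φ x₀) := rfl
  have hφ₀ : φ x₀ ∈ φ.target := mem_extChartAt_target x₀
  have hinv : ∀ᶠ z in 𝓝 (φ x₀), A z ∈ range ((↑) : (((Fin k → ℝ) × ℝ) ≃L[ℝ] E) → _) := by
    have h1 : ContinuousAt A (φ x₀) :=
      (hA _ hφ₀ (by simpa [φ] using hx₀)).continuousAt
    refine h1.eventually ?_
    rw [← hA₀]
    exact A₀.nhds
  have hev : ∀ᶠ x in 𝓝 x₀, x ∈ φ.source ∧ x ∈ U ∧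
      A (φ x) ∈ range ((↑) : (((Fin k → ℝ) × ℝ) ≃L[ℝ] E) → _) :=
    Filter.Eventually.and (extChartAt_source_mem_nhds x₀) (Filter.Eventually.and (hU.mem_nhds hx₀)
      ((continuousAt_extChartAt x₀).eventually hinv))
  obtain ⟨V, hV, hVo, hx₀V⟩ := eventually_nhds_iff.1 hev
  -- The last component of the inverse of A z. Where A z is invertible, it takes the value 1 on v =
  -- A z (0, 1) and vanishes exactly on the span of the frame.
  let η : E → E →L[ℝ] ℝ := fun z =>
    (ContinuousLinearMap.snd ℝ (Fin k → ℝ) ℝ).comp (A z).inverse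
  let θ' : ∀ x : M, TangentSpace (𝓡 m) x →L[ℝ] ℝ := ofChartForm x₀ η
  have hηs : ∀ x ∈ V, ContDiffAt ℝ ∞ η (φ x) := by
    intro x hx
    obtain ⟨h1, h2, B, hB⟩ := hV x hx
    have h3 : ContDiffAt ℝ ∞ A (φ x) := hA _ (φ.map_source h1) (by rwa [φ.left_inv h1])
    have h4 : ContDiffAt ℝ ∞ ContinuousLinearMap.inverse (A (φ x)) := by
      rw [← hB]; exact contDiffAt_map_inverse B
    exact contDiffAt_const.clm_comp (h4.comp _ h3)
  have hθ's : ∀ x ∈ V, SmoothFormAt θ' x := by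
    intro x hx
    exact smoothFormAt_ofChartForm (hV x hx).1 (hηs x hx)
  have hY's : ∀ x ∈ V, SmoothFieldAt (chartConst x₀ v) x := fun x hx =>
    smoothFieldAt_chartConst (hV x hx).1 v
  have hθ'Y : ∀ x ∈ V, θ' x (chartConst x₀ v x) = 1 := by
    intro x hx
    obtain ⟨h1, h2, B, hB⟩ := hV x hx
    have h5 : θ' x (chartConst x₀ v x) = ((A (φ x)).inverse v).2 :=
      congrArg (fun w => ((A (φ x)).inverse w).2) (mfderiv_chartConst h1 v)
    have h6 : A (φ x) (0, 1) = v := by rw [hAapp]; simp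
    rw [h5, ← hB, ContinuousLinearMap.inverse_equiv]
    rw [← hB] at h6
    have h7 : B.symm v = (0, 1) := by rw [← h6]; simp
    exact congrArg Prod.snd h7
  have hθ'H : ∀ x ∈ V, LinearMap.ker (θ' x).toLinearMap = H x := by
    intro x hx
    obtain ⟨h1, h2, B, hB⟩ := hV x hx
    let D : TangentSpace (𝓡 m) x →L[ℝ] E := mfderiv (𝓡 m) 𝓘(ℝ, E) φ x
    have hDi : Function.Injective D := mfderiv_chart_injective h1
    have hD : ∀ i, D (X i x) = chartField x₀ (X i) (φ x) := fun i =>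
      mfderiv_chart_eq_chartField h1 (X i)
    have hθ'D : ∀ w, θ' x w = (B.symm (D w)).2 := by
      intro w
      have : θ' x w = ((A (φ x)).inverse (D w)).2 := rfl
      rw [this, ← hB, ContinuousLinearMap.inverse_equiv]
      rfl
    have hBapp : ∀ a b, B (a, b) = ∑ i, a i • chartField x₀ (X i) (φ x) + b • v := by
      intro a b
      rw [← hAapp, ← hB]; rfl
    ext w
    rw [← (hframe x h2).2, Submodule.mem_span_range_iff_exists_fun]
    change θ' x w = 0 ↔ _
    rw [hθ'D]
    constructor
    · intro hw
      refine ⟨(B.symm (D w)).1, hDi ?_⟩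
      rw [map_sum]
      simp only [map_smul, hD]
      have h3 := hBapp (B.symm (D w)).1 (B.symm (D w)).2
      rw [Prod.mk.eta, B.apply_symm_apply, hw, zero_smul, add_zero] at h3
      exact h3.symm
    · rintro ⟨a, rfl⟩
      have h3 : D (∑ i, a i • X i x) = B (a, 0) := by
        rw [hBapp, map_sum]
        simp only [map_smul, hD, zero_smul, add_zero]
      rw [h3]; simp
  -- Outside V the pointwise choices take over, so the kernel condition and the normalization hold
  -- at every point and only smoothness is local.
  refine ⟨V, fun x => if x ∈ V then θ' x else α x, fun x => if x ∈ V then chartConst x₀ v x else y x,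
    hVo, hx₀V, ?_, ?_, ?_⟩
  · intro x
    by_cases hx : x ∈ V
    · simp only [hx, if_true]; exact hθ'H x hx
    · simp only [hx, if_false]; exact hα x
  · intro x
    by_cases hx : x ∈ V
    · simp only [hx, if_true]; exact hθ'Y x hx
    · simp only [hx, if_false]; exact hy x
  · intro x hx
    refine ⟨(hθ's x hx).congr ?_, (hY's x hx).congr ?_⟩
    · filter_upwards [hVo.mem_nhds hx] with z hz
      simp only [hz, if_true]
    · filter_upwards [hVo.mem_nhds hx] with z hz
      simp only [hz, if_true]

end Distributions

/-! ### From local 1-forms to distributions; the contact condition in terms of dθ -/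

section Distributions

open Set Filter Topology

variable {m : ℕ} {M : Type u} [TopologicalSpace M] [ChartedSpace (EuclideanSpace ℝ (Fin m)) M]
  [IsManifold (𝓡 m) ∞ M]

/-- The kernels of local non-vanishing smooth 1-forms form a hyperplane distribution. -/
theorem isHyperplaneDistribution_of_localForm
    {H : ∀ x : M, Submodule ℝ (TangentSpace (𝓡 m) x)}
    (h : ∀ x₀ : M, ∃ (U : Set M) (θ : ∀ x : M, TangentSpace (𝓡 m) x →L[ℝ] ℝ),
      IsOpen U ∧ x₀ ∈ U ∧ ∀ x ∈ U, LinearMap.ker (θ x).toLinearMap = H x ∧ θ x ≠ 0 ∧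
        SmoothFormAt θ x) : IsHyperplaneDistribution H where
  codim_one x := by
    obtain ⟨U, θ, -, hx, h⟩ := h x
    obtain ⟨h1, h2, -⟩ := h x hx
    rw [← h1]
    exact finrank_quotient_ker fun h3 => h2 (by ext v; exact congrArg (fun L => L v) h3)
  exists_frame x₀ := by
    obtain ⟨U, θ, hU, hx₀, h⟩ := h x₀
    let E := EuclideanSpace ℝ (Fin m)
    let α : E →L[ℝ] ℝ := θ x₀
    have hα : α ≠ 0 := (h x₀ hx₀).2.1
    obtain ⟨y₀, hy₀⟩ : ∃ y, α y = 1 := by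
      have : Function.Surjective α.toLinearMap :=
        LinearMap.surjective fun h3 => hα (by ext v; exact congrArg (fun L => L v) h3)
      exact this 1
    let K := LinearMap.ker α.toLinearMap
    let b := Module.finBasis ℝ K
    let V : Fin (Module.finrank ℝ K) → ∀ x : M, TangentSpace (𝓡 m) x := fun i =>
      chartConst x₀ (b i : E)
    let Y : ∀ x : M, TangentSpace (𝓡 m) x := chartConst x₀ y₀
    let S := (extChartAt (𝓡 m) x₀).source
    have hθY : ∀ x ∈ U ∩ S, ContMDiffAt (𝓡 m) 𝓘(ℝ, ℝ) ∞ (fun x => θ x (Y x)) x := fun x hx =>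
      (h x hx.1).2.2.apply (smoothFieldAt_chartConst hx.2 _)
    have hθV : ∀ i, ∀ x ∈ U ∩ S, ContMDiffAt (𝓡 m) 𝓘(ℝ, ℝ) ∞ (fun x => θ x (V i x)) x :=
      fun i x hx => (h x hx.1).2.2.apply (smoothFieldAt_chartConst hx.2 _)
    have hYx₀ : θ x₀ (Y x₀) = 1 := by
      have : Y x₀ = y₀ := chartConst_self x₀ y₀
      rw [this]; exact hy₀
    have hev : ∀ᶠ x in 𝓝 x₀, x ∈ U ∩ S ∧ θ x (Y x) ≠ 0 := by
      have h0 : U ∩ S ∈ 𝓝 x₀ :=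
        inter_mem (hU.mem_nhds hx₀) (extChartAt_source_mem_nhds (I := 𝓡 m) x₀)
      have h1 : ContinuousAt (fun x => θ x (Y x)) x₀ :=
        (hθY x₀ ⟨hx₀, mem_extChartAt_source x₀⟩).continuousAt
      have h2 := h1.eventually_ne (y := 0) (by rw [hYx₀]; exact one_ne_zero)
      filter_upwards [h0, h2] with x h3 h4 using ⟨h3, h4⟩
    obtain ⟨W, hW, hWo, hx₀W⟩ := eventually_nhds_iff.1 hev
    -- The constant-coordinate fields V i span ker θ at x₀, but elsewhere they may leave it. They
    -- are projected to ker θ along Y, which stays transverse on W.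
    refine ⟨W, hWo, hx₀W, Module.finrank ℝ K,
      fun i x => V i x + (-(θ x (V i x) / θ x (Y x))) • Y x, ?_, ?_⟩
    · intro i x hx
      have h1 := hW x hx
      have h2 : ContMDiffAt (𝓡 m) 𝓘(ℝ, ℝ) ∞ (fun x => -(θ x (V i x) / θ x (Y x))) x :=
        ((hθV i x h1.1).div₀ (hθY x h1.1) h1.2).neg
      exact ((smoothFieldAt_chartConst h1.1.2 (b i : E)).add
        ((smoothFieldAt_chartConst h1.1.2 y₀).smul h2)).contMDiffWithinAt
    · intro x hx
      obtain ⟨⟨hxU, hxS⟩, hne⟩ := hW x hx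
      let D : TangentSpace (𝓡 m) x →L[ℝ] E := mfderiv (𝓡 m) 𝓘(ℝ, E) (extChartAt (𝓡 m) x₀) x
      have hDi : Function.Injective D := mfderiv_chart_injective hxS
      have hDV : ∀ i, D (V i x) = (b i : E) := fun i => mfderiv_chartConst hxS _
      have hDY : D (Y x) = y₀ := mfderiv_chartConst hxS _
      constructor
      · rw [Fintype.linearIndependent_iff]
        intro a ha i
        have h1 := congrArg D ha
        simp only [map_sum, map_smul, map_add, hDV, hDY, map_zero] at h1
        -- α, the value of θ at x₀, kills each b i and is 1 on y₀. It therefore shows that the total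
        -- coefficient of y₀ is zero, which leaves a relation among the b i.
        have h2 := congrArg α h1
        have hb0 : ∀ i, α (b i : E) = 0 := fun i => (b i).2
        simp only [map_sum, map_smul, map_add, map_zero, hb0, hy₀, zero_add, smul_eq_mul,
          mul_one] at h2
        simp only [smul_add, Finset.sum_add_distrib, ← smul_assoc, ← Finset.sum_smul,
          smul_eq_mul] at h1
        rw [h2, zero_smul, add_zero] at h1
        have h3 : ∑ i, a i • b i = 0 := by
          apply Subtype.ext
          simpa using h1
        exact Fintype.linearIndependent_iff.1 b.linearIndependent a h3 i
      · rw [← (h x hxU).1]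
        apply le_antisymm
        · rw [Submodule.span_le]
          rintro _ ⟨i, rfl⟩
          change θ x _ = 0
          rw [map_add, map_smul, smul_eq_mul, neg_mul, div_mul_cancel₀ _ hne, add_neg_cancel]
        · intro w hw
          have hw' : θ x w = 0 := hw
          -- The image of w in the chart is split along ker α ⊕ ℝ y₀. The equation θ(w) = 0 at x
          -- then forces the coefficient of Y to be the one in the corrected frame.
          have h1 : D w - α (D w) • y₀ ∈ K := by
            change α _ = 0
            rw [map_sub, map_smul, hy₀]; simp
          let a := b.repr ⟨_, h1⟩
          have h2 : D w = ∑ i, a i • (b i : E) + α (D w) • y₀ := by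
            have := congrArg (Submodule.subtype K) (b.sum_repr ⟨_, h1⟩)
            rw [map_sum] at this
            simp only [map_smul, Submodule.subtype_apply] at this
            rw [this]; simp
          have h3 : w = ∑ i, a i • V i x + α (D w) • Y x := by
            apply hDi
            simp only [map_sum, map_smul, map_add, hDV, hDY]
            exact h2
          have h4 : α (D w) = - ((∑ i, a i * θ x (V i x)) / θ x (Y x)) := by
            have := congrArg (θ x) h3
            rw [hw'] at this
            simp only [map_sum, map_smul, map_add, smul_eq_mul] at this
            field_simp
            linarith
          rw [Submodule.mem_span_range_iff_exists_fun]
          refine ⟨a, ?_⟩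
          conv_rhs => rw [h3, h4]
          simp only [smul_add, Finset.sum_add_distrib, ← smul_assoc, ← Finset.sum_smul,
            smul_eq_mul]
          congr 2
          rw [Finset.sum_div, ← Finset.sum_neg_distrib]
          exact Finset.sum_congr rfl fun i _ => by ring

/-- A vector in a hyperplane distribution extends to a section. -/
theorem IsHyperplaneDistribution.exists_section [T2Space M]
    {H : ∀ x : M, Submodule ℝ (TangentSpace (𝓡 m) x)} (hH : IsHyperplaneDistribution H) {x₀ : M}
    {v : TangentSpace (𝓡 m) x₀} (hv : v ∈ H x₀) :
    ∃ X : (∀ x : M, TangentSpace (𝓡 m) x), IsSectionOf H X ∧ X x₀ = v := by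
  classical
  obtain ⟨U, hU, hx₀, k, X, hX, hframe⟩ := hH.exists_frame x₀
  rw [← (hframe x₀ hx₀).2, Submodule.mem_span_range_iff_exists_fun] at hv
  obtain ⟨a, rfl⟩ := hv
  -- The value 0 off U keeps W in H everywhere; smoothness is needed on U only, as the bump function
  -- is supported there.
  let W : ∀ x : M, TangentSpace (𝓡 m) x := fun x => if x ∈ U then ∑ i, a i • X i x else 0
  have hW : ∀ x ∈ U, SmoothFieldAt W x := by
    intro x hx
    have h1 : SmoothFieldAt (fun x => ∑ i, a i • X i x) x :=
      SmoothFieldAt.sum fun i _ => SmoothFieldAt.smul ((hX i).contMDiffAt (hU.mem_nhds hx))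
        contMDiffAt_const
    refine h1.congr ?_
    filter_upwards [hU.mem_nhds hx] with z hz
    simp only [W, hz, if_true]
  obtain ⟨χ, hχ, hs⟩ := exists_smul_contMDiff hU hx₀ hW
  refine ⟨fun x => χ x • W x, ⟨hs, fun x => ?_⟩, ?_⟩
  · refine Submodule.smul_mem _ _ ?_
    by_cases hx : x ∈ U
    · simp only [W, hx, if_true]
      rw [← (hframe x hx).2]
      exact Submodule.sum_mem _ fun i _ => Submodule.smul_mem _ _ (Submodule.subset_span ⟨i, rfl⟩)
    · simp only [W, hx, if_false]
      exact Submodule.zero_mem _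
  · simp only [W, hx₀, if_true, hχ, one_smul]

/-- A tangent vector extends to a global vector field. -/
theorem exists_isSmoothField [T2Space M] {x₀ : M} (v : TangentSpace (𝓡 m) x₀) :
    ∃ X : (∀ x : M, TangentSpace (𝓡 m) x), IsSmoothField X ∧ X x₀ = v := by
  let v' : EuclideanSpace ℝ (Fin m) := v
  obtain ⟨χ, hχ, hs⟩ := exists_smul_contMDiff (isOpen_extChartAt_source (I := 𝓡 m) x₀)
    (mem_extChartAt_source x₀) (fun x hx => smoothFieldAt_chartConst hx v')
  refine ⟨_, hs, ?_⟩
  have h : chartConst x₀ v' x₀ = v := chartConst_self x₀ v'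
  rw [hχ, h, one_smul]

/-- On sections of the kernel of `θ`, the exterior derivative of `θ` is the curvature. -/
theorem extD_eq_neg_bracket {H : ∀ x : M, Submodule ℝ (TangentSpace (𝓡 m) x)}
    {θ : ∀ x : M, TangentSpace (𝓡 m) x →L[ℝ] ℝ} {x₀ : M}
    (hker : ∀ᶠ x in 𝓝 x₀, LinearMap.ker (θ x).toLinearMap = H x) (hθ : SmoothFormAt θ x₀)
    {X Y : ∀ x : M, TangentSpace (𝓡 m) x} (hX : IsSectionOf H X) (hY : IsSectionOf H Y) :
    extD θ x₀ (X x₀) (Y x₀) = - θ x₀ (bracket X Y x₀) := by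
  rw [← dOneForm_eq_extD hθ (hX.1 x₀) (hY.1 x₀), dOneForm]
  -- θ(X) and θ(Y) vanish identically near x₀, so only the bracket term of Cartan's formula
  -- survives.
  have key : ∀ Z : (∀ x : M, TangentSpace (𝓡 m) x), IsSectionOf H Z →
      (fun x => θ x (Z x)) =ᶠ[𝓝 x₀] fun _ => 0 := by
    intro Z hZ
    filter_upwards [hker] with x hx
    have : Z x ∈ H x := hZ.2 x
    rw [← hx] at this
    exact this
  have key2 : ∀ Z W : (∀ x : M, TangentSpace (𝓡 m) x), IsSectionOf H Z →
      fieldDeriv W (fun x => θ x (Z x)) x₀ = 0 := by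
    intro Z W hZ
    have h1 : (mfderiv (𝓡 m) 𝓘(ℝ, ℝ) (fun x => θ x (Z x)) x₀ : EuclideanSpace ℝ (Fin m) →L[ℝ] ℝ) =
      (mfderiv (𝓡 m) 𝓘(ℝ, ℝ) (fun _ : M => (0 : ℝ)) x₀ : EuclideanSpace ℝ (Fin m) →L[ℝ] ℝ) :=
      (key Z hZ).mfderiv_eq
    rw [mfderiv_const] at h1
    exact congrArg (fun L : EuclideanSpace ℝ (Fin m) →L[ℝ] ℝ => L (W x₀)) h1
  rw [key2 _ _ hX, key2 _ _ hY]
  ring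

theorem curvature_eq_zero_iff {H : ∀ x : M, Submodule ℝ (TangentSpace (𝓡 m) x)}
    {θ : ∀ x : M, TangentSpace (𝓡 m) x →L[ℝ] ℝ} {x₀ : M}
    (hker : LinearMap.ker (θ x₀).toLinearMap = H x₀) (X Y : ∀ x : M, TangentSpace (𝓡 m) x) :
    curvature H X Y x₀ = 0 ↔ θ x₀ (bracket X Y x₀) = 0 := by
  rw [curvature, Submodule.mkQ_apply, Submodule.Quotient.mk_eq_zero, ← hker]
  rfl

/-- On sections of H the curvature, seen through θ, is -dθ by `extD_eq_neg_bracket`. The required w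
is the value at x₀ of the second section. -/
theorem IsContactStructure.extD_nondegenerate {H : ∀ x : M, Submodule ℝ (TangentSpace (𝓡 m) x)}
    (hH : IsContactStructure H) {θ : ∀ x : M, TangentSpace (𝓡 m) x →L[ℝ] ℝ} {x₀ : M}
    (hker : ∀ᶠ x in 𝓝 x₀, LinearMap.ker (θ x).toLinearMap = H x) (hθ : SmoothFormAt θ x₀)
    {v : TangentSpace (𝓡 m) x₀} (hv : v ∈ H x₀) (hv0 : v ≠ 0) :
    ∃ w ∈ H x₀, extD θ x₀ v w ≠ 0 := by
  obtain ⟨X, Y, hX, hY, rfl, hne⟩ := hH.nondegenerate x₀ v hv hv0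
  refine ⟨Y x₀, hY.2 x₀, ?_⟩
  rw [extD_eq_neg_bracket hker hθ hX hY, neg_ne_zero]
  rwa [Ne, curvature_eq_zero_iff hker.self_of_nhds] at hne

/-- The converse of `IsContactStructure.extD_nondegenerate`: v and w extend to sections by bump
functions. Since dθ sees only values at x₀, the choice of extensions is irrelevant. The form θ may
change with the point. -/
theorem isContactStructure_of_extD [T2Space M] {H : ∀ x : M, Submodule ℝ (TangentSpace (𝓡 m) x)}
    (hH : IsHyperplaneDistribution H)
    (h : ∀ x₀ : M, ∃ θ : ∀ x : M, TangentSpace (𝓡 m) x →L[ℝ] ℝ,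
      (∀ᶠ x in 𝓝 x₀, LinearMap.ker (θ x).toLinearMap = H x) ∧ SmoothFormAt θ x₀ ∧
      ∀ v ∈ H x₀, v ≠ 0 → ∃ w ∈ H x₀, extD θ x₀ v w ≠ 0) : IsContactStructure H where
  isHyperplaneDistribution := hH
  nondegenerate x₀ v hv hv0 := by
    obtain ⟨θ, hker, hθ, h⟩ := h x₀
    obtain ⟨w, hw, hne⟩ := h v hv hv0
    obtain ⟨X, hX, rfl⟩ := hH.exists_section hv
    obtain ⟨Y, hY, rfl⟩ := hH.exists_section hw
    refine ⟨X, Y, hX, hY, rfl, ?_⟩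
    rw [Ne, curvature_eq_zero_iff hker.self_of_nhds]
    rwa [extD_eq_neg_bracket hker hθ hX hY, neg_ne_zero] at hne

end Distributions

/-! ### The Lie group of units of ℝ -/

section Units

open Set Filter Topology

/-- The unit of `ℝ` defined by a non-zero number (and `1` for the number `0`). -/
def unitOf (t : ℝ) : ℝˣ := if h : t ≠ 0 then Units.mk0 t h else 1

theorem coe_unitOf {t : ℝ} (h : t ≠ 0) : (unitOf t : ℝ) = t := by
  simp [unitOf, h]

theorem unitOf_coe (t : ℝˣ) : unitOf t = t := Units.ext (coe_unitOf t.ne_zero)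

theorem unitOf_one : unitOf 1 = 1 := Units.ext (coe_unitOf one_ne_zero)

variable {E X : Type*} [NormedAddCommGroup E] [NormedSpace ℝ E] {H : Type*} [TopologicalSpace H]
  {I : ModelWithCorners ℝ E H} [TopologicalSpace X] [ChartedSpace H X]

/-- The units carry the manifold structure of an open subset of ℝ, so the inclusion has a smooth
local inverse. -/
theorem contMDiffAt_of_val {f : X → ℝˣ} {x : X}
    (hf : ContMDiffAt I 𝓘(ℝ, ℝ) ∞ (fun x => (f x : ℝ)) x) : ContMDiffAt I 𝓘(ℝ, ℝ) ∞ f x := by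
  have h1 := contMDiffOn_isOpenEmbedding_symm (I := 𝓘(ℝ, ℝ)) (n := ∞)
    (Units.isOpenEmbedding_val (R := ℝ))
  have h2 : ContMDiffAt 𝓘(ℝ, ℝ) 𝓘(ℝ, ℝ) ∞
      (Units.isOpenEmbedding_val (R := ℝ)).toOpenPartialHomeomorph.symm (f x : ℝ) :=
    (h1 _ ⟨f x, rfl⟩).contMDiffAt ((Units.isOpenEmbedding_val (R := ℝ)).isOpen_range.mem_nhds
      ⟨f x, rfl⟩)
  refine (h2.comp x hf).congr_of_eventuallyEq (Eventually.of_forall fun y => ?_)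
  exact ((Units.isOpenEmbedding_val (R := ℝ)).toOpenPartialHomeomorph_left_inv _).symm

theorem contMDiffAt_unitOf {f : X → ℝ} {x : X} (hf : ContMDiffAt I 𝓘(ℝ, ℝ) ∞ f x)
    (h : f x ≠ 0) : ContMDiffAt I 𝓘(ℝ, ℝ) ∞ (fun x => unitOf (f x)) x := by
  refine contMDiffAt_of_val (hf.congr_of_eventuallyEq ?_)
  filter_upwards [hf.continuousAt.eventually_ne h] with y hy using coe_unitOf hy

end Units

/-! ### Principal bundles: local sections, fibre coordinates and the Euler field -/

section Homogeneous

open Set Filter Topology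

attribute [instance] HomogeneousManifold.smooth_smul

/-- A smooth section `σ` of a principal `ℝ*`-bundle over an open set `U`, together with the
fibre coordinate `c` that it defines. -/
structure LocalSection (Q : HomogeneousManifold.{u}) where
  U : Set Q.M
  σ : Q.M → Q.P
  c : Q.P → ℝˣ
  isOpen : IsOpen U
  proj_σ : ∀ x ∈ U, Q.proj (σ x) = x
  smooth_σ : ∀ x ∈ U, ContMDiffAt (𝓡 Q.M.dim) (𝓡 Q.P.dim) ∞ σ x
  smooth_c : ∀ p, Q.proj p ∈ U → ContMDiffAt (𝓡 Q.P.dim) 𝓘(ℝ, ℝ) ∞ (fun p => (c p : ℝ)) p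
  c_smul_σ : ∀ p, Q.proj p ∈ U → c p • σ (Q.proj p) = p
  c_smul : ∀ p, Q.proj p ∈ U → ∀ t : ℝˣ, c (t • p) = t * c p

variable {Q : HomogeneousManifold.{u}}

/-- The section is the slice with fibre component 1 of an equivariant trivialization, and c is the
fibre component. Equivariance gives p = c(p) • σ(π(p)), which is checked in the trivialization. -/
theorem exists_localSection (x₀ : Q.M) : ∃ s : LocalSection Q, x₀ ∈ s.U := by
  obtain ⟨e, hx, he, he', hc⟩ := Q.exists_trivialization x₀
  have hsrc : ∀ p, Q.proj p ∈ e.baseSet → p ∈ e.source := fun p hp => e.mem_source.2 hp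
  refine ⟨⟨e.baseSet, fun x => e.toOpenPartialHomeomorph.symm (x, 1), fun p => (e p).2,
    e.open_baseSet, fun x hx => e.proj_symm_apply' hx, fun x hx => ?_, fun p hp => ?_,
    fun p hp => ?_, fun p hp t => hc p (hsrc p hp) t⟩, hx⟩
  · have h1 : (x, (1 : ℝˣ)) ∈ e.target := e.mem_target.2 hx
    have h2 := (he' _ h1).contMDiffAt (e.open_target.mem_nhds h1)
    exact h2.comp x (contMDiffAt_id.prodMk contMDiffAt_const)
  · have h1 := (he _ (hsrc p hp)).contMDiffAt (e.open_source.mem_nhds (hsrc p hp))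
    exact (Units.contMDiff_val (𝕜 := ℝ) (n := ∞) (R := ℝ)).contMDiffAt.comp p
      (contMDiffAt_snd.comp p h1)
  · have hp1 : e.toOpenPartialHomeomorph.symm (Q.proj p, 1) ∈ e.source :=
      e.map_target (e.mem_target.2 hp)
    have hp2 : Q.proj (e.toOpenPartialHomeomorph.symm (Q.proj p, 1)) = Q.proj p :=
      e.proj_symm_apply' hp
    apply e.injOn (hsrc _ _) (hsrc p hp)
    · apply Prod.ext
      · refine (e.coe_fst' (by rw [Q.proj_smul]; exact hp2.symm ▸ hp)).trans ?_
        rw [Q.proj_smul]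
        exact hp2.trans (e.coe_fst' hp).symm
      · refine (hc _ hp1 _).trans ?_
        have h3 : (e (e.toOpenPartialHomeomorph.symm (Q.proj p, 1))).2 = 1 :=
          congrArg Prod.snd (e.apply_symm_apply' hp)
        rw [h3, mul_one]
        rfl
    · exact Set.mem_of_eq_of_mem ((Q.proj_smul _ _).trans hp2) hp

theorem LocalSection.c_σ (s : LocalSection Q) {x : Q.M} (hx : x ∈ s.U) : s.c (s.σ x) = 1 := by
  have h1 := s.proj_σ x hx
  have h2 : Q.proj (s.σ x) ∈ s.U := by rw [h1]; exact hx
  have h3 := congrArg s.c (s.c_smul_σ _ h2)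
  rw [h1, s.c_smul _ h2] at h3
  exact mul_right_cancel (h3.trans (one_mul _).symm)

theorem exists_smul_of_proj_eq {p q : Q.P} (h : Q.proj p = Q.proj q) : ∃ t : ℝˣ, t • p = q := by
  obtain ⟨s, hs⟩ := exists_localSection (Q.proj p)
  -- Both points are multiples of the same σ(x), so the ratio of their fibre coordinates carries one
  -- to the other.
  refine ⟨s.c q * (s.c p)⁻¹, ?_⟩
  have h1 := s.c_smul_σ p hs
  have h2 := s.c_smul_σ q (h ▸ hs)
  rw [← h] at h2
  have h3 : (s.c q * (s.c p)⁻¹) • p = (s.c q * (s.c p)⁻¹) • s.c p • s.σ (Q.proj p) := by rw [h1]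
  rw [h3, smul_smul, inv_mul_cancel_right, h2]

theorem contMDiff_smul_const (t : ℝˣ) :
    ContMDiff (𝓡 Q.P.dim) (𝓡 Q.P.dim) ∞ (fun q : Q.P => t • q) :=
  ContMDiffSMul.contMDiff_const_smul (I := 𝓘(ℝ, ℝ)) t

theorem contMDiffAt_smul {E X : Type*} [NormedAddCommGroup E] [NormedSpace ℝ E] {H : Type*}
    [TopologicalSpace H] {I : ModelWithCorners ℝ E H} [TopologicalSpace X] [ChartedSpace H X]
    {f : X → ℝˣ} {g : X → Q.P} {x : X} (hf : ContMDiffAt I 𝓘(ℝ, ℝ) ∞ f x)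
    (hg : ContMDiffAt I (𝓡 Q.P.dim) ∞ g x) :
    ContMDiffAt I (𝓡 Q.P.dim) ∞ (fun x => f x • g x) x :=
  hf.smul hg

/-- The infinitesimal generator of the action of `ℝ*` on a homogeneous manifold. -/
def euler (p : Q.P) : TangentSpace (𝓡 Q.P.dim) p :=
  (show EuclideanSpace ℝ (Fin Q.P.dim) from
    mfderiv 𝓘(ℝ, ℝ) (𝓡 Q.P.dim) (fun t : ℝ => unitOf t • p) 1 (1 : ℝ))

theorem contMDiffAt_orbit (p : Q.P) :
    ContMDiffAt 𝓘(ℝ, ℝ) (𝓡 Q.P.dim) ∞ (fun t : ℝ => unitOf t • p) 1 :=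
  contMDiffAt_smul (contMDiffAt_unitOf contMDiffAt_id one_ne_zero) contMDiffAt_const

/-- The derivative of a map along the Euler field. -/
theorem mfderiv_euler {E X : Type*} [NormedAddCommGroup E] [NormedSpace ℝ E]
    [TopologicalSpace X] [ChartedSpace E X] {f : Q.P → X} {p : Q.P}
    (hf : MDifferentiableAt (𝓡 Q.P.dim) 𝓘(ℝ, E) f p) :
    (show E from mfderiv (𝓡 Q.P.dim) 𝓘(ℝ, E) f p (euler p)) =
      mfderiv 𝓘(ℝ, ℝ) 𝓘(ℝ, E) (fun t : ℝ => f (unitOf t • p)) 1 (1 : ℝ) := by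
  have h1 : unitOf 1 • p = p := by rw [unitOf_one, one_smul]
  have h2 : MDifferentiableAt (𝓡 Q.P.dim) 𝓘(ℝ, E) f (unitOf 1 • p) := by rwa [h1]
  have h3 := mfderiv_comp (1 : ℝ) h2 ((contMDiffAt_orbit p).mdifferentiableAt (by simp))
  have h4 : mfderiv (𝓡 Q.P.dim) 𝓘(ℝ, E) f (unitOf 1 • p) =
    (show EuclideanSpace ℝ (Fin Q.P.dim) →L[ℝ] E from mfderiv (𝓡 Q.P.dim) 𝓘(ℝ, E) f p) := by
    rw [h1]
  rw [h4] at h3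
  exact (congrArg (fun L : ℝ →L[ℝ] E => L 1) h3).symm

theorem mfderiv_proj_euler (p : Q.P) :
    mfderiv (𝓡 Q.P.dim) (𝓡 Q.M.dim) Q.proj p (euler p) = 0 := by
  refine (mfderiv_euler (Q.smooth_proj.mdifferentiableAt (by simp))).trans ?_
  have h : (fun t : ℝ => Q.proj (unitOf t • p)) = fun _ => Q.proj p :=
    funext fun t => Q.proj_smul _ _
  refine (congrArg (fun f : ℝ → Q.M => (show EuclideanSpace ℝ (Fin Q.M.dim) from
    mfderiv 𝓘(ℝ, ℝ) (𝓡 Q.M.dim) f 1 (1 : ℝ))) h).trans ?_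
  rw [mfderiv_const]
  rfl

theorem mfderiv_euler_of_equivariant {Q' : HomogeneousManifold.{u}} {f : Q.P → Q'.P} {p : Q.P}
    (hf : MDifferentiableAt (𝓡 Q.P.dim) (𝓡 Q'.P.dim) f p) (h : ∀ t : ℝˣ, f (t • p) = t • f p) :
    mfderiv (𝓡 Q.P.dim) (𝓡 Q'.P.dim) f p (euler p) = euler (f p) := by
  refine (mfderiv_euler hf).trans ?_
  exact congrArg (fun g : ℝ → Q'.P => (show EuclideanSpace ℝ (Fin Q'.P.dim) from
    mfderiv 𝓘(ℝ, ℝ) (𝓡 Q'.P.dim) g 1 (1 : ℝ))) (funext fun t => h (unitOf t))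

namespace LocalSection

/-- Euler's relation for c, which is homogeneous of degree 1 along the fibres. -/
theorem mfderiv_c_euler (s : LocalSection Q) {p : Q.P} (hp : Q.proj p ∈ s.U) :
    (show ℝ from mfderiv (𝓡 Q.P.dim) 𝓘(ℝ, ℝ) (fun p => (s.c p : ℝ)) p (euler p)) = s.c p := by
  refine (mfderiv_euler ((s.smooth_c p hp).mdifferentiableAt (by simp))).trans ?_
  have h1 : (fun t : ℝ => (s.c (unitOf t • p) : ℝ)) =ᶠ[𝓝 1] fun t => t * s.c p := by
    filter_upwards [eventually_ne_nhds one_ne_zero] with t ht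
    rw [s.c_smul p hp, Units.val_mul, coe_unitOf ht]
  rw [h1.mfderiv_eq, mfderiv_eq_fderiv]
  have h2 : HasDerivAt (fun t : ℝ => t * (s.c p : ℝ)) (1 * (s.c p : ℝ)) 1 :=
    (hasDerivAt_id (1 : ℝ)).mul_const _
  exact h2.deriv.trans (one_mul _)

theorem proj_mem_nhds (s : LocalSection Q) {p : Q.P} (hp : Q.proj p ∈ s.U) :
    ∀ᶠ q in 𝓝 p, Q.proj q ∈ s.U :=
  Q.smooth_proj.continuous.continuousAt.preimage_mem_nhds (s.isOpen.mem_nhds hp)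

end LocalSection

/-- A tangent vector is determined by its projection and its fibre component. -/
theorem LocalSection.tangent_ext (s : LocalSection Q) {p : Q.P} (hp : Q.proj p ∈ s.U)
    {v w : TangentSpace (𝓡 Q.P.dim) p}
    (h1 : mfderiv (𝓡 Q.P.dim) (𝓡 Q.M.dim) Q.proj p v = mfderiv (𝓡 Q.P.dim) (𝓡 Q.M.dim) Q.proj p w)
    (h2 : (show ℝ from mfderiv (𝓡 Q.P.dim) 𝓘(ℝ, ℝ) (fun p => (s.c p : ℝ)) p v) =
      mfderiv (𝓡 Q.P.dim) 𝓘(ℝ, ℝ) (fun p => (s.c p : ℝ)) p w) : v = w := by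
  -- G is a smooth left inverse of g near p, so the derivative of g, which records both components,
  -- is injective at p.
  let g : Q.P → ℝ × Q.M := fun q => ((s.c q : ℝ), Q.proj q)
  let G : ℝ × Q.M → Q.P := fun z => unitOf z.1 • s.σ z.2
  have hg : MDifferentiableAt (𝓡 Q.P.dim) (𝓘(ℝ, ℝ).prod (𝓡 Q.M.dim)) g p :=
    ((s.smooth_c p hp).mdifferentiableAt (by simp)).prodMk
      (Q.smooth_proj.mdifferentiableAt (by simp))
  have hG : MDifferentiableAt (𝓘(ℝ, ℝ).prod (𝓡 Q.M.dim)) (𝓡 Q.P.dim) G (g p) := by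
    refine (contMDiffAt_smul (contMDiffAt_unitOf contMDiffAt_fst (s.c p).ne_zero)
      ?_).mdifferentiableAt (n := ∞) (by simp)
    exact (s.smooth_σ _ hp).comp (g p) contMDiffAt_snd
  have h3 : G ∘ g =ᶠ[𝓝 p] id := by
    filter_upwards [s.proj_mem_nhds hp] with q hq
    change unitOf (s.c q) • s.σ (Q.proj q) = q
    rw [unitOf_coe, s.c_smul_σ q hq]
  have h4 := mfderiv_comp p hG hg
  have h5 : (show EuclideanSpace ℝ (Fin Q.P.dim) →L[ℝ] EuclideanSpace ℝ (Fin Q.P.dim) from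
    mfderiv (𝓡 Q.P.dim) (𝓡 Q.P.dim) (G ∘ g) p) = ContinuousLinearMap.id ℝ _ :=
    (h3.mfderiv_eq).trans mfderiv_id
  have h6 := h4.symm.trans h5
  have h7 : mfderiv (𝓡 Q.P.dim) (𝓘(ℝ, ℝ).prod (𝓡 Q.M.dim)) g p v =
      mfderiv (𝓡 Q.P.dim) (𝓘(ℝ, ℝ).prod (𝓡 Q.M.dim)) g p w := by
    have h8 := mfderiv_prodMk ((s.smooth_c p hp).mdifferentiableAt (by simp))
      (Q.smooth_proj.mdifferentiableAt (x := p) (by simp))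
    change mfderiv (𝓡 Q.P.dim) (𝓘(ℝ, ℝ).prod (𝓡 Q.M.dim))
      (fun q : Q.P => ((s.c q : ℝ), Q.proj q)) p v = mfderiv (𝓡 Q.P.dim)
      (𝓘(ℝ, ℝ).prod (𝓡 Q.M.dim)) (fun q : Q.P => ((s.c q : ℝ), Q.proj q)) p w
    rw [h8]
    exact Prod.ext h2 h1
  have h8 : ∀ u : EuclideanSpace ℝ (Fin Q.P.dim), (show EuclideanSpace ℝ (Fin Q.P.dim) from
      mfderiv (𝓘(ℝ, ℝ).prod (𝓡 Q.M.dim)) (𝓡 Q.P.dim) G (g p)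
        (mfderiv (𝓡 Q.P.dim) (𝓘(ℝ, ℝ).prod (𝓡 Q.M.dim)) g p u)) = u := fun u =>
    congrArg (fun L : EuclideanSpace ℝ (Fin Q.P.dim) →L[ℝ] EuclideanSpace ℝ (Fin Q.P.dim) => L u) h6
  exact (h8 v).symm.trans ((congrArg _ h7).trans (h8 w))

/-- The kernel of the differential of the projection is spanned by the Euler field. -/
theorem eq_smul_euler_of_mfderiv_proj_eq_zero {p : Q.P} {v : TangentSpace (𝓡 Q.P.dim) p}
    (hv : mfderiv (𝓡 Q.P.dim) (𝓡 Q.M.dim) Q.proj p v = 0) : ∃ a : ℝ, v = a • euler p := by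
  obtain ⟨s, hs⟩ := exists_localSection (Q.proj p)
  let D : ℝ := mfderiv (𝓡 Q.P.dim) 𝓘(ℝ, ℝ) (fun p => (s.c p : ℝ)) p v
  -- dc(E) = c, so this multiple of E has the same fibre component as v.
  refine ⟨D / s.c p, s.tangent_ext hs ?_ ?_⟩
  · rw [map_smul, mfderiv_proj_euler, smul_zero, hv]
  · have h1 := s.mfderiv_c_euler hs
    have h2 := map_smul (mfderiv (𝓡 Q.P.dim) 𝓘(ℝ, ℝ) (fun p => (s.c p : ℝ)) p) (D / (s.c p : ℝ))
      (euler p)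
    refine Eq.trans ?_ h2.symm
    refine Eq.trans ?_ (congrArg (fun r : ℝ => (D / (s.c p : ℝ)) * r) h1.symm)
    exact (div_mul_cancel₀ D (s.c p).ne_zero).symm

theorem mfderiv_smul_const_euler (t : ℝˣ) (p : Q.P) :
    mfderiv (𝓡 Q.P.dim) (𝓡 Q.P.dim) (fun q : Q.P => t • q) p (euler p) = euler (t • p) :=
  mfderiv_euler_of_equivariant ((contMDiff_smul_const t).mdifferentiableAt (by simp))
    fun r => smul_comm t r p

theorem euler_ne_zero (p : Q.P) : euler p ≠ 0 := by
  obtain ⟨s, hs⟩ := exists_localSection (Q.proj p)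
  intro h
  have h1 := s.mfderiv_c_euler hs
  rw [h, map_zero] at h1
  exact (s.c p).ne_zero h1.symm

end Homogeneous

/-! ### Cartan's magic formula for a homogeneous closed 2-form, in coordinates -/

section HomogeneousForm

open Set Filter Topology

variable {E : Type*} [NormedAddCommGroup E] [NormedSpace ℝ E]

/-- A closed 2-form that is homogeneous of degree 1 with respect to a local action `h` of `ℝ*` is
the exterior derivative of its contraction with the infinitesimal generator. -/
theorem altD_contraction_of_homogeneous {β : E → E →L[ℝ] E →L[ℝ] ℝ} {h : ℝ × E → E} {y₀ : E}
    (hh : ContDiffAt ℝ ∞ h (1, y₀)) (h1 : ∀ᶠ y in 𝓝 y₀, h (1, y) = y)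
    (hβ : DifferentiableAt ℝ β y₀)
    (hhom : ∀ b c : E, ∀ᶠ t in 𝓝 (1 : ℝ), β (h (t, y₀)) (fderiv ℝ h (t, y₀) (0, b))
      (fderiv ℝ h (t, y₀) (0, c)) = t * β y₀ b c)
    (hskew : ∀ a b, β y₀ a b = - β y₀ b a) (hclosed : ∀ a b c, altD₂ β y₀ a b c = 0) (b c : E) :
    altD (fun y => β y (fderiv ℝ h (1, y) (1, 0))) y₀ b c = β y₀ b c := by
  have h0 : h (1, y₀) = y₀ := h1.self_of_nhds
  have hh1 : HasFDerivAt h (fderiv ℝ h (1, y₀)) (1, y₀) :=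
    (hh.differentiableAt (by simp)).hasFDerivAt
  have hh2 : HasFDerivAt (fderiv ℝ h) (fderiv ℝ (fderiv ℝ h) (1, y₀)) (1, y₀) :=
    ((hh.fderiv_right (m := ∞) (by simp)).differentiableAt (by simp)).hasFDerivAt
  set D := fderiv ℝ (fderiv ℝ h) (1, y₀) with hD
  have hsymm : ∀ v w, D v w = D w v := fun v w =>
    (hh.isSymmSndFDerivAt (by simp; exact ENat.LEInfty.out)).eq v w
  have hid : ∀ b : E, fderiv ℝ h (1, y₀) (0, b) = b := by
    intro b
    have h2 : HasFDerivAt (fun y : E => h (1, y))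
        ((fderiv ℝ h (1, y₀)).comp (ContinuousLinearMap.inr ℝ ℝ E)) y₀ :=
      HasFDerivAt.comp (g := h) (f := fun y : E => ((1 : ℝ), y)) y₀ hh1
        (hasFDerivAt_prodMk_right (1 : ℝ) y₀)
    have h3 : HasFDerivAt (fun y : E => h (1, y)) (ContinuousLinearMap.id ℝ E) y₀ :=
      (hasFDerivAt_id y₀).congr_of_eventuallyEq h1
    exact congrArg (fun L : E →L[ℝ] E => L b) (h2.unique h3)
  -- the derivative of the generator
  have hE : HasFDerivAt (fun y : E => fderiv ℝ h (1, y) ((1 : ℝ), (0 : E)))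
      ((D.comp (ContinuousLinearMap.inr ℝ ℝ E)).flip (1, 0)) y₀ := by
    have h2 : HasFDerivAt (fun y : E => fderiv ℝ h (1, y))
        (D.comp (ContinuousLinearMap.inr ℝ ℝ E)) y₀ :=
      HasFDerivAt.comp (g := fderiv ℝ h) (f := fun y : E => ((1 : ℝ), y)) y₀ hh2
        (hasFDerivAt_prodMk_right (1 : ℝ) y₀)
    have h3 := h2.clm_apply (hasFDerivAt_const ((1 : ℝ), (0 : E)) y₀)
    refine h3.congr_fderiv ?_
    ext v
    simp
  set e₀ : E := fderiv ℝ h (1, y₀) (1, 0) with he₀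
  have hl := hβ.hasFDerivAt.clm_apply hE
  -- This is the equation L_E β = β at y₀, obtained by differentiating the homogeneity relation in t
  -- at t = 1. The mixed derivatives of h are the derivatives of the generator.
  have key : ∀ b c : E, fderiv ℝ β y₀ e₀ b c + β y₀ (D (1, 0) (0, b)) c
      + β y₀ b (D (1, 0) (0, c)) = β y₀ b c := by
    intro b c
    have hc1 : HasDerivAt (fun t : ℝ => ((t, y₀) : ℝ × E)) (1, 0) 1 :=
      (hasDerivAt_id (1 : ℝ)).prodMk (hasDerivAt_const 1 y₀)
    have hc2 : HasDerivAt (fun t : ℝ => h (t, y₀)) e₀ 1 :=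
      HasFDerivAt.comp_hasDerivAt (l := h) (f := fun t : ℝ => ((t, y₀) : ℝ × E)) 1 hh1 hc1
    have hβ' : HasFDerivAt β (fderiv ℝ β y₀) (h (1, y₀)) := by
      rw [h0]; exact hβ.hasFDerivAt
    have hc3 : HasDerivAt (fun t : ℝ => β (h (t, y₀))) (fderiv ℝ β y₀ e₀) 1 :=
      HasFDerivAt.comp_hasDerivAt (l := β) (f := fun t : ℝ => h (t, y₀)) 1 hβ' hc2
    have hc4 : ∀ b : E, HasDerivAt (fun t : ℝ => fderiv ℝ h (t, y₀) ((0 : ℝ), b))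
        (D (1, 0) (0, b)) 1 := by
      intro b
      have h5 : HasDerivAt (fun t : ℝ => fderiv ℝ h (t, y₀)) (D (1, 0)) 1 :=
        HasFDerivAt.comp_hasDerivAt (l := fderiv ℝ h) (f := fun t : ℝ => ((t, y₀) : ℝ × E)) 1 hh2 hc1
      have h6 := h5.clm_apply (hasDerivAt_const 1 ((0 : ℝ), b))
      simpa using h6
    have hc5 := (hc3.clm_apply (hc4 b)).clm_apply (hc4 c)
    have hc6 : HasDerivAt (fun t : ℝ => t * β y₀ b c) (1 * β y₀ b c) 1 :=
      (hasDerivAt_id (1 : ℝ)).mul_const _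
    have hc7 := hc5.unique (hc6.congr_of_eventuallyEq (hhom b c))
    rw [h0, hid, hid, one_mul] at hc7
    rw [← hc7]
    simp
  -- Closedness with the generator as first argument makes ι_E dβ vanish, so d(ι_E β) = L_E β, and
  -- this is β by `key`.
  have h2 := hclosed e₀ b c
  have h3 := key b c
  rw [altD_apply, hl.fderiv]
  simp only [altD₂, add_apply, ContinuousLinearMap.comp_apply,
    ContinuousLinearMap.flip_apply, ContinuousLinearMap.inr_apply] at h2 ⊢
  rw [hsymm (0, b), hsymm (0, c)]
  have h4 := hskew b (D (1, 0) (0, c))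
  linarith

end HomogeneousForm

/-! ### The Liouville form λ = Ω(E, ·) and the identity Ω = dλ -/

section Liouville

open Set Filter Topology

variable (S : HomogeneousSymplecticManifold.{u})

/-- The contraction of the symplectic form with the Euler field. -/
def liouville (p : S.P) : TangentSpace (𝓡 S.P.dim) p →L[ℝ] ℝ := S.Ω p (euler p)

variable {S}

theorem liouville_euler (p : S.P) : liouville S p (euler p) = 0 :=
  S.isSymplectic.alternating p _

theorem liouville_smul (t : ℝˣ) (p : S.P) (v : TangentSpace (𝓡 S.P.dim) p) :
    liouville S (t • p) (mfderiv (𝓡 S.P.dim) (𝓡 S.P.dim) (fun q : S.P => t • q) p v) =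
      t * liouville S p v := by
  rw [liouville, liouville, ← S.homogeneous t p, mfderiv_smul_const_euler]

theorem liouville_ne_zero (p : S.P) : liouville S p ≠ 0 := fun h =>
  euler_ne_zero p (S.isSymplectic.nondegenerate p _ fun w => congrArg (fun L => L w) h)

theorem liouville_map {S' : HomogeneousSymplecticManifold.{u}}
    (f : EquivariantSymplectomorphism S S') (p : S.P) (v : TangentSpace (𝓡 S.P.dim) p) :
    liouville S' (f.toDiffeo p) (mfderiv (𝓡 S.P.dim) (𝓡 S'.P.dim) f.toDiffeo p v) =
      liouville S p v := by
  rw [liouville, liouville, ← f.map_Ω p, mfderiv_euler_of_equivariant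
    (f.toDiffeo.mdifferentiable (by simp) p) fun t => f.map_smul t p]

theorem symplectic_skew (p : S.P) (v w : TangentSpace (𝓡 S.P.dim) p) :
    S.Ω p v w = - S.Ω p w v := by
  have h := S.isSymplectic.alternating p (v + w)
  have h1 : S.Ω p (v + w) (v + w) = S.Ω p v (v + w) + S.Ω p w (v + w) :=
    congrArg (fun L => L (v + w)) (map_add (S.Ω p) v w)
  rw [h1, map_add, map_add, S.isSymplectic.alternating, S.isSymplectic.alternating] at h
  linarith

theorem smoothForm₂At_symplectic (p : S.P) : SmoothForm₂At S.Ω p := S.isSymplectic.smooth p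

/-- Closedness is assumed for global fields only. Every tangent vector extends to one, and Cartan's
formula sees just the values at p, so closedness holds on vectors. -/
theorem altD₂_symplectic (p : S.P) (a b c : EuclideanSpace ℝ (Fin S.P.dim)) :
    altD₂ (chartForm₂ p S.Ω) (extChartAt (𝓡 S.P.dim) p p) a b c = 0 := by
  obtain ⟨X, hX, rfl⟩ := exists_isSmoothField (x₀ := p) a
  obtain ⟨Y, hY, rfl⟩ := exists_isSmoothField (x₀ := p) b
  obtain ⟨Z, hZ, rfl⟩ := exists_isSmoothField (x₀ := p) c
  exact (dTwoForm_eq_altD₂ (smoothForm₂At_symplectic p) (symplectic_skew p) (hX p) (hY p)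
    (hZ p)).symm.trans (S.isSymplectic.closed X Y Z hX hY hZ p)

/-- The action of `ℝ*` near `p`, in the chart at `p`. -/
def chartAction (p : S.P) (z : ℝ × EuclideanSpace ℝ (Fin S.P.dim)) :
    EuclideanSpace ℝ (Fin S.P.dim) :=
  extChartAt (𝓡 S.P.dim) p (unitOf z.1 • (extChartAt (𝓡 S.P.dim) p).symm z.2)

theorem contDiffAt_chartAction (p : S.P) :
    ContDiffAt ℝ ∞ (chartAction p) (1, extChartAt (𝓡 S.P.dim) p p) := by
  have h1 : ContMDiffAt 𝓘(ℝ, EuclideanSpace ℝ (Fin S.P.dim)) (𝓡 S.P.dim) ∞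
      (extChartAt (𝓡 S.P.dim) p).symm (extChartAt (𝓡 S.P.dim) p p) :=
    (contMDiffOn_extChartAt_symm p).contMDiffAt (extChartAt_target_mem_nhds p)
  have h2 : ContMDiffAt (𝓘(ℝ, ℝ).prod 𝓘(ℝ, EuclideanSpace ℝ (Fin S.P.dim))) (𝓡 S.P.dim) ∞
      (fun z : ℝ × EuclideanSpace ℝ (Fin S.P.dim) =>
        unitOf z.1 • (extChartAt (𝓡 S.P.dim) p).symm z.2) (1, extChartAt (𝓡 S.P.dim) p p) :=
    contMDiffAt_smul (contMDiffAt_unitOf contMDiffAt_fst one_ne_zero)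
      (ContMDiffAt.comp (1, extChartAt (𝓡 S.P.dim) p p) h1 contMDiffAt_snd)
  have h3 : ContMDiffAt (𝓘(ℝ, ℝ).prod 𝓘(ℝ, EuclideanSpace ℝ (Fin S.P.dim))) (𝓡 S.P.dim) ∞
      (chartAction p) (1, extChartAt (𝓡 S.P.dim) p p) :=
    ContMDiffAt.comp_of_eq (contMDiffAt_extChartAt (x := p)) h2
      (by rw [extChartAt_to_inv, unitOf_one, one_smul])
  rw [← contMDiffAt_iff_contDiffAt, modelWithCornersSelf_prod, ← chartedSpaceSelf_prod]
  exact h3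

theorem eventually_differentiableAt_chartAction (p : S.P) :
    ∀ᶠ z in 𝓝 ((1 : ℝ), extChartAt (𝓡 S.P.dim) p p), DifferentiableAt ℝ (chartAction p) z := by
  have h2 := (contDiffAt_chartAction p).of_le (m := 1) (by simp)
  filter_upwards [h2.eventually (by simp)] with z hz using hz.differentiableAt (by simp)

/-- The inverse chart carries the t-derivative of the action in coordinates to E. This puts λ into
the form required by `altD_contraction_of_homogeneous`, and it also shows that λ is smooth. -/
theorem eventually_chartForm_liouville (p : S.P) :
    chartForm p (liouville S) =ᶠ[𝓝 (extChartAt (𝓡 S.P.dim) p p)]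
      fun y => chartForm₂ p S.Ω y (fderiv ℝ (chartAction p) (1, y) (1, 0)) := by
  have hd : ∀ᶠ y in 𝓝 (extChartAt (𝓡 S.P.dim) p p),
      DifferentiableAt ℝ (chartAction p) (1, y) := by
    have h3 : ContinuousAt (fun y : EuclideanSpace ℝ (Fin S.P.dim) => ((1 : ℝ), y))
      (extChartAt (𝓡 S.P.dim) p p) := by fun_prop
    exact h3.eventually (eventually_differentiableAt_chartAction p)
  filter_upwards [hd, extChartAt_target_mem_nhds (I := 𝓡 S.P.dim) p] with y hy hyt
  have hE : mfderiv (𝓡 S.P.dim) (𝓡 S.P.dim) (extChartAt (𝓡 S.P.dim) p).symm y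
      (fderiv ℝ (chartAction p) (1, y) (1, 0)) =
      euler ((extChartAt (𝓡 S.P.dim) p).symm y) := by
    set q := (extChartAt (𝓡 S.P.dim) p).symm y with hq
    have hq1 : unitOf 1 • q ∈ (extChartAt (𝓡 S.P.dim) p).source := by
      rw [unitOf_one, one_smul]; exact (extChartAt (𝓡 S.P.dim) p).map_target hyt
    have hy1 : chartAction p (1, y) = y := by
      rw [chartAction, unitOf_one, one_smul]
      exact (extChartAt (𝓡 S.P.dim) p).right_inv hyt
    have h1 : (fun t : ℝ => unitOf t • q) =ᶠ[𝓝 1]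
        (extChartAt (𝓡 S.P.dim) p).symm ∘ fun t : ℝ => chartAction p (t, y) := by
      filter_upwards [(contMDiffAt_orbit q).continuousAt.preimage_mem_nhds
        ((isOpen_extChartAt_source p).mem_nhds hq1)] with t ht
      exact ((extChartAt (𝓡 S.P.dim) p).left_inv ht).symm
    have h2 : HasFDerivAt (fun t : ℝ => chartAction p (t, y))
        ((fderiv ℝ (chartAction p) (1, y)).comp
          (ContinuousLinearMap.inl ℝ ℝ (EuclideanSpace ℝ (Fin S.P.dim)))) 1 :=
      HasFDerivAt.comp (g := chartAction p)
        (f := fun t : ℝ => ((t, y) : ℝ × EuclideanSpace ℝ (Fin S.P.dim))) 1 hy.hasFDerivAt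
        (hasFDerivAt_prodMk_left (1 : ℝ) y)
    have h3 : MDifferentiableAt (𝓡 S.P.dim) (𝓡 S.P.dim) (extChartAt (𝓡 S.P.dim) p).symm
        (chartAction p (1, y)) := by
      rw [hy1]; exact mdifferentiableAt_symm_chart hyt
    have h4 := mfderiv_comp (1 : ℝ) h3 h2.differentiableAt.mdifferentiableAt
    rw [mfderiv_eq_fderiv, h2.fderiv] at h4
    have h5 := congrArg (fun L : ℝ →L[ℝ] EuclideanSpace ℝ (Fin S.P.dim) => L 1)
      (h1.mfderiv_eq.trans h4)
    refine Eq.trans ?_ h5.symm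
    exact (congrArg (fun z : EuclideanSpace ℝ (Fin S.P.dim) =>
      (show EuclideanSpace ℝ (Fin S.P.dim) from mfderiv (𝓡 S.P.dim) (𝓡 S.P.dim)
        (extChartAt (𝓡 S.P.dim) p).symm z (fderiv ℝ (chartAction p) (1, y) (1, 0)))) hy1).symm
  ext v
  exact (congrArg (fun a => S.Ω _ a
    (mfderiv (𝓡 S.P.dim) (𝓡 S.P.dim) (extChartAt (𝓡 S.P.dim) p).symm y v)) hE).symm

theorem smoothFormAt_liouville (p : S.P) : SmoothFormAt (liouville S) p := by
  rw [smoothFormAt_iff]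
  refine ContDiffAt.congr_of_eventuallyEq ?_ (eventually_chartForm_liouville p)
  have h1 := smoothForm₂At_iff.1 (smoothForm₂At_symplectic p)
  have h2 : ContDiffAt ℝ ∞ (fderiv ℝ (chartAction p)) (1, extChartAt (𝓡 S.P.dim) p p) :=
    (contDiffAt_chartAction p).fderiv_right (by simp)
  have h3 : ContDiffAt ℝ ∞ (fun y => fderiv ℝ (chartAction p) (1, y))
      (extChartAt (𝓡 S.P.dim) p p) :=
    ContDiffAt.comp (g := fderiv ℝ (chartAction p))
      (f := fun y : EuclideanSpace ℝ (Fin S.P.dim) => ((1 : ℝ), y)) _ h2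
      (contDiffAt_const.prodMk contDiffAt_id)
  exact h1.clm_apply (h3.clm_apply contDiffAt_const)

/-- The Lie derivative of Ω along E is Ω, and dΩ = 0. The work consists in expressing homogeneity
and closedness at p in the chart at p, where the local formula applies. -/
theorem extD_liouville (p : S.P) : extD (liouville S) p = S.Ω p := by
  have h1 : ∀ b c, altD (chartForm p (liouville S)) (extChartAt (𝓡 S.P.dim) p p) b c =
      chartForm₂ p S.Ω (extChartAt (𝓡 S.P.dim) p p) b c := by
    intro b c
    rw [altD_congr (eventually_chartForm_liouville p)]
    refine altD_contraction_of_homogeneous (contDiffAt_chartAction p) ?_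
      ((smoothForm₂At_iff.1 (smoothForm₂At_symplectic p)).differentiableAt (by simp)) ?_ ?_
      (altD₂_symplectic p) b c
    · filter_upwards [extChartAt_target_mem_nhds (I := 𝓡 S.P.dim) p] with y hy
      rw [chartAction, unitOf_one, one_smul]
      exact (extChartAt (𝓡 S.P.dim) p).right_inv hy
    · intro b c
      have hc : ContinuousAt (fun t : ℝ => ((t, extChartAt (𝓡 S.P.dim) p p) :
          ℝ × EuclideanSpace ℝ (Fin S.P.dim))) 1 := by fun_prop
      have hp1 : unitOf 1 • p ∈ (extChartAt (𝓡 S.P.dim) p).source := by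
        rw [unitOf_one, one_smul]; exact mem_extChartAt_source p
      filter_upwards [hc.eventually (eventually_differentiableAt_chartAction p),
        (contMDiffAt_orbit p).continuousAt.preimage_mem_nhds
          ((isOpen_extChartAt_source p).mem_nhds hp1), eventually_ne_nhds one_ne_zero]
        with t h2 h3 ht
      -- In the chart, multiplication by t is the slice of `chartAction` at t, so its derivative is
      -- that of `chartAction` restricted to the second factor.
      have h4 : fderiv ℝ (chartMap p p (fun q : S.P => unitOf t • q))
          (extChartAt (𝓡 S.P.dim) p p) = (fderiv ℝ (chartAction p)
            (t, extChartAt (𝓡 S.P.dim) p p)).comp (ContinuousLinearMap.inr ℝ ℝ _) :=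
        HasFDerivAt.fderiv (HasFDerivAt.comp (g := chartAction p)
          (f := fun y : EuclideanSpace ℝ (Fin S.P.dim) => (t, y)) (extChartAt (𝓡 S.P.dim) p p)
          h2.hasFDerivAt (hasFDerivAt_prodMk_right t _))
      have h5 := chartForm₂_pullForm₂ (y₀ := p) (x₀ := p) (f := fun q : S.P => unitOf t • q)
        (mem_extChartAt_target p) (by rw [extChartAt_to_inv]; exact h3)
        ((contMDiff_smul_const (unitOf t)).mdifferentiableAt (by simp)) S.Ω
      rw [h4] at h5
      have h6 := chartForm₂_self p (pullForm₂ (fun q : S.P => unitOf t • q) S.Ω :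
        ∀ q : S.P, TangentSpace (𝓡 S.P.dim) q →L[ℝ] TangentSpace (𝓡 S.P.dim) q →L[ℝ] ℝ)
      have h7 := congrArg (fun L : EuclideanSpace ℝ (Fin S.P.dim) →L[ℝ]
        EuclideanSpace ℝ (Fin S.P.dim) →L[ℝ] ℝ => L b c) (h5.symm.trans h6)
      refine h7.trans ((S.homogeneous (unitOf t) p b c).trans ?_)
      rw [coe_unitOf ht]
      exact congrArg (fun L : EuclideanSpace ℝ (Fin S.P.dim) →L[ℝ]
        EuclideanSpace ℝ (Fin S.P.dim) →L[ℝ] ℝ => t * L b c) (chartForm₂_self p S.Ω).symm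
    · rw [chartForm₂_self]
      exact symplectic_skew p
  ext b c
  exact (h1 b c).trans (congrArg (fun L : EuclideanSpace ℝ (Fin S.P.dim) →L[ℝ]
    EuclideanSpace ℝ (Fin S.P.dim) →L[ℝ] ℝ => L b c) (chartForm₂_self p S.Ω))

end Liouville

/-! ### The contact structure on the base of a homogeneous symplectic manifold -/

section CanonicalContact

open Set Filter Topology

variable {S : HomogeneousSymplecticManifold.{u}}

/-- The pull-back of the Liouville form along a local section. -/
def LocalSection.form (s : LocalSection S.toHomogeneousManifold) :
    ∀ x : S.M, TangentSpace (𝓡 S.M.dim) x →L[ℝ] ℝ :=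
  pullForm s.σ (liouville S)

theorem LocalSection.smoothFormAt_form (s : LocalSection S.toHomogeneousManifold) {x : S.M}
    (hx : x ∈ s.U) : SmoothFormAt s.form x :=
  (smoothFormAt_liouville (s.σ x)).pullForm (s.smooth_σ x hx)

theorem proj_surjective (Q : HomogeneousManifold.{u}) : Function.Surjective Q.proj := fun x => by
  obtain ⟨s, hs⟩ := exists_localSection (Q := Q) x
  exact ⟨s.σ x, s.proj_σ x hs⟩

theorem mfderiv_proj_surjective {Q : HomogeneousManifold.{u}} (p : Q.P)
    (u : EuclideanSpace ℝ (Fin Q.M.dim)) : ∃ v : TangentSpace (𝓡 Q.P.dim) p,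
      (show EuclideanSpace ℝ (Fin Q.M.dim) from
        mfderiv (𝓡 Q.P.dim) (𝓡 Q.M.dim) Q.proj p v) = u := by
  obtain ⟨s, hs⟩ := exists_localSection (Q := Q) (Q.proj p)
  -- the section `x ↦ c p • σ x` passes through `p`
  let k : Q.M → Q.P := fun x => s.c p • s.σ x
  have hk : ContMDiffAt (𝓡 Q.M.dim) (𝓡 Q.P.dim) ∞ k (Q.proj p) :=
    (contMDiff_smul_const (s.c p)).contMDiffAt.comp (Q.proj p) (s.smooth_σ _ hs)
  have hkp : k (Q.proj p) = p := s.c_smul_σ p hs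
  have h1 : Q.proj ∘ k =ᶠ[𝓝 (Q.proj p)] id := by
    filter_upwards [s.isOpen.mem_nhds hs] with y hy
    exact (Q.proj_smul _ _).trans (s.proj_σ y hy)
  have h2 := mfderiv_comp (Q.proj p) (Q.smooth_proj.mdifferentiableAt (by simp))
    (hk.mdifferentiableAt (by simp))
  have h3 : (show EuclideanSpace ℝ (Fin Q.M.dim) →L[ℝ] EuclideanSpace ℝ (Fin Q.M.dim) from
    mfderiv (𝓡 Q.M.dim) (𝓡 Q.M.dim) (Q.proj ∘ k) (Q.proj p)) = ContinuousLinearMap.id ℝ _ :=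
    (h1.mfderiv_eq).trans mfderiv_id
  have h4 : (show EuclideanSpace ℝ (Fin Q.P.dim) →L[ℝ] EuclideanSpace ℝ (Fin Q.M.dim) from
      mfderiv (𝓡 Q.P.dim) (𝓡 Q.M.dim) Q.proj (k (Q.proj p))) =
      mfderiv (𝓡 Q.P.dim) (𝓡 Q.M.dim) Q.proj p :=
    congrArg (fun q => (show EuclideanSpace ℝ (Fin Q.P.dim) →L[ℝ] EuclideanSpace ℝ (Fin Q.M.dim)
      from mfderiv (𝓡 Q.P.dim) (𝓡 Q.M.dim) Q.proj q)) hkp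
  refine ⟨(show EuclideanSpace ℝ (Fin Q.P.dim) from
    mfderiv (𝓡 Q.M.dim) (𝓡 Q.P.dim) k (Q.proj p) u), ?_⟩
  have h5 := congrArg (fun L : EuclideanSpace ℝ (Fin Q.M.dim) →L[ℝ] EuclideanSpace ℝ (Fin Q.M.dim)
    => L u) (h2.symm.trans h3)
  refine Eq.trans ?_ h5
  exact congrArg (fun L : EuclideanSpace ℝ (Fin Q.P.dim) →L[ℝ] EuclideanSpace ℝ (Fin Q.M.dim) =>
    L (show EuclideanSpace ℝ (Fin Q.P.dim) from
      mfderiv (𝓡 Q.M.dim) (𝓡 Q.P.dim) k (Q.proj p) u)) h4.symm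

/-- The Liouville form vanishes on vertical vectors. -/
theorem liouville_congr {p : S.P} {v w : TangentSpace (𝓡 S.P.dim) p}
    (h : mfderiv (𝓡 S.P.dim) (𝓡 S.M.dim) S.proj p v =
      mfderiv (𝓡 S.P.dim) (𝓡 S.M.dim) S.proj p w) : liouville S p v = liouville S p w := by
  obtain ⟨a, ha⟩ := eq_smul_euler_of_mfderiv_proj_eq_zero (Q := S.toHomogeneousManifold)
    (v := v - w) (by rw [map_sub, h, sub_self])
  rw [← sub_eq_zero, ← map_sub, ha, map_smul, liouville_euler, smul_zero]

/-- The map k = c(p) • σ ∘ π, with c frozen at p, fixes p and covers the identity near π(p). Hence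
dk(v) and v differ by a vertical vector, which λ does not see, and λ = k*λ at p. Homogeneity
extracts the factor c(p). -/
theorem LocalSection.liouville_eq (s : LocalSection S.toHomogeneousManifold) {p : S.P}
    (hp : S.proj p ∈ s.U) :
    liouville S p = (s.c p : ℝ) • pullForm (S.proj : S.P → S.M) s.form p := by
  let k : S.P → S.P := fun q => s.c p • s.σ (S.proj q)
  have hkp : k p = p := s.c_smul_σ p hp
  have hσ : MDifferentiableAt (𝓡 S.M.dim) (𝓡 S.P.dim) s.σ (S.proj p) :=
    (s.smooth_σ _ hp).mdifferentiableAt (by simp)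
  have hπ : MDifferentiableAt (𝓡 S.P.dim) (𝓡 S.M.dim) S.proj p :=
    S.smooth_proj.mdifferentiableAt (by simp)
  have hh : ∀ q : S.P, MDifferentiableAt (𝓡 S.P.dim) (𝓡 S.P.dim) (fun q : S.P => s.c p • q) q :=
    fun q => (contMDiff_smul_const (s.c p)).mdifferentiableAt (by simp)
  have hk : MDifferentiableAt (𝓡 S.P.dim) (𝓡 S.P.dim) k p :=
    (hh _).comp p (hσ.comp p hπ)
  have h1 : (pullForm k (liouville S) : ∀ q : S.P, TangentSpace (𝓡 S.P.dim) q →L[ℝ] ℝ) p =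
      pullForm (S.proj : S.P → S.M) (pullForm s.σ
        (pullForm (fun q : S.P => s.c p • q) (liouville S) :
          ∀ q : S.P, TangentSpace (𝓡 S.P.dim) q →L[ℝ] ℝ) :
          ∀ x : S.M, TangentSpace (𝓡 S.M.dim) x →L[ℝ] ℝ) p := by
    refine (pullForm_comp (hh _) (hσ.comp p hπ) _).trans ?_
    exact pullForm_comp hσ hπ _
  have h2 : (pullForm (fun q : S.P => s.c p • q) (liouville S) :
      ∀ q : S.P, TangentSpace (𝓡 S.P.dim) q →L[ℝ] ℝ) = fun q => (s.c p : ℝ) • liouville S q := by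
    funext q
    ext v
    exact liouville_smul (s.c p) q v
  rw [h2] at h1
  have h3 : liouville S p =
      (pullForm k (liouville S) : ∀ q : S.P, TangentSpace (𝓡 S.P.dim) q →L[ℝ] ℝ) p := by
    ext v
    have h4 : (show EuclideanSpace ℝ (Fin S.P.dim) →L[ℝ] ℝ from liouville S (k p)) =
      liouville S p := congrArg (fun q => (show EuclideanSpace ℝ (Fin S.P.dim) →L[ℝ] ℝ from
        liouville S q)) hkp
    refine Eq.trans ?_ (congrArg (fun L : EuclideanSpace ℝ (Fin S.P.dim) →L[ℝ] ℝ => L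
      (show EuclideanSpace ℝ (Fin S.P.dim) from
        mfderiv (𝓡 S.P.dim) (𝓡 S.P.dim) k p v)) h4.symm)
    refine liouville_congr ?_
    have h5 : S.proj ∘ k =ᶠ[𝓝 p] S.proj := by
      filter_upwards [s.proj_mem_nhds hp] with q hq
      exact (S.proj_smul _ _).trans (s.proj_σ _ hq)
    have h6 := mfderiv_comp p (S.smooth_proj.mdifferentiableAt (x := k p) (by simp)) hk
    have h7 : (show EuclideanSpace ℝ (Fin S.P.dim) →L[ℝ] EuclideanSpace ℝ (Fin S.M.dim) from
        mfderiv (𝓡 S.P.dim) (𝓡 S.M.dim) S.proj (k p)) =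
        mfderiv (𝓡 S.P.dim) (𝓡 S.M.dim) S.proj p :=
      congrArg (fun q => (show EuclideanSpace ℝ (Fin S.P.dim) →L[ℝ] EuclideanSpace ℝ (Fin S.M.dim)
        from mfderiv (𝓡 S.P.dim) (𝓡 S.M.dim) S.proj q)) hkp
    have h8 := congrArg (fun L : EuclideanSpace ℝ (Fin S.P.dim) →L[ℝ]
      EuclideanSpace ℝ (Fin S.M.dim) => L v) (h5.mfderiv_eq.symm.trans h6)
    refine h8.trans ?_
    exact congrArg (fun L : EuclideanSpace ℝ (Fin S.P.dim) →L[ℝ] EuclideanSpace ℝ (Fin S.M.dim) =>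
      L (show EuclideanSpace ℝ (Fin S.P.dim) from mfderiv (𝓡 S.P.dim) (𝓡 S.P.dim) k p v)) h7
  rw [h3, h1]
  rfl

theorem exists_covector (p : S.P) : ∃ α : TangentSpace (𝓡 S.M.dim) (S.proj p) →L[ℝ] ℝ,
    liouville S p = α.comp (mfderiv (𝓡 S.P.dim) (𝓡 S.M.dim) S.proj p) := by
  obtain ⟨s, hs⟩ := exists_localSection (Q := S.toHomogeneousManifold) (S.proj p)
  exact ⟨(s.c p : ℝ) • s.form (S.proj p), (s.liouville_eq hs).trans rfl⟩

/-- The covector on the base defined by a point of a homogeneous symplectic manifold. -/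
def covector (p : S.P) : TangentSpace (𝓡 S.M.dim) (S.proj p) →L[ℝ] ℝ :=
  Classical.choose (exists_covector p)

theorem covector_spec (p : S.P) :
    liouville S p = (covector p).comp (mfderiv (𝓡 S.P.dim) (𝓡 S.M.dim) S.proj p) :=
  Classical.choose_spec (exists_covector p)

theorem covector_unique {p : S.P} {α : TangentSpace (𝓡 S.M.dim) (S.proj p) →L[ℝ] ℝ}
    (h : liouville S p = α.comp (mfderiv (𝓡 S.P.dim) (𝓡 S.M.dim) S.proj p)) :
    covector p = α := by
  ext u
  obtain ⟨v, rfl⟩ := mfderiv_proj_surjective p u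
  exact congrArg (fun L => L v) ((covector_spec p).symm.trans h)

theorem LocalSection.covector_eq (s : LocalSection S.toHomogeneousManifold) {p : S.P}
    (hp : S.proj p ∈ s.U) : covector p = (s.c p : ℝ) • s.form (S.proj p) :=
  covector_unique ((s.liouville_eq hp).trans rfl)

theorem covector_smul (t : ℝˣ) (p : S.P) :
    (show EuclideanSpace ℝ (Fin S.M.dim) →L[ℝ] ℝ from covector (t • p)) =
      (t : ℝ) • (show EuclideanSpace ℝ (Fin S.M.dim) →L[ℝ] ℝ from covector p) := by
  obtain ⟨s, hs⟩ := exists_localSection (Q := S.toHomogeneousManifold) (S.proj p)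
  have h1 := S.proj_smul t p
  have h2 : S.proj (t • p) ∈ s.U := by rw [h1]; exact hs
  refine (s.covector_eq h2).trans ?_
  refine (congrArg (fun x => (s.c (t • p) : ℝ) •
    (show EuclideanSpace ℝ (Fin S.M.dim) →L[ℝ] ℝ from s.form x)) h1).trans ?_
  rw [s.c_smul p hs, Units.val_mul]
  refine (mul_smul _ _ _).trans ?_
  exact congrArg (fun L : EuclideanSpace ℝ (Fin S.M.dim) →L[ℝ] ℝ => (t : ℝ) • L)
    (s.covector_eq hs).symm

theorem covector_ne_zero (p : S.P) : covector p ≠ 0 := fun h =>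
  liouville_ne_zero p ((covector_spec p).trans (by rw [h]; rfl))

theorem LocalSection.covector_σ (s : LocalSection S.toHomogeneousManifold) {x : S.M}
    (hx : x ∈ s.U) :
    (show EuclideanSpace ℝ (Fin S.M.dim) →L[ℝ] ℝ from covector (s.σ x)) = s.form x := by
  have h1 := s.proj_σ x hx
  refine (s.covector_eq (by rw [h1]; exact hx)).trans ?_
  rw [s.c_σ hx, Units.val_one, one_smul]
  exact congrArg (fun x => (show EuclideanSpace ℝ (Fin S.M.dim) →L[ℝ] ℝ from s.form x)) h1

theorem LocalSection.form_ne_zero (s : LocalSection S.toHomogeneousManifold) {x : S.M}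
    (hx : x ∈ s.U) : s.form x ≠ 0 := fun h =>
  covector_ne_zero (s.σ x) ((s.covector_σ hx).trans h)

variable (S)

/-- The canonical contact structure on the base of a homogeneous symplectic manifold. -/
def baseContact (x : S.M) : Submodule ℝ (TangentSpace (𝓡 S.M.dim) x) :=
  LinearMap.ker (show EuclideanSpace ℝ (Fin S.M.dim) →L[ℝ] ℝ from
    covector (Classical.choose (proj_surjective S.toHomogeneousManifold x))).toLinearMap

variable {S}

/-- The chosen point of the fibre does not matter: its covector is a non-zero multiple of `s.form
x`. -/
theorem LocalSection.ker_form (s : LocalSection S.toHomogeneousManifold) {x : S.M}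
    (hx : x ∈ s.U) : LinearMap.ker (s.form x).toLinearMap = baseContact S x := by
  have h1 := Classical.choose_spec (proj_surjective S.toHomogeneousManifold x)
  set p := Classical.choose (proj_surjective S.toHomogeneousManifold x) with hp
  have hpx : S.proj p ∈ s.U := by rw [h1]; exact hx
  have h2 : (show EuclideanSpace ℝ (Fin S.M.dim) →L[ℝ] ℝ from covector p) =
      (s.c p : ℝ) • (show EuclideanSpace ℝ (Fin S.M.dim) →L[ℝ] ℝ from s.form x) :=
    (s.covector_eq hpx).trans (congrArg (fun x => (s.c p : ℝ) •
      (show EuclideanSpace ℝ (Fin S.M.dim) →L[ℝ] ℝ from s.form x)) h1)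
  have h3 : LinearMap.ker (show EuclideanSpace ℝ (Fin S.M.dim) →L[ℝ] ℝ from
      covector p).toLinearMap = LinearMap.ker
      (show EuclideanSpace ℝ (Fin S.M.dim) →L[ℝ] ℝ from s.form x).toLinearMap := by
    rw [h2]
    exact LinearMap.ker_smul _ _ (s.c p).ne_zero
  exact h3.symm

theorem ker_covector (p : S.P) :
    LinearMap.ker (covector p).toLinearMap = baseContact S (S.proj p) := by
  obtain ⟨s, hs⟩ := exists_localSection (Q := S.toHomogeneousManifold) (S.proj p)
  rw [← s.ker_form hs, s.covector_eq hs]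
  exact LinearMap.ker_smul _ _ (s.c p).ne_zero

/-- The symplectic form in terms of a local section. -/
theorem LocalSection.symplectic_apply (s : LocalSection S.toHomogeneousManifold) {p : S.P}
    (hp : S.proj p ∈ s.U) (v w : TangentSpace (𝓡 S.P.dim) p) :
    S.Ω p v w = (show ℝ from mfderiv (𝓡 S.P.dim) 𝓘(ℝ, ℝ) (fun p => (s.c p : ℝ)) p v) *
        s.form (S.proj p) (mfderiv (𝓡 S.P.dim) (𝓡 S.M.dim) S.proj p w)
      - (show ℝ from mfderiv (𝓡 S.P.dim) 𝓘(ℝ, ℝ) (fun p => (s.c p : ℝ)) p w) *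
        s.form (S.proj p) (mfderiv (𝓡 S.P.dim) (𝓡 S.M.dim) S.proj p v)
      + s.c p * extD s.form (S.proj p) (mfderiv (𝓡 S.P.dim) (𝓡 S.M.dim) S.proj p v)
        (mfderiv (𝓡 S.P.dim) (𝓡 S.M.dim) S.proj p w) := by
  -- λ = c π*θ near p, so dλ expands by the Leibniz rule and the naturality of d.
  rw [← extD_liouville, extD_congr (θ' := fun p => (s.c p : ℝ) •
    (pullForm (S.proj : S.P → S.M) s.form : ∀ p : S.P, TangentSpace (𝓡 S.P.dim) p →L[ℝ] ℝ) p)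
    (by filter_upwards [s.proj_mem_nhds hp] with q hq using s.liouville_eq hq)]
  rw [extD_smul ((s.smoothFormAt_form hp).pullForm S.smooth_proj.contMDiffAt) (s.smooth_c p hp),
    extD_pullForm (s.smoothFormAt_form hp) S.smooth_proj.contMDiffAt]
  rfl

/-- If v lies in H and dθ(v, ·) vanishes on H, then dθ(v, ·) is a multiple of θ. By the local
formula for Ω, some lift v' of v then satisfies Ω(v', ·) = κ λ = Ω(κE, ·). Non-degeneracy makes v'
vertical, so v = 0. -/
theorem isContactStructure_baseContact : IsContactStructure (baseContact S) := by
  refine isContactStructure_of_extD (isHyperplaneDistribution_of_localForm fun x₀ => ?_)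
    fun x₀ => ?_
  · obtain ⟨s, hs⟩ := exists_localSection (Q := S.toHomogeneousManifold) x₀
    exact ⟨s.U, s.form, s.isOpen, hs, fun x hx =>
      ⟨s.ker_form hx, s.form_ne_zero hx, s.smoothFormAt_form hx⟩⟩
  · obtain ⟨p, rfl⟩ := proj_surjective S.toHomogeneousManifold x₀
    obtain ⟨s, hs⟩ := exists_localSection (Q := S.toHomogeneousManifold) (S.proj p)
    refine ⟨s.form, ?_, s.smoothFormAt_form hs, fun v hv hv0 => ?_⟩
    · filter_upwards [s.isOpen.mem_nhds hs] with x hx using s.ker_form hx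
    by_contra! hcon
    rw [← s.ker_form hs] at hv hcon
    have hv' : s.form (S.proj p) v = 0 := hv
    obtain ⟨v', rfl⟩ := mfderiv_proj_surjective p v
    let θ : EuclideanSpace ℝ (Fin S.M.dim) →L[ℝ] ℝ := s.form (S.proj p)
    let β : EuclideanSpace ℝ (Fin S.M.dim) →L[ℝ] ℝ := extD s.form (S.proj p)
      (mfderiv (𝓡 S.P.dim) (𝓡 S.M.dim) S.proj p v')
    obtain ⟨y, hy⟩ : ∃ y, θ y ≠ 0 := by
      by_contra! h
      exact s.form_ne_zero hs (by ext w; exact h w)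
    -- Every w differs from a multiple of y by an element of ker θ, on which β vanishes.
    have hβ : ∀ w, β w = β y / θ y * θ w := by
      intro w
      have h1 : β (w - (θ w / θ y) • y) = 0 := by
        refine hcon _ ?_
        change θ (w - (θ w / θ y) • y) = 0
        rw [map_sub, map_smul, smul_eq_mul, div_mul_cancel₀ _ hy, sub_self]
      rw [map_sub, map_smul, smul_eq_mul, sub_eq_zero] at h1
      rw [h1]
      ring
    let D : ℝ := mfderiv (𝓡 S.P.dim) 𝓘(ℝ, ℝ) (fun p => (s.c p : ℝ)) p v'
    -- With θ(v) = 0 the local formula reads Ω(v', w) = (D + c β(y)/θ(y)) θ(dπ w), while λ(w) = c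
    -- θ(dπ w); κ is the quotient.
    let κ : ℝ := (D + s.c p * (β y / θ y)) / s.c p
    have key : v' - κ • euler p = 0 := by
      refine S.isSymplectic.nondegenerate p _ fun w => ?_
      have h1 : S.Ω p (v' - κ • euler p) w = S.Ω p v' w - κ * liouville S p w := by
        have h2 : S.Ω p (v' - κ • euler p) = S.Ω p v' - κ • S.Ω p (euler p) := by
          rw [map_sub, map_smul]
        exact congrArg (fun L => L w) h2
      let w' : EuclideanSpace ℝ (Fin S.M.dim) := mfderiv (𝓡 S.P.dim) (𝓡 S.M.dim) S.proj p w
      have h2 : liouville S p w = s.c p * θ w' :=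
        congrArg (fun L => L w) (s.liouville_eq hs)
      let D' : ℝ := mfderiv (𝓡 S.P.dim) 𝓘(ℝ, ℝ) (fun p => (s.c p : ℝ)) p w
      have h3 : S.Ω p v' w = D * θ w' - D' * 0 + s.c p * β w' := by
        rw [← hv']
        exact s.symplectic_apply hs v' w
      rw [h1, h2, h3, hβ]
      have hc := (s.c p).ne_zero
      simp only [κ]
      field_simp
      ring
    apply hv0
    rw [sub_eq_zero] at key
    rw [key, map_smul, mfderiv_proj_euler, smul_zero]

variable (S) in
/-- The contact manifold defined by a homogeneous symplectic manifold. -/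
def baseContactManifold : ContactManifold.{u} where
  M := S.M
  H := baseContact S
  isContact := isContactStructure_baseContact

end CanonicalContact

/-! ### Equivariant maps and the maps they cover -/

section Descent

open Set Filter Topology

variable {Q Q' : HomogeneousManifold.{u}}

/-- An equivariant map descends to the bases. -/
theorem exists_descent {f : Q.P → Q'.P} (hf : ContMDiff (𝓡 Q.P.dim) (𝓡 Q'.P.dim) ∞ f)
    (h : ∀ (t : ℝˣ) (p : Q.P), f (t • p) = t • f p) :
    ∃ φ : Q.M → Q'.M, ContMDiff (𝓡 Q.M.dim) (𝓡 Q'.M.dim) ∞ φ ∧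
      ∀ p, Q'.proj (f p) = φ (Q.proj p) := by
  choose τ hτ using proj_surjective Q
  have key : ∀ p q : Q.P, Q.proj p = Q.proj q → Q'.proj (f p) = Q'.proj (f q) := by
    intro p q hpq
    obtain ⟨t, rfl⟩ := exists_smul_of_proj_eq hpq
    rw [h, Q'.proj_smul]
  -- τ is an arbitrary set-theoretic section. The value does not depend on it, so near each point a
  -- smooth local section may replace it.
  refine ⟨fun x => Q'.proj (f (τ x)), fun x₀ => ?_, fun p => key _ _ (hτ _).symm⟩
  obtain ⟨s, hs⟩ := exists_localSection (Q := Q) x₀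
  have h1 : ContMDiffAt (𝓡 Q.M.dim) (𝓡 Q'.M.dim) ∞ (fun x => Q'.proj (f (s.σ x))) x₀ :=
    Q'.smooth_proj.contMDiffAt.comp x₀ (hf.contMDiffAt.comp x₀ (s.smooth_σ x₀ hs))
  refine h1.congr_of_eventuallyEq ?_
  filter_upwards [s.isOpen.mem_nhds hs] with x hx
  exact key _ _ ((hτ x).trans (s.proj_σ x hx).symm)

/-- The chain rule for a map that covers a map of the bases. -/
theorem mfderiv_proj_of_covers {f : Q.P → Q'.P} {φ : Q.M → Q'.M}
    (hf : ContMDiff (𝓡 Q.P.dim) (𝓡 Q'.P.dim) ∞ f) (hφ : ContMDiff (𝓡 Q.M.dim) (𝓡 Q'.M.dim) ∞ φ)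
    (h : ∀ p, Q'.proj (f p) = φ (Q.proj p)) (p : Q.P) (v : TangentSpace (𝓡 Q.P.dim) p) :
    (show EuclideanSpace ℝ (Fin Q'.M.dim) from mfderiv (𝓡 Q'.P.dim) (𝓡 Q'.M.dim) Q'.proj (f p)
      (mfderiv (𝓡 Q.P.dim) (𝓡 Q'.P.dim) f p v)) =
    mfderiv (𝓡 Q.M.dim) (𝓡 Q'.M.dim) φ (Q.proj p)
      (mfderiv (𝓡 Q.P.dim) (𝓡 Q.M.dim) Q.proj p v) := by
  have h1 := mfderiv_comp p (Q'.smooth_proj.mdifferentiableAt (x := f p) (by simp))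
    (hf.mdifferentiableAt (by simp))
  have h2 := mfderiv_comp p (hφ.mdifferentiableAt (x := Q.proj p) (by simp))
    (Q.smooth_proj.mdifferentiableAt (by simp))
  have h3 : Q'.proj ∘ f = φ ∘ Q.proj := funext h
  have h4 : (show EuclideanSpace ℝ (Fin Q.P.dim) →L[ℝ] EuclideanSpace ℝ (Fin Q'.M.dim) from
      mfderiv (𝓡 Q.P.dim) (𝓡 Q'.M.dim) (Q'.proj ∘ f) p) =
      mfderiv (𝓡 Q.P.dim) (𝓡 Q'.M.dim) (φ ∘ Q.proj) p :=
    congrArg (fun g : Q.P → Q'.M => (show EuclideanSpace ℝ (Fin Q.P.dim) →L[ℝ]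
      EuclideanSpace ℝ (Fin Q'.M.dim) from mfderiv (𝓡 Q.P.dim) (𝓡 Q'.M.dim) g p)) h3
  exact congrArg (fun L : EuclideanSpace ℝ (Fin Q.P.dim) →L[ℝ] EuclideanSpace ℝ (Fin Q'.M.dim) =>
    L v) (h1.symm.trans (h4.trans h2))

end Descent

/-! ### Maps that identify two distributions -/

section PreservesDistribution

variable {A B : Mfd.{u}}

/-- A map whose differential identifies the distributions `H` and `H'`. -/
def PreservesDistribution (H : ∀ x : A, Submodule ℝ (TangentSpace (𝓡 A.dim) x))
    (H' : ∀ x : B, Submodule ℝ (TangentSpace (𝓡 B.dim) x)) (φ : A → B) : Prop :=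
  ∀ (x : A) (v : TangentSpace (𝓡 A.dim) x),
    mfderiv (𝓡 A.dim) (𝓡 B.dim) φ x v ∈ H' (φ x) ↔ v ∈ H x

theorem mfderiv_bijective (Φ : Diffeomorph (𝓡 A.dim) (𝓡 B.dim) A B ∞) (x : A) :
    Function.Bijective (mfderiv (𝓡 A.dim) (𝓡 B.dim) Φ x) :=
  (Φ.mfderivToContinuousLinearEquiv (by simp) x).bijective

/-- The differential of a diffeomorphism is bijective, so the elementwise condition used for lifts
is the same as equality of images. -/
theorem preservesDistribution_iff {H : ∀ x : A, Submodule ℝ (TangentSpace (𝓡 A.dim) x)}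
    {H' : ∀ x : B, Submodule ℝ (TangentSpace (𝓡 B.dim) x)}
    {Φ : Diffeomorph (𝓡 A.dim) (𝓡 B.dim) A B ∞} :
    PreservesDistribution H H' Φ ↔
      ∀ x, (H x).map (mfderiv (𝓡 A.dim) (𝓡 B.dim) Φ x).toLinearMap = H' (Φ x) := by
  constructor
  · intro h x
    apply le_antisymm
    · rintro _ ⟨v, hv, rfl⟩
      exact (h x v).2 hv
    · intro w hw
      obtain ⟨v, rfl⟩ := (mfderiv_bijective Φ x).2 w
      exact ⟨v, (h x v).1 hw, rfl⟩
  · intro h x v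
    rw [← h x]
    constructor
    · rintro ⟨v', hv', he⟩
      exact (mfderiv_bijective Φ x).1 he ▸ hv'
    · exact fun hv => ⟨v, hv, rfl⟩

theorem PreservesDistribution.symm {H : ∀ x : A, Submodule ℝ (TangentSpace (𝓡 A.dim) x)}
    {H' : ∀ x : B, Submodule ℝ (TangentSpace (𝓡 B.dim) x)}
    {Φ : Diffeomorph (𝓡 A.dim) (𝓡 B.dim) A B ∞} (h : PreservesDistribution H H' Φ) :
    PreservesDistribution H' H Φ.symm := by
  intro y w
  have h1 := mfderiv_comp y (Φ.mdifferentiable (by simp) (Φ.symm y))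
    (Φ.symm.mdifferentiable (by simp) y)
  have h2 : (Φ ∘ Φ.symm : B → B) = id := funext Φ.apply_symm_apply
  have h3 : (show EuclideanSpace ℝ (Fin B.dim) →L[ℝ] EuclideanSpace ℝ (Fin B.dim) from
      mfderiv (𝓡 B.dim) (𝓡 B.dim) (Φ ∘ Φ.symm) y) = ContinuousLinearMap.id ℝ _ :=
    (congrArg (fun g : B → B => (show EuclideanSpace ℝ (Fin B.dim) →L[ℝ]
      EuclideanSpace ℝ (Fin B.dim) from mfderiv (𝓡 B.dim) (𝓡 B.dim) g y)) h2).trans mfderiv_id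
  have h4 := congrArg (fun L : EuclideanSpace ℝ (Fin B.dim) →L[ℝ] EuclideanSpace ℝ (Fin B.dim) =>
    L w) (h1.symm.trans h3)
  rw [← h (Φ.symm y)]
  have h5 : ∀ (z : B) (w' : EuclideanSpace ℝ (Fin B.dim)), z = y → w' = w →
      ((show Submodule ℝ (EuclideanSpace ℝ (Fin B.dim)) from H' z).carrier w' ↔
        (show Submodule ℝ (EuclideanSpace ℝ (Fin B.dim)) from H' y).carrier w) := by
    rintro z w' rfl rfl; rfl
  exact h5 _ _ (Φ.apply_symm_apply y) h4

end PreservesDistribution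

/-! ### Cotangent lifts between homogeneous symplectic manifolds -/

section Lift

open Set Filter Topology

variable {S S' : HomogeneousSymplecticManifold.{u}}

theorem eq_one_of_eq_smul {V : Type*} [NormedAddCommGroup V] [NormedSpace ℝ V] {α : V →L[ℝ] ℝ}
    {r : ℝ} (h : α = r • α) (hα : α ≠ 0) : r = 1 := by
  obtain ⟨y, hy⟩ : ∃ y, α y ≠ 0 := by
    by_contra! h'
    exact hα (by ext w; exact h' w)
  have h1 : α y = r * α y := congrArg (fun L => L y) h
  exact mul_right_cancel₀ hy (h1.symm.trans (one_mul _).symm)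

/-- Points of a fibre are multiples of each other and their covectors scale accordingly; a non-zero
covector is fixed by the scalar 1 only. A point is thus known from its projection and covector. -/
theorem eq_of_covector_eq {p q : S.P} (h : S.proj p = S.proj q)
    (h' : (show EuclideanSpace ℝ (Fin S.M.dim) →L[ℝ] ℝ from covector p) = covector q) : p = q := by
  obtain ⟨t, rfl⟩ := exists_smul_of_proj_eq h
  have h5 : t = 1 := Units.ext (eq_one_of_eq_smul (h'.trans (covector_smul t p))
    (covector_ne_zero p))
  rw [h5, one_smul]

/-- `q` is the image of `p` under the cotangent lift of `φ`. -/
structure IsLiftAt (φ : S.M → S'.M) (p : S.P) (q : S'.P) : Prop where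
  proj_eq : S'.proj q = φ (S.proj p)
  covector_eq : (show EuclideanSpace ℝ (Fin S'.M.dim) →L[ℝ] ℝ from covector q).comp
    (show EuclideanSpace ℝ (Fin S.M.dim) →L[ℝ] EuclideanSpace ℝ (Fin S'.M.dim) from
      mfderiv (𝓡 S.M.dim) (𝓡 S'.M.dim) φ (S.proj p)) =
    (show EuclideanSpace ℝ (Fin S.M.dim) →L[ℝ] ℝ from covector p)

/-- dΦ is onto, so it determines the covector of the image point. Most later identities between maps
of total spaces are consequences. -/
theorem IsLiftAt.unique {Φ : Diffeomorph (𝓡 S.M.dim) (𝓡 S'.M.dim) S.M S'.M ∞} {p : S.P}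
    {q q' : S'.P} (h : IsLiftAt Φ p q) (h' : IsLiftAt Φ p q') : q = q' := by
  refine eq_of_covector_eq (h.proj_eq.trans h'.proj_eq.symm) ?_
  ext w
  obtain ⟨v, rfl⟩ := (mfderiv_bijective Φ (S.proj p)).2 w
  exact congrArg (fun L : EuclideanSpace ℝ (Fin S.M.dim) →L[ℝ] ℝ => L v)
    (h.covector_eq.trans h'.covector_eq.symm)

theorem IsLiftAt.smul {φ : S.M → S'.M} {p : S.P} {q : S'.P} (h : IsLiftAt φ p q) (t : ℝˣ) :
    IsLiftAt φ (t • p) (t • q) := by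
  refine ⟨(S'.proj_smul t q).trans (h.proj_eq.trans (congrArg φ (S.proj_smul t p).symm)), ?_⟩
  have h1 : (show EuclideanSpace ℝ (Fin S.M.dim) →L[ℝ] EuclideanSpace ℝ (Fin S'.M.dim) from
      mfderiv (𝓡 S.M.dim) (𝓡 S'.M.dim) φ (S.proj (t • p))) =
      mfderiv (𝓡 S.M.dim) (𝓡 S'.M.dim) φ (S.proj p) :=
    congrArg (fun x => (show EuclideanSpace ℝ (Fin S.M.dim) →L[ℝ] EuclideanSpace ℝ (Fin S'.M.dim)
      from mfderiv (𝓡 S.M.dim) (𝓡 S'.M.dim) φ x)) (S.proj_smul t p)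
  rw [h1, covector_smul, covector_smul, ← h.covector_eq]
  rfl

/-- An equivariant symplectomorphism is the cotangent lift of the map of the bases. -/
theorem isLiftAt_of_covers {f : EquivariantSymplectomorphism S S'} {φ : S.M → S'.M}
    (hφ : ContMDiff (𝓡 S.M.dim) (𝓡 S'.M.dim) ∞ φ)
    (h : ∀ p, S'.proj (f.toDiffeo p) = φ (S.proj p)) (p : S.P) :
    IsLiftAt φ p (f.toDiffeo p) := by
  refine ⟨h p, ?_⟩
  ext u
  obtain ⟨v, rfl⟩ := mfderiv_proj_surjective p u
  have h1 := mfderiv_proj_of_covers f.toDiffeo.contMDiff hφ h p v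
  have h2 := congrArg (show EuclideanSpace ℝ (Fin S'.M.dim) →L[ℝ] ℝ from
    covector (f.toDiffeo p)) h1.symm
  refine h2.trans ?_
  -- An equivariant symplectomorphism preserves E and Ω, hence λ. Written with covectors, this is
  -- the lift condition on vectors dπ(v), and these are all the tangent vectors of the base.
  have h3 := liouville_map f p v
  rw [covector_spec, covector_spec] at h3
  exact h3

/-- H and H' are the kernels of the covectors of p and f p, and the first covector is the pull-back
of the second. -/
theorem preservesDistribution_of_isLiftAt {φ : S.M → S'.M} {f : S.P → S'.P}
    (h : ∀ p, IsLiftAt φ p (f p)) : PreservesDistribution (baseContact S) (baseContact S') φ := by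
  intro x v
  obtain ⟨p, rfl⟩ := proj_surjective S.toHomogeneousManifold x
  rw [← ker_covector p]
  have h1 := ker_covector (f p)
  have h2 : ∀ y, S'.proj (f p) = y → (show Submodule ℝ (EuclideanSpace ℝ (Fin S'.M.dim)) from
      baseContact S' y) = LinearMap.ker (show EuclideanSpace ℝ (Fin S'.M.dim) →L[ℝ] ℝ from
        covector (f p)).toLinearMap := by
    rintro y rfl; exact h1.symm
  have h3 := h2 _ (h p).proj_eq
  have h4 : (show EuclideanSpace ℝ (Fin S'.M.dim) →L[ℝ] ℝ from covector (f p))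
      (mfderiv (𝓡 S.M.dim) (𝓡 S'.M.dim) φ (S.proj p) v) = covector p v :=
    congrArg (fun L : EuclideanSpace ℝ (Fin S.M.dim) →L[ℝ] ℝ => L v) (h p).covector_eq
  have h5 : ∀ K : Submodule ℝ (EuclideanSpace ℝ (Fin S'.M.dim)),
      K = LinearMap.ker (show EuclideanSpace ℝ (Fin S'.M.dim) →L[ℝ] ℝ from
        covector (f p)).toLinearMap → ∀ w, (w ∈ K ↔
        (show EuclideanSpace ℝ (Fin S'.M.dim) →L[ℝ] ℝ from covector (f p)) w = 0) := by
    rintro K rfl w; rfl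
  refine (h5 _ h3 _).trans ?_
  exact (congrArg (fun r : ℝ => r = 0) h4).to_iff

theorem exists_smul_of_ker_eq {V : Type*} [NormedAddCommGroup V] [NormedSpace ℝ V]
    {α β : V →L[ℝ] ℝ} (hβ : β ≠ 0) (h : ∀ v, α v = 0 ↔ β v = 0) : ∃ r : ℝˣ, β = (r : ℝ) • α := by
  obtain ⟨y, hy⟩ : ∃ y, β y ≠ 0 := by
    by_contra! h'
    exact hβ (by ext w; exact h' w)
  have hy' : α y ≠ 0 := fun h' => hy ((h y).1 h')
  refine ⟨Units.mk0 (β y / α y) (div_ne_zero hy hy'), ?_⟩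
  ext w
  have h1 : β (w - (α w / α y) • y) = 0 := by
    rw [← h, map_sub, map_smul, smul_eq_mul, div_mul_cancel₀ _ hy', sub_self]
  rw [map_sub, map_smul, smul_eq_mul, sub_eq_zero] at h1
  rw [h1, Units.val_mk0, smul_apply, smul_eq_mul]
  ring

variable {Φ : Diffeomorph (𝓡 S.M.dim) (𝓡 S'.M.dim) S.M S'.M ∞}

/-- Any q over Φ(π(p)) is the lift up to scale: its covector pulls back to one with the kernel of
`covector p`, and the action of ℝ* corrects the factor. -/
theorem exists_isLiftAt (hΦ : PreservesDistribution (baseContact S) (baseContact S') Φ) (p : S.P) :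
    ∃ q : S'.P, IsLiftAt Φ p q := by
  obtain ⟨q, hq⟩ := proj_surjective S'.toHomogeneousManifold (Φ (S.proj p))
  let α : EuclideanSpace ℝ (Fin S.M.dim) →L[ℝ] ℝ :=
    (show EuclideanSpace ℝ (Fin S'.M.dim) →L[ℝ] ℝ from covector q).comp
    (show EuclideanSpace ℝ (Fin S.M.dim) →L[ℝ] EuclideanSpace ℝ (Fin S'.M.dim) from
      mfderiv (𝓡 S.M.dim) (𝓡 S'.M.dim) Φ (S.proj p))
  let β : EuclideanSpace ℝ (Fin S.M.dim) →L[ℝ] ℝ := covector p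
  have hK : (show Submodule ℝ (EuclideanSpace ℝ (Fin S'.M.dim)) from
      baseContact S' (Φ (S.proj p))) = LinearMap.ker (show EuclideanSpace ℝ (Fin S'.M.dim) →L[ℝ] ℝ
        from covector q).toLinearMap := by
    have h2 : ∀ y, S'.proj q = y → (show Submodule ℝ (EuclideanSpace ℝ (Fin S'.M.dim)) from
        baseContact S' y) = LinearMap.ker (show EuclideanSpace ℝ (Fin S'.M.dim) →L[ℝ] ℝ from
          covector q).toLinearMap := by
      rintro y rfl; exact (ker_covector q).symm
    exact h2 _ hq
  have hαβ : ∀ v, α v = 0 ↔ β v = 0 := by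
    intro v
    have h5 : ∀ K : Submodule ℝ (EuclideanSpace ℝ (Fin S'.M.dim)),
        K = LinearMap.ker (show EuclideanSpace ℝ (Fin S'.M.dim) →L[ℝ] ℝ from
          covector q).toLinearMap → ∀ w, (w ∈ K ↔
          (show EuclideanSpace ℝ (Fin S'.M.dim) →L[ℝ] ℝ from covector q) w = 0) := by
      rintro K rfl w; rfl
    refine (h5 _ hK _).symm.trans ((hΦ (S.proj p) v).trans ?_)
    rw [← ker_covector p]
    rfl
  obtain ⟨r, hr⟩ := exists_smul_of_ker_eq (covector_ne_zero p) hαβ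
  refine ⟨r • q, (S'.proj_smul r q).trans hq, ?_⟩
  refine Eq.trans ?_ hr.symm
  rw [covector_smul]
  rfl

/-- In local sections f(p) = (c(p) r(π(p))) • σ'(Φ(π(p))), where r is the ratio of the local form of
S to the pull-back by Φ of that of S'. The ratio is smooth because it can be computed on a vector
field. -/
theorem contMDiffAt_of_isLiftAt (hΦ : PreservesDistribution (baseContact S) (baseContact S') Φ)
    {f : S.P → S'.P} (hf : ∀ p, IsLiftAt Φ p (f p)) :
    ContMDiff (𝓡 S.P.dim) (𝓡 S'.P.dim) ∞ f := by
  intro p₀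
  set x₀ := S.proj p₀ with hx₀
  obtain ⟨s, hs⟩ := exists_localSection (Q := S.toHomogeneousManifold) x₀
  obtain ⟨s', hs'⟩ := exists_localSection (Q := S'.toHomogeneousManifold) (Φ x₀)
  let θ' : ∀ x : S.M, TangentSpace (𝓡 S.M.dim) x →L[ℝ] ℝ := pullForm Φ s'.form
  have hθ' : SmoothFormAt θ' x₀ := (s'.smoothFormAt_form hs').pullForm Φ.contMDiff.contMDiffAt
  have hprop : ∀ x ∈ s.U, Φ x ∈ s'.U → ∃ r : ℝˣ,
      (show EuclideanSpace ℝ (Fin S.M.dim) →L[ℝ] ℝ from s.form x) =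
        (r : ℝ) • (show EuclideanSpace ℝ (Fin S.M.dim) →L[ℝ] ℝ from θ' x) := by
    intro x hx hx'
    refine exists_smul_of_ker_eq (s.form_ne_zero hx) fun v => ?_
    have h1 := hΦ x v
    rw [← s.ker_form hx, ← s'.ker_form hx'] at h1
    exact h1
  obtain ⟨y, hy⟩ : ∃ y : EuclideanSpace ℝ (Fin S.M.dim),
      (show EuclideanSpace ℝ (Fin S.M.dim) →L[ℝ] ℝ from θ' x₀) y ≠ 0 := by
    by_contra! h
    obtain ⟨r, hr⟩ := hprop x₀ hs hs'
    refine s.form_ne_zero hs (hr.trans ?_)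
    have h1 : (show EuclideanSpace ℝ (Fin S.M.dim) →L[ℝ] ℝ from θ' x₀) = 0 := by
      ext w; exact h w
    rw [h1, smul_zero]
    rfl
  -- A field on which the pulled-back form does not vanish near x₀, so that it can serve as
  -- denominator of r.
  let Y : ∀ x : S.M, TangentSpace (𝓡 S.M.dim) x := chartConst x₀ y
  have hY : SmoothFieldAt Y x₀ := smoothFieldAt_chartConst (mem_extChartAt_source x₀) y
  have h1 := (s.smoothFormAt_form hs).apply hY
  have h2 := hθ'.apply hY
  have hy0 : θ' x₀ (Y x₀) ≠ 0 := by
    have : (Y x₀ : EuclideanSpace ℝ (Fin S.M.dim)) = y := chartConst_self x₀ y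
    intro h
    exact hy ((congrArg (show EuclideanSpace ℝ (Fin S.M.dim) →L[ℝ] ℝ from θ' x₀) this.symm).trans h)
  let r : S.M → ℝ := fun x => s.form x (Y x) / θ' x (Y x)
  have hr : ContMDiffAt (𝓡 S.M.dim) 𝓘(ℝ, ℝ) ∞ r x₀ := h1.div₀ h2 hy0
  have hrx : ∀ x ∈ s.U, Φ x ∈ s'.U → θ' x (Y x) ≠ 0 → r x ≠ 0 ∧
      (show EuclideanSpace ℝ (Fin S.M.dim) →L[ℝ] ℝ from s.form x) =
        r x • (show EuclideanSpace ℝ (Fin S.M.dim) →L[ℝ] ℝ from θ' x) := by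
    intro x hx hx' hxy
    obtain ⟨ρ, hρ⟩ := hprop x hx hx'
    have h3 : r x = ρ := by
      have h4 : s.form x (Y x) = ρ * θ' x (Y x) :=
        congrArg (fun L : EuclideanSpace ℝ (Fin S.M.dim) →L[ℝ] ℝ => L (Y x)) hρ
      simp only [r, h4]
      rw [mul_div_cancel_right₀ _ hxy]
    rw [h3]
    exact ⟨ρ.ne_zero, hρ⟩
  have hc : S.proj p₀ ∈ s.U := hs
  have hπ : ContMDiffAt (𝓡 S.P.dim) (𝓡 S.M.dim) ∞ S.proj p₀ := S.smooth_proj.contMDiffAt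
  have hg : ContMDiffAt (𝓡 S.P.dim) (𝓡 S'.P.dim) ∞
      (fun p : S.P => unitOf ((s.c p : ℝ) * r (S.proj p)) • s'.σ (Φ (S.proj p))) p₀ := by
    refine contMDiffAt_smul (contMDiffAt_unitOf ?_ ?_) ?_
    · exact (s.smooth_c p₀ hs).mul (hr.comp p₀ hπ)
    · exact mul_ne_zero (s.c p₀).ne_zero (hrx x₀ hs hs' hy0).1
    · exact (s'.smooth_σ _ hs').comp p₀ (Φ.contMDiff.contMDiffAt.comp p₀ hπ)
  refine hg.congr_of_eventuallyEq ?_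
  have hev : ∀ᶠ x in 𝓝 x₀, θ' x (Y x) ≠ 0 := h2.continuousAt.eventually_ne hy0
  have hev' : ∀ᶠ x in 𝓝 x₀, Φ x ∈ s'.U :=
    Φ.continuous.continuousAt.preimage_mem_nhds (s'.isOpen.mem_nhds hs')
  filter_upwards [s.proj_mem_nhds hs, hπ.continuousAt.eventually hev,
    hπ.continuousAt.eventually hev'] with p h3 h4 h5
  obtain ⟨h6, h7⟩ := hrx _ h3 h5 h4
  have h8 : (s.c p : ℝ) * r (S.proj p) ≠ 0 := mul_ne_zero (s.c p).ne_zero h6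
  refine (hf p).unique ⟨(S'.proj_smul _ _).trans (s'.proj_σ _ h5), ?_⟩
  rw [covector_smul, coe_unitOf h8, s'.covector_σ h5]
  refine Eq.trans ?_ (s.covector_eq h3).symm
  ext v
  have h9 := congrArg (fun L : EuclideanSpace ℝ (Fin S.M.dim) →L[ℝ] ℝ => (s.c p : ℝ) * L v) h7
  refine Eq.trans ?_ h9.symm
  exact mul_assoc _ _ _

theorem IsLiftAt.symm {p : S.P} {q : S'.P} (h : IsLiftAt Φ p q) : IsLiftAt Φ.symm q p := by
  have hp : S.proj p = Φ.symm (S'.proj q) := by rw [h.proj_eq, Φ.symm_apply_apply]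
  refine ⟨hp, ?_⟩
  rw [← h.covector_eq]
  have h1 := mfderiv_comp (S'.proj q) (Φ.mdifferentiable (by simp) (Φ.symm (S'.proj q)))
    (Φ.symm.mdifferentiable (by simp) (S'.proj q))
  have h2 : (Φ ∘ Φ.symm : S'.M → S'.M) = id := funext Φ.apply_symm_apply
  have h3 : (show EuclideanSpace ℝ (Fin S'.M.dim) →L[ℝ] EuclideanSpace ℝ (Fin S'.M.dim) from
      mfderiv (𝓡 S'.M.dim) (𝓡 S'.M.dim) (Φ ∘ Φ.symm) (S'.proj q)) = ContinuousLinearMap.id ℝ _ :=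
    (congrArg (fun g : S'.M → S'.M => (show EuclideanSpace ℝ (Fin S'.M.dim) →L[ℝ]
      EuclideanSpace ℝ (Fin S'.M.dim) from mfderiv (𝓡 S'.M.dim) (𝓡 S'.M.dim) g (S'.proj q)))
      h2).trans mfderiv_id
  have h4 := h1.symm.trans h3
  have h5 : (show EuclideanSpace ℝ (Fin S.M.dim) →L[ℝ] EuclideanSpace ℝ (Fin S'.M.dim) from
      mfderiv (𝓡 S.M.dim) (𝓡 S'.M.dim) Φ (S.proj p)) =
      mfderiv (𝓡 S.M.dim) (𝓡 S'.M.dim) Φ (Φ.symm (S'.proj q)) :=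
    congrArg (fun x => (show EuclideanSpace ℝ (Fin S.M.dim) →L[ℝ] EuclideanSpace ℝ (Fin S'.M.dim)
      from mfderiv (𝓡 S.M.dim) (𝓡 S'.M.dim) Φ x)) hp
  rw [h5]
  ext w
  exact congrArg (fun L : EuclideanSpace ℝ (Fin S'.M.dim) →L[ℝ] EuclideanSpace ℝ (Fin S'.M.dim) =>
    (show EuclideanSpace ℝ (Fin S'.M.dim) →L[ℝ] ℝ from covector q) (L w)) h4

/-- The cotangent lift of a diffeomorphism that preserves the contact structures. -/
theorem exists_lift (hΦ : PreservesDistribution (baseContact S) (baseContact S') Φ) :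
    ∃ f : EquivariantSymplectomorphism S S', ∀ p, IsLiftAt Φ p (f.toDiffeo p) := by
  choose f hf using exists_isLiftAt hΦ
  choose g hg using exists_isLiftAt hΦ.symm
  have hfs := contMDiffAt_of_isLiftAt hΦ hf
  have hgs := contMDiffAt_of_isLiftAt hΦ.symm hg
  have hcov : ∀ p, S'.proj (f p) = Φ (S.proj p) := fun p => (hf p).proj_eq
  -- f covers Φ and transforms covectors by the transpose of dΦ, so it pulls λ' back to λ.
  have hlam : (pullForm f (liouville S') : ∀ p : S.P, TangentSpace (𝓡 S.P.dim) p →L[ℝ] ℝ) =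
      liouville S := by
    funext p
    ext v
    refine (congrArg (fun L => L (mfderiv (𝓡 S.P.dim) (𝓡 S'.P.dim) f p v))
      (covector_spec (f p))).trans ?_
    have h1 := mfderiv_proj_of_covers hfs Φ.contMDiff hcov p v
    refine (congrArg (show EuclideanSpace ℝ (Fin S'.M.dim) →L[ℝ] ℝ from covector (f p)) h1).trans ?_
    rw [covector_spec p]
    exact congrArg (fun L : EuclideanSpace ℝ (Fin S.M.dim) →L[ℝ] ℝ =>
      L (mfderiv (𝓡 S.P.dim) (𝓡 S.M.dim) S.proj p v)) (hf p).covector_eq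
  refine ⟨⟨⟨⟨f, g, fun p => (hg (f p)).unique (hf p).symm, fun q => (hf (g q)).unique ?_⟩,
    hfs, hgs⟩, fun t p => (hf (t • p)).unique ((hf p).smul t), fun p v w => ?_⟩, hf⟩
  · exact (hg q).symm
  -- Since d is natural and Ω = dλ on both sides, preserving λ suffices.
  · have h1 := extD_pullForm (smoothFormAt_liouville (f p)) hfs.contMDiffAt
    rw [hlam, extD_liouville] at h1
    have h2 := congrArg (fun L : EuclideanSpace ℝ (Fin S.P.dim) →L[ℝ]
      EuclideanSpace ℝ (Fin S.P.dim) →L[ℝ] ℝ => L v w) h1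
    refine Eq.trans ?_ h2.symm
    have h3 := congrArg (fun L : EuclideanSpace ℝ (Fin S'.P.dim) →L[ℝ]
      EuclideanSpace ℝ (Fin S'.P.dim) →L[ℝ] ℝ => L (mfderiv (𝓡 S.P.dim) (𝓡 S'.P.dim) f p v)
        (mfderiv (𝓡 S.P.dim) (𝓡 S'.P.dim) f p w)) (extD_liouville (f p))
    exact h3.symm

/-- Reduces equality of morphisms to a comparison on the bases; the functor laws, fullness and the
inverse isomorphisms of essential surjectivity use it. -/
theorem EquivariantSymplectomorphism.ext_of_isLiftAt {f g : EquivariantSymplectomorphism S S'}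
    (hf : ∀ p, IsLiftAt Φ p (f.toDiffeo p)) (hg : ∀ p, IsLiftAt Φ p (g.toDiffeo p)) : f = g :=
  EquivariantSymplectomorphism.ext (Diffeomorph.ext fun p => (hf p).unique (hg p))

/-- f and its inverse both descend, and the descended maps are inverse to each other since the
projections are onto. That f is their lift comes from its preserving λ. -/
theorem exists_base_diffeomorph (f : EquivariantSymplectomorphism S S') :
    ∃ Φ : Diffeomorph (𝓡 S.M.dim) (𝓡 S'.M.dim) S.M S'.M ∞,
      (∀ p, IsLiftAt Φ p (f.toDiffeo p)) ∧
      PreservesDistribution (baseContact S) (baseContact S') Φ := by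
  have hsymm : ∀ (t : ℝˣ) (q : S'.P), f.toDiffeo.symm (t • q) = t • f.toDiffeo.symm q := by
    intro t q
    apply f.toDiffeo.injective
    change f.toDiffeo _ = f.toDiffeo _
    rw [f.map_smul, f.toDiffeo.apply_symm_apply, f.toDiffeo.apply_symm_apply]
  obtain ⟨φ, hφ, h⟩ := exists_descent f.toDiffeo.contMDiff f.map_smul
  obtain ⟨φ', hφ', h'⟩ := exists_descent f.toDiffeo.symm.contMDiff hsymm
  have hl : ∀ p, IsLiftAt φ p (f.toDiffeo p) := isLiftAt_of_covers hφ h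
  refine ⟨⟨⟨φ, φ', fun x => ?_, fun y => ?_⟩, hφ, hφ'⟩, hl, preservesDistribution_of_isLiftAt hl⟩
  · obtain ⟨p, rfl⟩ := proj_surjective S.toHomogeneousManifold x
    rw [← h, ← h', f.toDiffeo.symm_apply_apply]
  · obtain ⟨q, rfl⟩ := proj_surjective S'.toHomogeneousManifold y
    rw [← h', ← h, f.toDiffeo.apply_symm_apply]

end Lift

/-! ### Smooth maps into the cotangent bundle -/

section Cotangent

open Set Filter Topology

variable {E Z : Type*} [NormedAddCommGroup E] [NormedSpace ℝ E] {H : Type*} [TopologicalSpace H]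
  {I : ModelWithCorners ℝ E H} [TopologicalSpace Z] [ChartedSpace H Z] {A : Mfd.{u}}

theorem contMDiffAt_covector_proj {f : Z → CotangentBundle A} {z₀ : Z}
    (hf : ContMDiffAt I (cotangentModel A) ∞ f z₀) :
    ContMDiffAt I (𝓡 A.dim) ∞ (fun z => (f z).proj) z₀ :=
  (Bundle.contMDiffAt_totalSpace.1 hf).1

theorem contMDiffAt_covector_apply {f : Z → CotangentBundle A} {z₀ : Z}
    (hf : ContMDiffAt I (cotangentModel A) ∞ f z₀) {Y : ∀ x : A, TangentSpace (𝓡 A.dim) x}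
    (hY : SmoothFieldAt Y (f z₀).proj) :
    ContMDiffAt I 𝓘(ℝ, ℝ) ∞ (fun z => (f z).2 (Y (f z).proj)) z₀ := by
  have hb := contMDiffAt_covector_proj hf
  have hY' : ContMDiffAt I (𝓡 A.dim).tangent ∞
      (fun z => (⟨(f z).proj, Y (f z).proj⟩ : TangentBundle (𝓡 A.dim) A)) z₀ :=
    ContMDiffAt.comp z₀ (g := fun x => (⟨x, Y x⟩ : TangentBundle (𝓡 A.dim) A)) hY hb
  have h : ContMDiffAt I ((𝓡 A.dim).prod 𝓘(ℝ, ℝ)) ∞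
      (fun z => Bundle.TotalSpace.mk' ℝ (E := Bundle.Trivial A ℝ) (f z).proj
        ((f z).2 (Y (f z).proj))) z₀ :=
    ContMDiffAt.clm_bundle_apply (F₁ := EuclideanSpace ℝ (Fin A.dim)) (F₂ := ℝ)
      (E₁ := fun x : A => TangentSpace (𝓡 A.dim) x)
      (E₂ := Bundle.Trivial A ℝ) (b := fun z => (f z).proj) hf hY'
  simp only [Bundle.contMDiffAt_totalSpace] at h
  exact h.2

theorem contMDiffAt_covector_smul {f : Z → CotangentBundle A} {c : Z → ℝ} {z₀ : Z}
    (hf : ContMDiffAt I (cotangentModel A) ∞ f z₀) (hc : ContMDiffAt I 𝓘(ℝ, ℝ) ∞ c z₀) :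
    ContMDiffAt I (cotangentModel A) ∞
      (fun z => (⟨(f z).proj, c z • (f z).2⟩ : CotangentBundle A)) z₀ := by
  have h := Bundle.contMDiffAt_totalSpace.1 hf
  refine Bundle.contMDiffAt_totalSpace.2 ⟨h.1, (hc.smul h.2).congr_of_eventuallyEq ?_⟩
  let e := trivializationAt (EuclideanSpace ℝ (Fin A.dim) →L[ℝ] ℝ)
    (fun x : A => TangentSpace (𝓡 A.dim) x →L[ℝ] ℝ) (f z₀).proj
  have hb := h.1.continuousAt.preimage_mem_nhds
    (e.open_baseSet.mem_nhds (mem_baseSet_trivializationAt _ _ _))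
  filter_upwards [hb] with z hz
  -- The trivialization is linear on fibres over its base set, so the fibre coordinates of the
  -- product are the products.
  exact (e.linear ℝ hz).map_smul (c z) (f z).2

theorem contMDiffAt_covector_section {θ : ∀ x : A, TangentSpace (𝓡 A.dim) x →L[ℝ] ℝ} {b : Z → A}
    {z₀ : Z} (hθ : SmoothFormAt θ (b z₀)) (hb : ContMDiffAt I (𝓡 A.dim) ∞ b z₀) :
    ContMDiffAt I (cotangentModel A) ∞ (fun z => (⟨b z, θ (b z)⟩ : CotangentBundle A)) z₀ :=
  ContMDiffAt.comp z₀ (g := fun x => (⟨x, θ x⟩ : CotangentBundle A)) hθ hb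

end Cotangent

/-! ### The space L* ∖ 0 and its coordinates -/

section Symplectization

open Set Filter Topology

/-- A local contact form `θ` near `x₀`, with a vector field `Y` such that `θ(Y) = 1`. -/
structure LocalForm (C : ContactManifold.{u}) (x₀ : C.M) where
  U : Set C.M
  θ : ∀ x : C.M, TangentSpace (𝓡 C.M.dim) x →L[ℝ] ℝ
  Y : ∀ x : C.M, TangentSpace (𝓡 C.M.dim) x
  isOpen : IsOpen U
  mem : x₀ ∈ U
  subset_source : U ⊆ (extChartAt (𝓡 C.M.dim) x₀).source
  ker_θ : ∀ x, LinearMap.ker (θ x).toLinearMap = C.H x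
  θ_Y : ∀ x, θ x (Y x) = 1
  smooth_θ : ∀ x ∈ U, SmoothFormAt θ x
  smooth_Y : ∀ x ∈ U, SmoothFieldAt Y x

theorem nonempty_localForm (C : ContactManifold.{u}) (x₀ : C.M) : Nonempty (LocalForm C x₀) := by
  obtain ⟨U, θ, Y, hU, hx₀, hker, hθY, hs⟩ :=
    C.isContact.isHyperplaneDistribution.exists_localForm x₀
  exact ⟨⟨U ∩ (extChartAt (𝓡 C.M.dim) x₀).source, θ, Y,
    hU.inter (isOpen_extChartAt_source x₀), ⟨hx₀, mem_extChartAt_source x₀⟩, inter_subset_right,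
    hker, hθY, fun x hx => (hs x hx.1).1, fun x hx => (hs x hx.1).2⟩⟩

/-- A choice of local contact forms. -/
def localForm (C : ContactManifold.{u}) (x₀ : C.M) : LocalForm C x₀ :=
  Classical.choice (nonempty_localForm C x₀)

/-- The total space `L^* ∖ 0` of the symplectization. -/
def SymplectizationSpace (C : ContactManifold.{u}) : Type u :=
  {α : CotangentBundle C.M // LinearMap.ker α.2.toLinearMap = C.H α.proj}

instance (C : ContactManifold.{u}) : TopologicalSpace (SymplectizationSpace C) :=
  instTopologicalSpaceSubtype

variable {C : ContactManifold.{u}}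

/-- The inclusion into the cotangent bundle. -/
def SymplectizationSpace.incl (α : SymplectizationSpace C) : CotangentBundle C.M := α.1

theorem isEmbedding_incl : IsEmbedding (SymplectizationSpace.incl (C := C)) :=
  IsEmbedding.subtypeVal

theorem incl_injective : Function.Injective (SymplectizationSpace.incl (C := C)) :=
  Subtype.val_injective

instance : MulAction ℝˣ (SymplectizationSpace C) where
  smul t α := ⟨⟨α.1.proj, (t : ℝ) • α.1.2⟩,
    (LinearMap.ker_smul _ _ t.ne_zero).trans α.2⟩
  one_smul α := by
    apply Subtype.ext
    change (⟨α.1.proj, ((1 : ℝˣ) : ℝ) • α.1.2⟩ : CotangentBundle C.M) = α.1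
    rw [Units.val_one, one_smul]
  mul_smul s t α := by
    apply Subtype.ext
    change (⟨α.1.proj, ((s * t : ℝˣ) : ℝ) • α.1.2⟩ : CotangentBundle C.M) =
      ⟨α.1.proj, (s : ℝ) • (t : ℝ) • α.1.2⟩
    rw [Units.val_mul, mul_smul]

namespace LocalForm

variable {x₀ : C.M} (l : LocalForm C x₀)

/-- The fibre coordinate defined by a local contact form. -/
def coord (α : CotangentBundle C.M) : ℝ := α.2 (l.Y α.proj)

/-- A multiple of the local contact form, as a point of the symplectization. -/
def point (x : C.M) (t : ℝˣ) : SymplectizationSpace C :=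
  ⟨⟨x, (t : ℝ) • l.θ x⟩, (LinearMap.ker_smul _ _ t.ne_zero).trans (l.ker_θ x)⟩

theorem coord_point (x : C.M) (t : ℝˣ) : l.coord (l.point x t).incl = t := by
  change (t : ℝ) * l.θ x (l.Y x) = t
  rw [l.θ_Y, mul_one]

/-- For every v, the vector v - θ(v) Y lies in ker θ = ker α, hence α(v) = α(Y) θ(v). -/
theorem covector_eq (α : SymplectizationSpace C) :
    α.incl.2 = l.coord α.incl • l.θ α.incl.proj := by
  have h1 := l.ker_θ α.incl.proj
  have h2 : LinearMap.ker α.incl.2.toLinearMap = C.H α.incl.proj := α.2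
  rw [← h2] at h1
  ext v
  have h3 : v - l.θ α.incl.proj v • l.Y α.incl.proj ∈
      LinearMap.ker (l.θ α.incl.proj).toLinearMap := by
    change l.θ α.incl.proj (v - l.θ α.incl.proj v • l.Y α.incl.proj) = 0
    rw [map_sub, map_smul, l.θ_Y, smul_eq_mul, mul_one, sub_self]
  rw [h1] at h3
  have h4 : α.incl.2 (v - l.θ α.incl.proj v • l.Y α.incl.proj) = 0 := h3
  rw [map_sub, map_smul, sub_eq_zero] at h4
  rw [h4]
  exact mul_comm _ _

/-- If α(Y) = 0, then Y would lie in ker α = H = ker θ, against θ(Y) = 1. In particular the kernel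
condition already excludes the zero covector. -/
theorem coord_ne_zero (α : SymplectizationSpace C) : l.coord α.incl ≠ 0 := by
  intro h
  have h1 : l.Y α.incl.proj ∈ LinearMap.ker α.incl.2.toLinearMap := h
  have h2 : LinearMap.ker α.incl.2.toLinearMap = C.H α.incl.proj := α.2
  rw [h2, ← l.ker_θ] at h1
  have h3 : l.θ α.incl.proj (l.Y α.incl.proj) = 0 := h1
  rw [l.θ_Y] at h3
  exact one_ne_zero h3

theorem point_coord (α : SymplectizationSpace C) :
    l.point α.incl.proj (unitOf (l.coord α.incl)) = α := by
  apply incl_injective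
  change (⟨α.incl.proj, (unitOf (l.coord α.incl) : ℝ) • l.θ α.incl.proj⟩ : CotangentBundle C.M) =
    α.incl
  rw [coe_unitOf (l.coord_ne_zero α), ← l.covector_eq α]

theorem coord_smul (t : ℝˣ) (α : SymplectizationSpace C) :
    l.coord (t • α).incl = t * l.coord α.incl := rfl

section Smooth

variable {E Z : Type*} [NormedAddCommGroup E] [NormedSpace ℝ E] {H : Type*} [TopologicalSpace H]
  {I : ModelWithCorners ℝ E H} [TopologicalSpace Z] [ChartedSpace H Z]

theorem contMDiffAt_coord {f : Z → CotangentBundle C.M} {z₀ : Z} (hz : (f z₀).proj ∈ l.U)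
    (hf : ContMDiffAt I (cotangentModel C.M) ∞ f z₀) :
    ContMDiffAt I 𝓘(ℝ, ℝ) ∞ (fun z => l.coord (f z)) z₀ :=
  contMDiffAt_covector_apply hf (l.smooth_Y _ hz)

theorem contMDiffAt_incl_point {b : Z → C.M} {t : Z → ℝˣ} {z₀ : Z} (hz : b z₀ ∈ l.U)
    (hb : ContMDiffAt I (𝓡 C.M.dim) ∞ b z₀)
    (ht : ContMDiffAt I 𝓘(ℝ, ℝ) ∞ (fun z => (t z : ℝ)) z₀) :
    ContMDiffAt I (cotangentModel C.M) ∞ (fun z => (l.point (b z) (t z)).incl) z₀ :=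
  contMDiffAt_covector_smul (contMDiffAt_covector_section (l.smooth_θ _ hz) hb) ht

end Smooth

end LocalForm

/-- The splitting of the model space of the symplectization. -/
def splitEquiv (n : ℕ) :
    (EuclideanSpace ℝ (Fin n) × ℝ) ≃L[ℝ] EuclideanSpace ℝ (Fin (n + 1)) :=
  ContinuousLinearEquiv.ofFinrankEq (by simp)

namespace LocalForm

variable {x₀ : C.M} (l : LocalForm C x₀)

/-- The chart of the symplectization, as a function on the cotangent bundle. -/
def chartFun (α : CotangentBundle C.M) : EuclideanSpace ℝ (Fin (C.M.dim + 1)) :=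
  splitEquiv C.M.dim (extChartAt (𝓡 C.M.dim) x₀ α.proj, l.coord α)

/-- The inverse of the chart of the symplectization. -/
def chartInv (z : EuclideanSpace ℝ (Fin (C.M.dim + 1))) : SymplectizationSpace C :=
  l.point ((extChartAt (𝓡 C.M.dim) x₀).symm ((splitEquiv C.M.dim).symm z).1)
    (unitOf ((splitEquiv C.M.dim).symm z).2)

/-- The target of the chart of the symplectization. -/
def chartTarget : Set (EuclideanSpace ℝ (Fin (C.M.dim + 1))) :=
  (splitEquiv C.M.dim).symm ⁻¹' (((extChartAt (𝓡 C.M.dim) x₀).target ∩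
    (extChartAt (𝓡 C.M.dim) x₀).symm ⁻¹' l.U) ×ˢ {s : ℝ | s ≠ 0})

theorem isOpen_chartTarget : IsOpen l.chartTarget := by
  refine IsOpen.preimage (splitEquiv C.M.dim).symm.continuous (IsOpen.prod ?_ isOpen_ne)
  exact (continuousOn_extChartAt_symm x₀).isOpen_inter_preimage (isOpen_extChartAt_target x₀)
    l.isOpen

variable {E Z : Type*} [NormedAddCommGroup E] [NormedSpace ℝ E] {H : Type*} [TopologicalSpace H]
  {I : ModelWithCorners ℝ E H} [TopologicalSpace Z] [ChartedSpace H Z]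

/-- The chart is treated as a function on the cotangent bundle, smooth over U. Transition maps,
smoothness into L* ∖ 0 and the immersion property all reduce to this. -/
theorem contMDiffAt_chartFun {f : Z → CotangentBundle C.M} {z₀ : Z} (hz : (f z₀).proj ∈ l.U)
    (hf : ContMDiffAt I (cotangentModel C.M) ∞ f z₀) :
    ContMDiffAt I (𝓡 (C.M.dim + 1)) ∞ (fun z => l.chartFun (f z)) z₀ := by
  have h1 : ContMDiffAt I (𝓡 C.M.dim) ∞ (fun z => extChartAt (𝓡 C.M.dim) x₀ (f z).proj) z₀ :=
    ContMDiffAt.comp z₀ (g := extChartAt (𝓡 C.M.dim) x₀) (contMDiffAt_extChartAt' (by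
      have := l.subset_source hz
      rwa [extChartAt_source] at this)) (contMDiffAt_covector_proj hf)
  have h2 := h1.prodMk_space (l.contMDiffAt_coord hz hf)
  exact (splitEquiv C.M.dim).contDiff.contMDiff.contMDiffAt.comp z₀ h2

theorem contMDiffAt_incl_chartInv {z : EuclideanSpace ℝ (Fin (C.M.dim + 1))}
    (hz : z ∈ l.chartTarget) :
    ContMDiffAt (𝓡 (C.M.dim + 1)) (cotangentModel C.M) ∞ (fun z => (l.chartInv z).incl) z := by
  have h0 : ContDiff ℝ ∞ (splitEquiv C.M.dim).symm := (splitEquiv C.M.dim).symm.contDiff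
  refine l.contMDiffAt_incl_point hz.1.2 ?_ ?_
  · have h1 := (contMDiffOn_extChartAt_symm (I := 𝓡 C.M.dim) (n := ∞) x₀).contMDiffAt
      ((isOpen_extChartAt_target x₀).mem_nhds hz.1.1)
    exact h1.comp z (contDiff_fst.comp h0).contMDiff.contMDiffAt
  · have h1 : ContMDiffAt (𝓡 (C.M.dim + 1)) 𝓘(ℝ, ℝ) ∞
        (fun z => ((splitEquiv C.M.dim).symm z).2) z :=
      (contDiff_snd.comp h0).contMDiff.contMDiffAt
    refine h1.congr_of_eventuallyEq ?_
    filter_upwards [h1.continuousAt.eventually_ne hz.2] with y hy using coe_unitOf hy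

theorem chartFun_mem {α : SymplectizationSpace C} (hα : α.incl.proj ∈ l.U) :
    l.chartFun α.incl ∈ l.chartTarget := by
  have h := l.subset_source hα
  refine ⟨⟨?_, ?_⟩, ?_⟩
  all_goals simp only [chartFun, ContinuousLinearEquiv.symm_apply_apply]
  · exact (extChartAt (𝓡 C.M.dim) x₀).map_source h
  · rw [mem_preimage, (extChartAt (𝓡 C.M.dim) x₀).left_inv h]
    exact hα
  · exact l.coord_ne_zero α

theorem chartInv_chartFun {α : SymplectizationSpace C} (hα : α.incl.proj ∈ l.U) :
    l.chartInv (l.chartFun α.incl) = α := by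
  have h := l.subset_source hα
  simp only [chartFun, chartInv, ContinuousLinearEquiv.symm_apply_apply]
  rw [(extChartAt (𝓡 C.M.dim) x₀).left_inv h, l.point_coord]

theorem chartFun_chartInv {z : EuclideanSpace ℝ (Fin (C.M.dim + 1))} (hz : z ∈ l.chartTarget) :
    l.chartFun (l.chartInv z).incl = z := by
  rw [chartFun, chartInv, l.coord_point, coe_unitOf hz.2]
  change splitEquiv C.M.dim (extChartAt (𝓡 C.M.dim) x₀ ((extChartAt (𝓡 C.M.dim) x₀).symm _), _) = z
  rw [(extChartAt (𝓡 C.M.dim) x₀).right_inv hz.1.1]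
  exact (splitEquiv C.M.dim).apply_symm_apply z

end LocalForm

end Symplectization

/-! ### L* ∖ 0 as a manifold and as a principal bundle -/

section SymplectizationManifold

open Set Filter Topology

variable {C : ContactManifold.{u}}

theorem continuous_incl_proj : Continuous fun α : SymplectizationSpace C => α.incl.proj :=
  (FiberBundle.continuous_proj _ _).comp isEmbedding_incl.continuous

namespace LocalForm

variable {x₀ : C.M} (l : LocalForm C x₀)

theorem continuousAt_incl_chartFun {α : CotangentBundle C.M} (hα : α.proj ∈ l.U) :
    ContinuousAt l.chartFun α :=
  (l.contMDiffAt_chartFun (f := id) (I := cotangentModel C.M) hα contMDiffAt_id).continuousAt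

/-- The chart of the symplectization defined by a local contact form. -/
def chart : OpenPartialHomeomorph (SymplectizationSpace C)
    (EuclideanSpace ℝ (Fin (C.M.dim + 1))) where
  toFun α := l.chartFun α.incl
  invFun := l.chartInv
  source := {α | α.incl.proj ∈ l.U}
  target := l.chartTarget
  map_source' _ hα := l.chartFun_mem hα
  map_target' _ hz := hz.1.2
  left_inv' _ hα := l.chartInv_chartFun hα
  right_inv' _ hz := l.chartFun_chartInv hz
  open_source := l.isOpen.preimage continuous_incl_proj
  open_target := l.isOpen_chartTarget
  continuousOn_toFun _ hα := ((l.continuousAt_incl_chartFun hα).comp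
    isEmbedding_incl.continuous.continuousAt).continuousWithinAt
  continuousOn_invFun _ hz := (isEmbedding_incl.continuousAt_iff.2
    (l.contMDiffAt_incl_chartInv hz).continuousAt).continuousWithinAt

end LocalForm

instance : ChartedSpace (EuclideanSpace ℝ (Fin (C.M.dim + 1))) (SymplectizationSpace C) where
  atlas := Set.range fun x₀ : C.M => (localForm C x₀).chart
  chartAt α := (localForm C α.incl.proj).chart
  mem_chart_source α := (localForm C α.incl.proj).mem
  chart_mem_atlas α := ⟨α.incl.proj, rfl⟩

/-- A transition map passes through the cotangent bundle: an inverse chart followed by the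
inclusion, then a chart function, each of them smooth. -/
instance : IsManifold (𝓡 (C.M.dim + 1)) ∞ (SymplectizationSpace C) := by
  refine isManifold_of_contDiffOn _ _ _ ?_
  rintro _ _ ⟨x, rfl⟩ ⟨y, rfl⟩
  intro z hz
  simp only [modelWithCornersSelf_coe, modelWithCornersSelf_coe_symm, Set.preimage_id,
    Set.range_id, Set.inter_univ, Function.comp_id, Function.id_comp] at hz ⊢
  rw [OpenPartialHomeomorph.trans_source] at hz
  have h1 := (localForm C x).contMDiffAt_incl_chartInv hz.1
  have h2 := (localForm C y).contMDiffAt_chartFun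
    (f := fun z => ((localForm C x).chartInv z).incl) hz.2 h1
  exact h2.contDiffAt.contDiffWithinAt

section Smooth

variable {E Z : Type*} [NormedAddCommGroup E] [NormedSpace ℝ E] {H : Type*} [TopologicalSpace H]
  {I : ModelWithCorners ℝ E H} [TopologicalSpace Z] [ChartedSpace H Z]

/-- The topology is induced and the charts extend to smooth functions on part of the cotangent
bundle, so smoothness of a map into L* ∖ 0 can be tested there. -/
theorem contMDiffAt_of_incl {f : Z → SymplectizationSpace C} {z₀ : Z}
    (hf : ContMDiffAt I (cotangentModel C.M) ∞ (fun z => (f z).incl) z₀) :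
    ContMDiffAt I (𝓡 (C.M.dim + 1)) ∞ f z₀ := by
  refine contMDiffAt_iff_target.2 ⟨isEmbedding_incl.continuousAt_iff.2 hf.continuousAt, ?_⟩
  exact (localForm C (f z₀).incl.proj).contMDiffAt_chartFun (localForm C (f z₀).incl.proj).mem hf

theorem contMDiff_incl : ContMDiff (𝓡 (C.M.dim + 1)) (cotangentModel C.M) ∞
    (SymplectizationSpace.incl (C := C)) := by
  intro α
  refine contMDiffAt_iff_source.2 (ContMDiffAt.contMDiffWithinAt ?_)
  let l := localForm C α.incl.proj
  have h : l.chartFun α.incl ∈ l.chartTarget := l.chartFun_mem l.mem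
  exact l.contMDiffAt_incl_chartInv h

end Smooth

/-- Two points of one fibre lie in a common chart; other pairs are separated on M. -/
instance : T2Space (SymplectizationSpace C) := by
  refine ⟨fun α β hne => ?_⟩
  by_cases h : α.incl.proj = β.incl.proj
  · let l := localForm C α.incl.proj
    have hα : α ∈ l.chart.source := l.mem
    have hβ : β ∈ l.chart.source := by
      change β.incl.proj ∈ l.U
      rw [← h]
      exact l.mem
    have h1 : l.chart α ≠ l.chart β := fun h2 => hne (l.chart.injOn hα hβ h2)
    obtain ⟨u, v, hu, hv, hαu, hβv, huv⟩ := t2_separation h1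
    refine ⟨_, _, l.chart.isOpen_inter_preimage hu, l.chart.isOpen_inter_preimage hv, ⟨hα, hαu⟩,
      ⟨hβ, hβv⟩, ?_⟩
    rw [Set.disjoint_left] at huv ⊢
    exact fun γ h1 h2 => huv h1.2 h2.2
  · obtain ⟨u, v, hu, hv, hαu, hβv, huv⟩ := t2_separation h
    exact ⟨_, _, hu.preimage continuous_incl_proj, hv.preimage continuous_incl_proj, hαu, hβv,
      huv.preimage _⟩

instance : SecondCountableTopology (SymplectizationSpace C) := by
  obtain ⟨s, hs, hcov⟩ := TopologicalSpace.countable_cover_nhds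
    (f := fun x : C.M => (localForm C x).U)
    fun x => (localForm C x).isOpen.mem_nhds (localForm C x).mem
  -- The chart at τ x is the one of `localForm C x`, so countably many base neighbourhoods that
  -- cover M yield countably many chart domains that cover L* ∖ 0.
  let τ : C.M → SymplectizationSpace C := fun x => (localForm C x).point x 1
  refine ChartedSpace.secondCountable_of_countable_cover
    (EuclideanSpace ℝ (Fin (C.M.dim + 1))) (s := τ '' s) ?_ (hs.image τ)
  refine Set.eq_univ_of_forall fun α => ?_
  have h := Set.mem_univ α.incl.proj
  rw [← hcov] at h
  simp only [Set.mem_iUnion] at h ⊢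
  obtain ⟨x, hx, hα⟩ := h
  exact ⟨τ x, ⟨x, hx, rfl⟩, hα⟩

variable (C) in
/-- The total space of the symplectization as a manifold. -/
abbrev symplectizationMfd : Mfd.{u} where
  carrier := SymplectizationSpace C
  dim := C.M.dim + 1

variable (C) in
/-- The projection of the symplectization. -/
def symplectizationProj (α : SymplectizationSpace C) : C.M := α.incl.proj

theorem contMDiff_symplectizationProj :
    ContMDiff (𝓡 (C.M.dim + 1)) (𝓡 C.M.dim) ∞ (symplectizationProj C) := fun α =>
  contMDiffAt_covector_proj (contMDiff_incl α)

namespace LocalForm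

variable {x₀ : C.M} (l : LocalForm C x₀)

theorem contMDiffAt_coord_incl {α : SymplectizationSpace C} (hα : α.incl.proj ∈ l.U) :
    ContMDiffAt (𝓡 (C.M.dim + 1)) 𝓘(ℝ, ℝ) ∞
      (fun α : SymplectizationSpace C => l.coord α.incl) α :=
  l.contMDiffAt_coord hα (contMDiff_incl α)

/-- The local trivialization of the symplectization defined by a local contact form. -/
def trivialization : Bundle.Trivialization ℝˣ (symplectizationProj C) where
  toFun α := (α.incl.proj, unitOf (l.coord α.incl))
  invFun z := l.point z.1 z.2
  source := {α | α.incl.proj ∈ l.U}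
  target := l.U ×ˢ univ
  map_source' _ hα := ⟨hα, mem_univ _⟩
  map_target' _ hz := hz.1
  left_inv' α _ := l.point_coord α
  right_inv' z _ := by
    refine Prod.ext rfl ?_
    change unitOf (l.coord (l.point z.1 z.2).incl) = z.2
    rw [l.coord_point, unitOf_coe]
  open_source := l.isOpen.preimage continuous_incl_proj
  open_target := l.isOpen.prod isOpen_univ
  continuousOn_toFun α hα := (continuous_incl_proj.continuousAt.prodMk
    (contMDiffAt_unitOf (l.contMDiffAt_coord_incl hα)
      (l.coord_ne_zero α)).continuousAt).continuousWithinAt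
  continuousOn_invFun z hz := by
    refine (isEmbedding_incl.continuousAt_iff.2 ?_).continuousWithinAt
    exact (l.contMDiffAt_incl_point (I := (𝓡 C.M.dim).prod 𝓘(ℝ, ℝ)) hz.1 contMDiffAt_fst
      ((Units.contMDiff_val (𝕜 := ℝ) (n := ∞) (R := ℝ)).contMDiffAt.comp z
        contMDiffAt_snd)).continuousAt
  baseSet := l.U
  open_baseSet := l.isOpen
  source_eq := rfl
  target_eq := rfl
  proj_toFun _ _ := rfl

end LocalForm

instance : ContMDiffSMul 𝓘(ℝ, ℝ) (𝓡 (C.M.dim + 1)) ∞ ℝˣ (SymplectizationSpace C) where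
  contMDiff_smul z := by
    refine contMDiffAt_of_incl ?_
    exact contMDiffAt_covector_smul
      ((contMDiff_incl (C := C) z.2).comp (I := 𝓘(ℝ, ℝ).prod (𝓡 (C.M.dim + 1))) z contMDiffAt_snd)
      ((Units.contMDiff_val (𝕜 := ℝ) (n := ∞) (R := ℝ)).contMDiffAt.comp z contMDiffAt_fst)

variable (C) in
/-- The symplectization as a principal `ℝ*`-bundle. -/
abbrev symplectizationBundle : HomogeneousManifold.{u} where
  P := symplectizationMfd C
  M := C.M
  proj := symplectizationProj C
  smooth_proj := contMDiff_symplectizationProj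
  action := inferInstanceAs (MulAction ℝˣ (SymplectizationSpace C))
  smooth_smul := inferInstanceAs
    (ContMDiffSMul 𝓘(ℝ, ℝ) (𝓡 (C.M.dim + 1)) ∞ ℝˣ (SymplectizationSpace C))
  proj_smul _ _ := rfl
  exists_trivialization x := by
    let l := localForm C x
    refine ⟨l.trivialization, l.mem, fun α hα => ?_, fun z hz => ?_, fun α hα t => ?_⟩
    · exact ((contMDiff_symplectizationProj α).prodMk
        (contMDiffAt_unitOf (l.contMDiffAt_coord_incl hα)
          (l.coord_ne_zero α))).contMDiffWithinAt
    · refine (contMDiffAt_of_incl (C := C) ?_).contMDiffWithinAt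
      exact l.contMDiffAt_incl_point (I := (𝓡 C.M.dim).prod 𝓘(ℝ, ℝ)) hz.1 contMDiffAt_fst
        ((Units.contMDiff_val (𝕜 := ℝ) (n := ∞) (R := ℝ)).contMDiffAt.comp z contMDiffAt_snd)
    · change SymplectizationSpace C at α
      change unitOf (l.coord (t • α).incl) = t * unitOf (l.coord α.incl)
      have h := l.coord_ne_zero α
      apply Units.ext
      rw [l.coord_smul, Units.val_mul, coe_unitOf h, coe_unitOf (mul_ne_zero t.ne_zero h)]

end SymplectizationManifold

/-! ### The tautological form and the symplectic form dλ on L* ∖ 0 -/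

section SymplecticStructure

open Set Filter Topology

variable {C : ContactManifold.{u}}

/-- The local section of the symplectization defined by a local contact form. -/
def LocalForm.localSection {x₀ : C.M} (l : LocalForm C x₀) :
    LocalSection (symplectizationBundle C) where
  U := l.U
  σ x := l.point x 1
  c α := unitOf (l.coord (SymplectizationSpace.incl α))
  isOpen := l.isOpen
  proj_σ _ _ := rfl
  smooth_σ x hx := contMDiffAt_of_incl (l.contMDiffAt_incl_point hx contMDiffAt_id
    contMDiffAt_const)
  smooth_c α hα := (l.contMDiffAt_coord_incl hα).congr_of_eventuallyEq
    (Eventually.of_forall fun β => coe_unitOf (l.coord_ne_zero β))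
  c_smul_σ α _ := by
    refine Eq.trans ?_ (l.point_coord α)
    apply incl_injective
    change (⟨_, (unitOf (l.coord (SymplectizationSpace.incl α)) : ℝ) • ((1 : ℝˣ) : ℝ) •
      l.θ (SymplectizationSpace.incl α).proj⟩ : CotangentBundle C.M) =
      ⟨_, (unitOf (l.coord (SymplectizationSpace.incl α)) : ℝ) •
        l.θ (SymplectizationSpace.incl α).proj⟩
    rw [Units.val_one, one_smul]
  c_smul α _ t := by
    change SymplectizationSpace C at α
    change unitOf (l.coord (t • α).incl) = t * unitOf (l.coord α.incl)
    have h := l.coord_ne_zero α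
    apply Units.ext
    rw [l.coord_smul, Units.val_mul, coe_unitOf h, coe_unitOf (mul_ne_zero t.ne_zero h)]

variable (C) in
/-- The tautological 1-form of the symplectization. -/
def tautForm (α : (symplectizationBundle C).P) :
    TangentSpace (𝓡 (symplectizationBundle C).P.dim) α →L[ℝ] ℝ :=
  (SymplectizationSpace.incl α).2.comp
    (mfderiv (𝓡 (symplectizationBundle C).P.dim) (𝓡 C.M.dim) (symplectizationBundle C).proj α)

theorem LocalForm.tautForm_eq {x₀ : C.M} (l : LocalForm C x₀) (α : (symplectizationBundle C).P) :
    tautForm C α = (l.localSection.c α : ℝ) •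
      (pullForm (symplectizationBundle C).proj l.θ : ∀ α : (symplectizationBundle C).P,
        TangentSpace (𝓡 (symplectizationBundle C).P.dim) α →L[ℝ] ℝ) α := by
  have h : (l.localSection.c α : ℝ) = l.coord (SymplectizationSpace.incl α) :=
    coe_unitOf (l.coord_ne_zero α)
  rw [h, tautForm, l.covector_eq α]
  rfl

theorem smoothFormAt_tautForm (α : (symplectizationBundle C).P) :
    SmoothFormAt (tautForm C) α := by
  let l := localForm C (SymplectizationSpace.incl α).proj
  have h1 := (l.smooth_θ _ l.mem).pullForm (f := (symplectizationBundle C).proj)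
    (symplectizationBundle C).smooth_proj.contMDiffAt
  refine (h1.smul (l.localSection.smooth_c α l.mem)).congr ?_
  exact Eventually.of_forall l.tautForm_eq

variable (C) in
/-- The exterior derivative of the tautological 1-form. -/
def symplForm (α : (symplectizationBundle C).P) :
    TangentSpace (𝓡 (symplectizationBundle C).P.dim) α →L[ℝ]
      TangentSpace (𝓡 (symplectizationBundle C).P.dim) α →L[ℝ] ℝ :=
  extD (tautForm C) α

/-- The expansion of d(c π*θ), now for the tautological form, where it precedes non-degeneracy and
is used to prove it. -/
theorem LocalForm.symplForm_apply {x₀ : C.M} (l : LocalForm C x₀)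
    {α : (symplectizationBundle C).P} (hα : (symplectizationBundle C).proj α ∈ l.U)
    (v w : TangentSpace (𝓡 (symplectizationBundle C).P.dim) α) :
    symplForm C α v w = (show ℝ from mfderiv (𝓡 (symplectizationBundle C).P.dim) 𝓘(ℝ, ℝ)
          (fun α => (l.localSection.c α : ℝ)) α v) *
        l.θ ((symplectizationBundle C).proj α) (mfderiv (𝓡 (symplectizationBundle C).P.dim)
          (𝓡 C.M.dim) (symplectizationBundle C).proj α w)
      - (show ℝ from mfderiv (𝓡 (symplectizationBundle C).P.dim) 𝓘(ℝ, ℝ)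
          (fun α => (l.localSection.c α : ℝ)) α w) *
        l.θ ((symplectizationBundle C).proj α) (mfderiv (𝓡 (symplectizationBundle C).P.dim)
          (𝓡 C.M.dim) (symplectizationBundle C).proj α v)
      + l.localSection.c α * extD l.θ ((symplectizationBundle C).proj α)
        (mfderiv (𝓡 (symplectizationBundle C).P.dim)
          (𝓡 C.M.dim) (symplectizationBundle C).proj α v)
        (mfderiv (𝓡 (symplectizationBundle C).P.dim)
          (𝓡 C.M.dim) (symplectizationBundle C).proj α w) := by
  have hπ := (symplectizationBundle C).smooth_proj.contMDiffAt (x := α)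
  rw [symplForm, extD_congr (Eventually.of_forall l.tautForm_eq),
    extD_smul ((l.smooth_θ _ hα).pullForm hπ) (l.localSection.smooth_c α hα),
    extD_pullForm (l.smooth_θ _ hα) hπ]
  rfl

/-- dc(E) = c and dπ(E) = 0 reduce the local formula to c π*θ. The Liouville form of the
symplectization is thus the tautological form. -/
theorem symplForm_euler (α : (symplectizationBundle C).P)
    (w : TangentSpace (𝓡 (symplectizationBundle C).P.dim) α) :
    symplForm C α (euler α) w = tautForm C α w := by
  let l := localForm C (SymplectizationSpace.incl α).proj
  have h0 := mfderiv_proj_euler (Q := symplectizationBundle C) α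
  have h1 := l.localSection.mfderiv_c_euler (p := α) l.mem
  have h2 := congrArg (fun L => L w) (l.tautForm_eq α)
  refine (l.symplForm_apply l.mem _ _).trans ?_
  refine Eq.trans ?_ h2.symm
  rw [h0, h1, map_zero, map_zero, mul_zero, sub_zero]
  change _ + _ * (0 : ℝ) = _
  rw [mul_zero, add_zero]
  rfl

/-- Let v be in the radical. Pairing with E gives λ(v) = 0, so V = dπ(v) is in H. Pairing with lifts
of vectors u in H gives dθ(V, u) = 0, so V = 0 by the contact condition. Hence v = aE, and pairing
with a lift of Y, where λ takes the value c ≠ 0, gives a = 0. -/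
theorem symplForm_nondegenerate (α : (symplectizationBundle C).P)
    (v : TangentSpace (𝓡 (symplectizationBundle C).P.dim) α)
    (hv : ∀ w, symplForm C α v w = 0) : v = 0 := by
  let l := localForm C (SymplectizationSpace.incl α).proj
  have hlα : (symplectizationBundle C).proj α ∈ l.U := l.mem
  let c : ℝ := l.localSection.c α
  have hc : c ≠ 0 := (l.localSection.c α).ne_zero
  let V : EuclideanSpace ℝ (Fin C.M.dim) := mfderiv (𝓡 (symplectizationBundle C).P.dim)
    (𝓡 C.M.dim) (symplectizationBundle C).proj α v
  have hskew : symplForm C α (euler α) v = 0 := by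
    rw [symplForm, extD_swap]
    exact neg_eq_zero.2 (hv _)
  have hV : l.θ ((symplectizationBundle C).proj α) V = 0 := by
    have h1 := (symplForm_euler α v).symm.trans hskew
    rw [l.tautForm_eq α] at h1
    exact (mul_eq_zero.1 h1).resolve_left hc
  have hVH : V ∈ C.H ((symplectizationBundle C).proj α) := by
    rw [← l.ker_θ]; exact hV
  have hV0 : (mfderiv (𝓡 (symplectizationBundle C).P.dim)
      (𝓡 C.M.dim) (symplectizationBundle C).proj α v) = 0 := by
    by_contra hne
    obtain ⟨u, hu, hne'⟩ := C.isContact.extD_nondegenerate (Eventually.of_forall l.ker_θ)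
      (l.smooth_θ _ hlα) hVH hne
    obtain ⟨w, rfl⟩ := mfderiv_proj_surjective (Q := symplectizationBundle C) α u
    rw [← l.ker_θ] at hu
    have hu' : l.θ ((symplectizationBundle C).proj α) (mfderiv
      (𝓡 (symplectizationBundle C).P.dim) (𝓡 C.M.dim) (symplectizationBundle C).proj α w) = 0 := hu
    have h1 := (l.symplForm_apply hlα v w).symm.trans (hv w)
    rw [hu'] at h1
    have h2 : _ * (0 : ℝ) - _ * l.θ ((symplectizationBundle C).proj α) V + c * _ = 0 := h1
    rw [hV, mul_zero, mul_zero, sub_zero, zero_add] at h2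
    exact hne' ((mul_eq_zero.1 h2).resolve_left hc)
  obtain ⟨a, rfl⟩ := eq_smul_euler_of_mfderiv_proj_eq_zero (Q := symplectizationBundle C) hV0
  obtain ⟨w, hw⟩ := mfderiv_proj_surjective (Q := symplectizationBundle C) α
    (l.Y ((symplectizationBundle C).proj α))
  have h1 : a * symplForm C α (euler α) w = 0 := by
    refine Eq.trans ?_ (hv w)
    exact (congrArg (fun L : TangentSpace (𝓡 (symplectizationBundle C).P.dim) α →L[ℝ] ℝ => L w)
      (map_smul (symplForm C α) a (euler α))).symm
  rw [symplForm_euler, l.tautForm_eq α] at h1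
  have h2 : a * (c * l.θ ((symplectizationBundle C).proj α) (mfderiv
      (𝓡 (symplectizationBundle C).P.dim) (𝓡 C.M.dim) (symplectizationBundle C).proj α w)) = 0 :=
    h1
  have h3 : l.θ ((symplectizationBundle C).proj α) (mfderiv
      (𝓡 (symplectizationBundle C).P.dim) (𝓡 C.M.dim) (symplectizationBundle C).proj α w) = 1 :=
    (congrArg (l.θ ((symplectizationBundle C).proj α)) hw).trans (l.θ_Y _)
  rw [h3, mul_one] at h2
  rw [(mul_eq_zero.1 h2).resolve_right hc, zero_smul]

theorem tautForm_smul (t : ℝˣ) :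
    (pullForm (fun β : (symplectizationBundle C).P => t • β) (tautForm C) :
      ∀ α : (symplectizationBundle C).P,
        TangentSpace (𝓡 (symplectizationBundle C).P.dim) α →L[ℝ] ℝ) =
      fun α => (t : ℝ) • tautForm C α := by
  funext α
  ext v
  have h := mfderiv_proj_of_covers (Q := symplectizationBundle C) (Q' := symplectizationBundle C)
    (f := fun β => t • β) (φ := id) (contMDiff_smul_const t) contMDiff_id (fun _ => rfl) α v
  rw [mfderiv_id] at h
  exact congrArg (fun u : EuclideanSpace ℝ (Fin C.M.dim) => (t : ℝ) *
    (show EuclideanSpace ℝ (Fin C.M.dim) →L[ℝ] ℝ from (SymplectizationSpace.incl α).2) u) h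

theorem symplForm_homogeneous (t : ℝˣ) (α : (symplectizationBundle C).P)
    (v w : TangentSpace (𝓡 (symplectizationBundle C).P.dim) α) :
    symplForm C (t • α) (mfderiv (𝓡 (symplectizationBundle C).P.dim)
      (𝓡 (symplectizationBundle C).P.dim) (fun β : (symplectizationBundle C).P => t • β) α v)
      (mfderiv (𝓡 (symplectizationBundle C).P.dim)
      (𝓡 (symplectizationBundle C).P.dim) (fun β : (symplectizationBundle C).P => t • β) α w) =
      t * symplForm C α v w := by
  have h1 := extD_pullForm (smoothFormAt_tautForm (t • α))
    (contMDiff_smul_const (Q := symplectizationBundle C) t).contMDiffAt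
  rw [tautForm_smul] at h1
  have h2 := extD_smul (c := fun _ => (t : ℝ)) (smoothFormAt_tautForm α) contMDiffAt_const v w
  have h3 := congrArg (fun L : EuclideanSpace ℝ (Fin (C.M.dim + 1)) →L[ℝ]
    EuclideanSpace ℝ (Fin (C.M.dim + 1)) →L[ℝ] ℝ => L v w) h1
  refine h3.symm.trans (h2.trans ?_)
  rw [mfderiv_const]
  change 0 * _ - 0 * _ + _ = _
  rw [zero_mul, zero_mul, sub_zero, zero_add]
  rfl

variable (C) in
/-- The symplectization of a contact manifold. -/
abbrev symplectization : HomogeneousSymplecticManifold.{u} where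
  toHomogeneousManifold := symplectizationBundle C
  Ω := symplForm C
  isSymplectic :=
    { smooth := fun _ => smoothForm₂At_extD (Eventually.of_forall smoothFormAt_tautForm)
      alternating := fun α => extD_self (tautForm C) α
      closed := fun _ _ _ hX hY hZ α => dTwoForm_extD
        (Eventually.of_forall smoothFormAt_tautForm) (hX α) (hY α) (hZ α)
      nondegenerate := symplForm_nondegenerate }
  homogeneous := symplForm_homogeneous

theorem isSymplectization_incl :
    IsSymplectization C (symplectization C) SymplectizationSpace.incl where
  smooth := contMDiff_incl
  isEmbedding := isEmbedding_incl
  immersion α := by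
    change SymplectizationSpace C at α
    let l := localForm C α.incl.proj
    have h1 : MDifferentiableAt (cotangentModel C.M) (𝓡 (C.M.dim + 1)) l.chartFun α.incl :=
      (l.contMDiffAt_chartFun (f := id) (I := cotangentModel C.M) l.mem
        contMDiffAt_id).mdifferentiableAt (by simp)
    have h2 : MDifferentiableAt (𝓡 (C.M.dim + 1)) (cotangentModel C.M)
        (SymplectizationSpace.incl (C := C)) α := contMDiff_incl.mdifferentiableAt (by simp)
    have h3 := mfderiv_comp α h1 h2
    -- `l.chartFun ∘ incl` is the preferred chart at α, with identity derivative there; so the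
    -- derivative of the inclusion has a left inverse.
    have h4 : (show EuclideanSpace ℝ (Fin (C.M.dim + 1)) →L[ℝ] EuclideanSpace ℝ (Fin (C.M.dim + 1))
        from mfderiv (𝓡 (C.M.dim + 1)) (𝓡 (C.M.dim + 1)) (l.chartFun ∘ SymplectizationSpace.incl) α)
        = ContinuousLinearMap.id ℝ _ := mfderiv_extChartAt_self (I := 𝓡 (C.M.dim + 1)) (x := α)
    have h5 := h3.symm.trans h4
    intro v w hvw
    have h6 : ∀ u : EuclideanSpace ℝ (Fin (C.M.dim + 1)),
        (show EuclideanSpace ℝ (Fin (C.M.dim + 1)) from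
          mfderiv (cotangentModel C.M) (𝓡 (C.M.dim + 1)) l.chartFun α.incl
          (mfderiv (𝓡 (C.M.dim + 1)) (cotangentModel C.M) SymplectizationSpace.incl α u)) = u :=
      fun u => congrArg (fun L : EuclideanSpace ℝ (Fin (C.M.dim + 1)) →L[ℝ]
        EuclideanSpace ℝ (Fin (C.M.dim + 1)) => L u) h5
    exact (h6 v).symm.trans ((congrArg (mfderiv (cotangentModel C.M) (𝓡 (C.M.dim + 1))
      l.chartFun α.incl) hvw).trans (h6 w))
  range_eq := Subtype.range_val
  map_smul _ _ := rfl
  Ω_eq X Y hX hY α :=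
    (dOneForm_eq_extD (smoothFormAt_tautForm α) (hX α) (hY α)).symm

/-- On the symplectization the abstract covector of a point is the point itself, because ι_E dλ = λ.
Lifts in the sense of `IsLiftAt` are therefore the classical cotangent lifts, and the recovered
distribution is the original one. -/
theorem covector_symplectization (α : (symplectization C).P) :
    covector α = (SymplectizationSpace.incl α).2 := by
  refine covector_unique ?_
  ext w
  exact symplForm_euler α w

theorem baseContact_symplectization : baseContact (symplectization C) = C.H := by
  funext x
  obtain ⟨α, rfl⟩ := proj_surjective (symplectization C).toHomogeneousManifold x
  rw [← ker_covector, covector_symplectization]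
  exact α.2

end SymplecticStructure

/-! ### The symplectization functor and the equivalence -/

section Functor

open CategoryTheory

theorem IsLiftAt.id {S : HomogeneousSymplecticManifold.{u}} (p : S.P) :
    IsLiftAt (Diffeomorph.refl (𝓡 S.M.dim) S.M ∞) p p := by
  refine ⟨rfl, ?_⟩
  have h : (show EuclideanSpace ℝ (Fin S.M.dim) →L[ℝ] EuclideanSpace ℝ (Fin S.M.dim) from
      mfderiv (𝓡 S.M.dim) (𝓡 S.M.dim) (Diffeomorph.refl (𝓡 S.M.dim) S.M ∞) (S.proj p)) =
      ContinuousLinearMap.id ℝ _ := mfderiv_id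
  rw [h]
  rfl

theorem IsLiftAt.trans {S S' S'' : HomogeneousSymplecticManifold.{u}}
    {Φ : Diffeomorph (𝓡 S.M.dim) (𝓡 S'.M.dim) S.M S'.M ∞}
    {Ψ : Diffeomorph (𝓡 S'.M.dim) (𝓡 S''.M.dim) S'.M S''.M ∞} {p : S.P} {q : S'.P} {r : S''.P}
    (h : IsLiftAt Φ p q) (h' : IsLiftAt Ψ q r) : IsLiftAt (Φ.trans Ψ) p r := by
  refine ⟨h'.proj_eq.trans (congrArg Ψ h.proj_eq), ?_⟩
  have h1 := mfderiv_trans_apply Φ Ψ (S.proj p)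
  have h2 : (show EuclideanSpace ℝ (Fin S'.M.dim) →L[ℝ] EuclideanSpace ℝ (Fin S''.M.dim) from
      mfderiv (𝓡 S'.M.dim) (𝓡 S''.M.dim) Ψ (S'.proj q)) =
      mfderiv (𝓡 S'.M.dim) (𝓡 S''.M.dim) Ψ (Φ (S.proj p)) :=
    congrArg (fun x => (show EuclideanSpace ℝ (Fin S'.M.dim) →L[ℝ] EuclideanSpace ℝ (Fin S''.M.dim)
      from mfderiv (𝓡 S'.M.dim) (𝓡 S''.M.dim) Ψ x)) h.proj_eq
  have h3 := h'.covector_eq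
  rw [h2] at h3
  refine Eq.trans ?_ h.covector_eq
  rw [← h3]
  exact congrArg (fun L => (show EuclideanSpace ℝ (Fin S''.M.dim) →L[ℝ] ℝ from
    covector r).comp L) h1

theorem preservesDistribution_contactomorphism {C C' : ContactManifold.{u}}
    (Φ : Contactomorphism C C') : PreservesDistribution (baseContact (symplectization C))
      (baseContact (symplectization C')) Φ.toDiffeo := by
  rw [baseContact_symplectization, baseContact_symplectization]
  exact preservesDistribution_iff.2 Φ.map_H

/-- The cotangent lift of a contactomorphism. -/
def symplectizationMap {C C' : ContactManifold.{u}} (Φ : Contactomorphism C C') :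
    EquivariantSymplectomorphism (symplectization C) (symplectization C') :=
  Classical.choose (exists_lift (preservesDistribution_contactomorphism Φ))

theorem isLiftAt_symplectizationMap {C C' : ContactManifold.{u}} (Φ : Contactomorphism C C')
    (α : (symplectization C).P) :
    IsLiftAt (S := symplectization C) (S' := symplectization C') Φ.toDiffeo α
      ((symplectizationMap Φ).toDiffeo α) :=
  Classical.choose_spec (exists_lift (preservesDistribution_contactomorphism Φ)) α

/-- The symplectization functor. -/
def symplectizationFunctor : ContactManifold.{u} ⥤ HomogeneousSymplecticManifold.{u} where
  obj C := symplectization C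
  map Φ := symplectizationMap Φ
  map_id C := EquivariantSymplectomorphism.ext_of_isLiftAt
    (Φ := Diffeomorph.refl (𝓡 C.M.dim) C.M ∞)
    (isLiftAt_symplectizationMap (Contactomorphism.refl C)) IsLiftAt.id
  map_comp Φ Ψ := EquivariantSymplectomorphism.ext_of_isLiftAt
    (isLiftAt_symplectizationMap (Contactomorphism.trans Φ Ψ))
    fun α => (isLiftAt_symplectizationMap Φ α).trans (isLiftAt_symplectizationMap Ψ _)

/-- A lift covers the contactomorphism it comes from, and every point of the base lies under some α.
-/
instance : (symplectizationFunctor.{u}).Faithful where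
  map_injective {C C'} Φ Ψ h := by
    refine Contactomorphism.ext (Diffeomorph.ext fun x => ?_)
    obtain ⟨α, rfl⟩ := proj_surjective (symplectization C).toHomogeneousManifold x
    have h1 := (isLiftAt_symplectizationMap Φ α).proj_eq
    have h2 := (isLiftAt_symplectizationMap Ψ α).proj_eq
    have h3 : symplectizationMap Φ = symplectizationMap Ψ := h
    rw [h3] at h1
    exact h1.symm.trans h2

/-- f and the image of the contactomorphism it induces are lifts of the same map, so they agree. -/
instance : (symplectizationFunctor.{u}).Full where
  map_surjective {C C'} f := by
    obtain ⟨Φ, hΦ, hp⟩ := exists_base_diffeomorph (S := symplectization C)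
      (S' := symplectization C') f
    rw [baseContact_symplectization, baseContact_symplectization] at hp
    let Φ' : Contactomorphism C C' := ⟨Φ, preservesDistribution_iff.1 hp⟩
    exact ⟨Φ', EquivariantSymplectomorphism.ext_of_isLiftAt (isLiftAt_symplectizationMap Φ') hΦ⟩

theorem preservesDistribution_refl {A : Mfd.{u}}
    (H : ∀ x : A, Submodule ℝ (TangentSpace (𝓡 A.dim) x)) :
    PreservesDistribution H H (Diffeomorph.refl (𝓡 A.dim) A ∞) := by
  intro x v
  rw [Diffeomorph.coe_refl, mfderiv_id]
  rfl

/-- The base of S with its canonical distribution is the preimage. The identity of the base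
preserves the distribution, so it lifts in both directions, and the composites are lifts of the
identity. -/
instance : (symplectizationFunctor.{u}).EssSurj where
  mem_essImage S := by
    let C := baseContactManifold S
    have h := preservesDistribution_refl (A := S.M) (baseContact S)
    have hC : baseContact (symplectization C) = baseContact S := baseContact_symplectization
    obtain ⟨f, hf⟩ := exists_lift (S := symplectization C) (S' := S)
      (Φ := Diffeomorph.refl (𝓡 S.M.dim) S.M ∞) (by rw [hC]; exact h)
    obtain ⟨g, hg⟩ := exists_lift (S := S) (S' := symplectization C)
      (Φ := Diffeomorph.refl (𝓡 S.M.dim) S.M ∞) (by rw [hC]; exact h)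
    exact ⟨C, ⟨⟨f, g,
      EquivariantSymplectomorphism.ext_of_isLiftAt (S := symplectization C)
        (S' := symplectization C) (Φ := Diffeomorph.refl (𝓡 S.M.dim) S.M ∞)
        (fun α => (hf α).trans (hg _)) IsLiftAt.id,
      EquivariantSymplectomorphism.ext_of_isLiftAt (S := S) (S' := S)
        (Φ := Diffeomorph.refl (𝓡 S.M.dim) S.M ∞)
        (fun p => (hg p).trans (hf _)) IsLiftAt.id⟩⟩⟩

instance : (symplectizationFunctor.{u}).IsEquivalence where

theorem isSymplectizationFunctor_symplectizationFunctor :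
    IsSymplectizationFunctor symplectizationFunctor.{u} := by
  refine ⟨fun C => SymplectizationSpace.incl, fun C => isSymplectization_incl, ?_⟩
  intro C C' Φ α
  have h := isLiftAt_symplectizationMap Φ α
  have h1 := h.proj_eq
  have h2 := h.covector_eq
  rw [covector_symplectization] at h2
  -- The required β is the covector of the image point, moved to the fibre over Φ(x) by substituting
  -- the equality of base points.
  have key : ∀ (γ : CotangentBundle C'.M) (y : C'.M)
      (L : EuclideanSpace ℝ (Fin C.M.dim) →L[ℝ] EuclideanSpace ℝ (Fin C'.M.dim))
      (δ : EuclideanSpace ℝ (Fin C.M.dim) →L[ℝ] ℝ), γ.proj = y →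
      (show EuclideanSpace ℝ (Fin C'.M.dim) →L[ℝ] ℝ from γ.2).comp L = δ →
      ∃ β : TangentSpace (𝓡 C'.M.dim) y →L[ℝ] ℝ, γ = ⟨y, β⟩ ∧
        (show EuclideanSpace ℝ (Fin C'.M.dim) →L[ℝ] ℝ from β).comp L = δ := by
    rintro γ y L δ rfl h
    exact ⟨γ.2, rfl, h⟩
  exact key _ _ _ _ h1 (h2.trans (covector_symplectization α))

end Functor

end ContactDictionary

end

theorem theorem5p2 :
    ∃ e : CategoryTheory.Equivalence ContactDictionary.ContactManifold.{u}
        ContactDictionary.HomogeneousSymplecticManifold.{u},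
      ContactDictionary.IsSymplectizationFunctor e.functor :=
  ⟨ContactDictionary.symplectizationFunctor.asEquivalence,
    ContactDictionary.isSymplectizationFunctor_symplectizationFunctor⟩
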